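/- **Setting.** Let $d,p\ge 1$ and $k\ge 0$ be integers, $\Omega\subset\mathbb R^d$ a bounded Lipschitz domain, and $\mathcal T_0,\dots,\mathcal T_L$ regular (face-to-face) subdivisions of $\overline\Omega$ into finitely many nondegenerate simplices, such that every cell of $\mathcal T_{\ell-1}$ is a union of cells of $\mathcal T_\ell$. Let $h_\ell$ be the largest cell diameter of $\mathcal T_\ell$. Assume there are constants $\sigma,\kappa,c_{\rm ref}>0$ such that, for all $\ell$: every $T\in\mathcal T_\ell$ contains a ball of radius $r>0$ with $\operatorname{diam}T\le\sigma r$ (shape regularity), $h_\ell\le \kappa\operatorname{diam}T$ for all $T\in\mathcal T_\ell$ (quasi-uniformity), and $h_\ell\ge c_{\rm ref}h_{\ell-1}$ for $\ell\ge1$. Let $\mathcal F_\ell$ be the set of faces ($(d-1)$-dimensional facets of cells) of $\mathcal T_\ell$, and let $M_\ell$ be the space of functions $\lambda$ on the faces with $\lambda|_F\in\mathcal P_p(F)$ for all $F\in\mathcal F_\ell$ and $\lambda|_F=0$ if $F\subset\partial\Omega$. Put $$\|\mu\|_\ell^2=\sum_{T\in\mathcal T_\ell}\frac{|T|}{|\partial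 T|}\int_{\partial T}\mu^2\,ds ,$$ also for functions that are double-valued on interior faces, with $ds$ the surface measure, and let $\|\cdot\|_0$ be the norm of $L^2(\Omega)$. Let $\overline V^c_\ell=\{w\in H^1_0(\Omega): w|_T\in\mathcal P_1(T)\ \forall T\in\mathcal T_\ell\}$ and let $\gamma_\ell w$ be the trace of $w$ on the faces of $\mathcal T_\ell$. **HDG method.** On every cell let $V_T\subset\mathcal P_k(T)$ and $W_T\subset\mathcal P_k(T)^d$ be linear spaces, and let $\tau_\ell\ge0$. Assume that for every $\lambda\in M_\ell$ and $T\in\mathcal T_\ell$ there is exactly one pair $(u,\vec q)\in V_T\times W_T$ such that, with outward unit normal $\vec\nu$, $$\int_T\vec q\cdot\vec p\,dx-\int_T u\,\nabla\!\cdot\vec p\,dx=-\int_{\partial T}\lambda\,\vec p\cdot\vec\nu\,ds\quad\forall\vec p\in W_T,$$ $$\int_{\partial T}(\vec q\cdot\vec\nu+\tau_\ell u)v\,ds-\int_T\vec q\cdot\nabla v\,dx=\tau_\ell\int_{\partial T}\lambda v\,ds\quad\forall v\in V_T,$$ and define $\mathcal U_\ell\lambda|_T=u$, $\mathcal Q_\ell\lambda|_T=\vec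 q$ (with $\nabla\,\mathcal U_\ell\lambda$ taken cellwise). Let $$a_\ell(\lambda,\mu)=\int_\Omega\mathcal Q_\ell\lambda\cdot\mathcal Q_\ell\mu\,dx+\sum_{T\in\mathcal T_\ell}\int_{\partial T}\tau_\ell(\mathcal U_\ell\lambda-\lambda)(\mathcal U_\ell\mu-\mu)\,ds,\qquad \|\mu\|_{a_\ell}^2=a_\ell(\mu,\mu).$$ **Assumptions.** Let $I_\ell:M_{\ell-1}\to M_\ell$ ($1\le\ell\le L$) be linear, and assume that with a constant $K$ the following hold on all levels, for all $\mu\in M_\ell$, $\lambda\in M_{\ell-1}$: - (LS1) $\|\mathcal U_\ell\mu-\mu\|_\ell\le K h_\ell\|\mathcal Q_\ell\mu\|_0$; - (LS2) $\|\mathcal Q_\ell\mu\|_0\le K h_\ell^{-1}\|\mu\|_\ell$ and $\|\mathcal U_\ell\mu\|_0\le K\|\mu\|_\ell$; - (LS3) $\|\mathcal Q_\ell\mu+\nabla\,\mathcal U_\ell\mu\|_0\le K h_\ell^{-1}\|\mathcal U_\ell\mu-\mu\|_\ell$; - (LS4) $\mathcal Q_\ell\gamma_\ell w=-\nabla w$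 and $\mathcal U_\ell\gamma_\ell w=w$ for all $w\in\overline V^c_\ell$; - (IA1) $\|I_\ell\lambda\|_\ell\le K\|\lambda\|_{\ell-1}$; - (IA2) $I_\ell\gamma_{\ell-1}w=\gamma_\ell w$ for all $w\in\overline V^c_{\ell-1}$; - $\tau_\ell h_\ell\le K$. **Lemma.** There is a constant $C>0$, depending only on $d,p,k,\sigma,\kappa,c_{\rm ref},K$ (in particular not on $\Omega$, the meshes, $h_\ell$, $\ell$ or $L$), such that for every $1\le\ell\le L$ and every $\lambda\in M_\ell$ there is exactly one $P_{\ell-1}\lambda\in M_{\ell-1}$ with $a_{\ell-1}(P_{\ell-1}\lambda,\mu)=a_\ell(\lambda,I_\ell\mu)$ for all $\mu\in M_{\ell-1}$, and $$\|\lambda-I_\ell P_{\ell-1}\lambda\|_{a_\ell}\le C\,\|\lambda\|_{a_\ell}.$$ -/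

import Mathlib

open MeasureTheory Set Filter Topology
open scoped ContDiff ENNReal

namespace HDG

noncomputable section

/-- Euclidean space `ℝ^d`. -/
abbrev Pt (d : ℕ) : Type := EuclideanSpace ℝ (Fin d)

/-- Polynomials in the `d` coordinates. -/
abbrev Poly (d : ℕ) : Type := MvPolynomial (Fin d) ℝ

/-- The function on `ℝ^d` given by a polynomial. -/
def polyFun {d : ℕ} (q : Poly d) (x : Pt d) : ℝ := MvPolynomial.eval (fun i => x i) q

/-- Bounded Lipschitz domain: open, connected, nonempty, bounded, and near every boundary point
equal to the strict epigraph of a Lipschitz function `g` of the coordinates orthogonal to some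
unit vector `e`. -/
def IsLipschitzDomain {d : ℕ} (Ω : Set (Pt d)) : Prop :=
  IsOpen Ω ∧ IsConnected Ω ∧ Bornology.IsBounded Ω ∧
    ∀ x ∈ frontier Ω, ∃ (r : ℝ) (e : Pt d) (g : Pt d → ℝ) (K : NNReal),
      0 < r ∧ ‖e‖ = 1 ∧ LipschitzWith K g ∧ (∀ (y : Pt d) (t : ℝ), g (y + t • e) = g y) ∧
        Ω ∩ Metric.ball x r = {y ∈ Metric.ball x r | g y < inner ℝ e y}

/-- Membership in `H^1_0(Ω)`, the closure of `C_c^∞(Ω)` in the norm of `H^1(Ω)`: the functions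
`φ n` and their gradients converge in `L²(Ω)`, the former to `w`. -/
def MemH10 {d : ℕ} (Ω : Set (Pt d)) (w : Pt d → ℝ) : Prop :=
  MemLp w 2 (volume.restrict Ω) ∧
    ∃ (G : Pt d → Pt d) (φ : ℕ → Pt d → ℝ),
      MemLp G 2 (volume.restrict Ω) ∧
      (∀ n, ContDiff ℝ ∞ (φ n) ∧ HasCompactSupport (φ n) ∧ tsupport (φ n) ⊆ Ω) ∧
      Tendsto (fun n => eLpNorm (fun x => φ n x - w x) 2 (volume.restrict Ω)) atTop (𝓝 0) ∧
      Tendsto (fun n => eLpNorm (fun x => gradient (φ n) x - G x) 2 (volume.restrict Ω))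
        atTop (𝓝 0)

/-- The closed simplex spanned by a finite set of vertices. -/
def hull {d : ℕ} (s : Finset (Pt d)) : Set (Pt d) := convexHull ℝ (s : Set (Pt d))

/-- The facet of the simplex `hull s` opposite to the vertex `v ∈ s`. -/
def facet {d : ℕ} (s : Finset (Pt d)) (v : Pt d) : Set (Pt d) :=
  convexHull ℝ ((s : Set (Pt d)) \ {v})

/-- The outward unit normal of the simplex `hull s` on the facet opposite to `v`: the vector
`∑ y ∈ s, (y - v)` points from `v` towards the facet; its component orthogonal to the facet
is normalized. -/
def outwardNormal {d : ℕ} (s : Finset (Pt d)) (v : Pt d) : Pt d :=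
  let n : Pt d := (vectorSpan ℝ ((s : Set (Pt d)) \ {v}))ᗮ.starProjection (∑ y ∈ s, (y - v))
  ‖n‖⁻¹ • n

/-- Integration over `hull s` with respect to Lebesgue measure. -/
def cellInt {d : ℕ} (s : Finset (Pt d)) (f : Pt d → ℝ) : ℝ := ∫ x in hull s, f x

/-- Integration over a facet with respect to surface measure. -/
def facetInt {d : ℕ} (F : Set (Pt d)) (f : Pt d → ℝ) : ℝ :=
  ∫ x in F, f x ∂(Measure.euclideanHausdorffMeasure (d - 1))

/-- A regular (face-to-face) subdivision of `Ω` into finitely many nondegenerate simplices;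
a cell is given by its set of `d + 1` vertices. -/
structure SimplicialMesh {d : ℕ} (Ω : Set (Pt d)) where
  cells : Finset (Finset (Pt d))
  card_eq : ∀ s ∈ cells, s.card = d + 1
  indep : ∀ s ∈ cells, AffineIndependent ℝ (fun x : s => (x : Pt d))
  inter_eq : ∀ s ∈ cells, ∀ t ∈ cells,
    hull s ∩ hull t = convexHull ℝ ((s : Set (Pt d)) ∩ (t : Set (Pt d)))
  cover : ⋃ s ∈ cells, hull s = closure Ω

namespace SimplicialMesh

variable {d : ℕ} {Ω : Set (Pt d)}

/-- The set of faces of the mesh. -/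
def faces (T : SimplicialMesh Ω) : Set (Set (Pt d)) :=
  {F | ∃ s ∈ T.cells, ∃ v ∈ s, F = facet s v}

/-- The mesh size: the largest diameter of a cell. -/
def meshSize (T : SimplicialMesh Ω) : ℝ :=
  ⨆ s : {s : Finset (Pt d) // s ∈ T.cells}, Metric.diam (hull s.1)

/-- Every cell contains a ball whose radius is at least `1 / σ` times the cell diameter. -/
def ShapeRegular (T : SimplicialMesh Ω) (σ : ℝ) : Prop :=
  ∀ s ∈ T.cells, ∃ (x : Pt d) (r : ℝ), 0 < r ∧ Metric.diam (hull s) ≤ σ * r ∧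
    Metric.closedBall x r ⊆ hull s

/-- All cell diameters are comparable to the mesh size. -/
def QuasiUniform (T : SimplicialMesh Ω) (q : ℝ) : Prop :=
  ∀ s ∈ T.cells, T.meshSize ≤ q * Metric.diam (hull s)

/-- Every cell of the coarse mesh `Tc` is a union of cells of the fine mesh `Tf`. -/
def Refines (Tf Tc : SimplicialMesh Ω) : Prop :=
  ∀ s ∈ Tc.cells, ∃ A ⊆ Tf.cells, hull s = ⋃ t ∈ A, hull t

/-- The skeletal space `M`: to every face `F` is assigned a polynomial function of degree at most
`p` on `F`, which is zero if `F` lies in the boundary of `Ω`. So that functions on different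
faces have a common type, the function on `F` is extended by zero to `ℝ^d`, and sets that are
not faces are assigned the zero function. -/
def skeletal (T : SimplicialMesh Ω) (p : ℕ) : Submodule ℝ (Set (Pt d) → Pt d → ℝ) where
  carrier := {μ |
    (∀ F ∈ T.faces, ∃ q : Poly d, q.totalDegree ≤ p ∧ μ F = F.indicator (polyFun q)) ∧
    (∀ F ∈ T.faces, F ⊆ frontier Ω → μ F = 0) ∧
    (∀ F, F ∉ T.faces → μ F = 0)}
  zero_mem' := by
    refine ⟨fun F _ => ⟨0, by simp, ?_⟩, fun _ _ _ => rfl, fun _ _ => rfl⟩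
    funext x
    simp [polyFun, Set.indicator]
  add_mem' := by
    rintro a b ⟨ha, ha', ha''⟩ ⟨hb, hb', hb''⟩
    refine ⟨fun F hF => ?_, fun F hF h => ?_, fun F hF => ?_⟩
    · obtain ⟨q, hq, hqa⟩ := ha F hF
      obtain ⟨r, hr, hrb⟩ := hb F hF
      refine ⟨q + r, (MvPolynomial.totalDegree_add q r).trans (max_le hq hr), ?_⟩
      funext x
      by_cases hx : x ∈ F <;> simp [hqa, hrb, polyFun, hx]
    · simp [ha' F hF h, hb' F hF h]
    · simp [ha'' F hF, hb'' F hF]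
  smul_mem' := by
    rintro c a ⟨ha, ha', ha''⟩
    refine ⟨fun F hF => ?_, fun F hF h => ?_, fun F hF => ?_⟩
    · obtain ⟨q, hq, hqa⟩ := ha F hF
      refine ⟨c • q, (MvPolynomial.totalDegree_smul_le c q).trans hq, ?_⟩
      funext x
      by_cases hx : x ∈ F <;> simp [hqa, polyFun, hx]
    · simp [ha' F hF h]
    · simp [ha'' F hF]

/-- The space of functions in `H^1_0(Ω)` that are polynomial of degree at most one on every
cell (represented by their values on the closed cells). -/
def conforming (T : SimplicialMesh Ω) : Set (Pt d → ℝ) :=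
  {w | MemH10 Ω w ∧
    ∀ s ∈ T.cells, ∃ q : Poly d, q.totalDegree ≤ 1 ∧ ∀ x ∈ hull s, w x = polyFun q x}

/-- The trace operator: restriction of a function to every face of the mesh. -/
def trace (T : SimplicialMesh Ω) (w : Pt d → ℝ) : Set (Pt d) → Pt d → ℝ :=
  T.faces.indicator fun F => F.indicator w

/-- `|T| / |∂T|` for a cell. -/
def cellRatio (s : Finset (Pt d)) : ℝ :=
  cellInt s (fun _ => 1) / ∑ v ∈ s, facetInt (facet s v) (fun _ => 1)

/-- The norm `‖f‖_ℓ`, where `‖f‖_ℓ² = ∑_T |T| / |∂T| ∫_{∂T} f²`, of a function `f` on the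
boundaries of the cells; `f s F` is its value on the facet `F` as seen from the cell `s`. -/
def bdryNorm (T : SimplicialMesh Ω) (f : Finset (Pt d) → Set (Pt d) → Pt d → ℝ) : ℝ :=
  √(∑ s ∈ T.cells, cellRatio s *
      ∑ v ∈ s, facetInt (facet s v) fun x => f s (facet s v) x ^ 2)

/-- The norm `‖μ‖_ℓ` of a skeletal function. -/
def skelNorm (T : SimplicialMesh Ω) (μ : Set (Pt d) → Pt d → ℝ) : ℝ :=
  T.bdryNorm fun _ F x => μ F x

/-- The `L²(Ω)` norm of a piecewise polynomial function; `u s` is the polynomial on `s`. -/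
def norm0 (T : SimplicialMesh Ω) (u : Finset (Pt d) → Poly d) : ℝ :=
  √(∑ s ∈ T.cells, cellInt s fun x => polyFun (u s) x ^ 2)

/-- The `L²(Ω; ℝ^d)` norm of a piecewise polynomial vector field. -/
def vecNorm0 (T : SimplicialMesh Ω) (q : Finset (Pt d) → Fin d → Poly d) : ℝ :=
  √(∑ s ∈ T.cells, cellInt s fun x => ∑ i, polyFun (q s i) x ^ 2)

end SimplicialMesh

/-- The data of an HDG method on a mesh: on every cell, a local space `V` of polynomials and a
local space `W` of polynomial vector fields, of degree at most `k`, and the penalty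
coefficient `τ` (zero is allowed, as for hybridized mixed methods). -/
structure Method {d : ℕ} {Ω : Set (Pt d)} (k : ℕ) (T : SimplicialMesh Ω) where
  V : Finset (Pt d) → Submodule ℝ (Poly d)
  W : Finset (Pt d) → Submodule ℝ (Fin d → Poly d)
  τ : ℝ
  V_degree : ∀ s ∈ T.cells, ∀ v ∈ V s, v.totalDegree ≤ k
  W_degree : ∀ s ∈ T.cells, ∀ w ∈ W s, ∀ i, (w i).totalDegree ≤ k
  τ_nonneg : 0 ≤ τ

namespace Method

variable {d : ℕ} {Ω : Set (Pt d)} {k : ℕ} {T : SimplicialMesh Ω}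

/-- `uq = (u, q)` solves the local problem on the cell `s` with skeletal data `μ`. -/
def IsLocalSolution (S : Method k T) (μ : Set (Pt d) → Pt d → ℝ) (s : Finset (Pt d))
    (uq : Poly d × (Fin d → Poly d)) : Prop :=
  uq.1 ∈ S.V s ∧ uq.2 ∈ S.W s ∧
  (∀ w ∈ S.W s,
    cellInt s (fun x => ∑ i, polyFun (uq.2 i) x * polyFun (w i) x)
      - cellInt s (fun x => polyFun uq.1 x * ∑ i, polyFun (MvPolynomial.pderiv i (w i)) x)
    = - ∑ v ∈ s, facetInt (facet s v) fun x =>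
        μ (facet s v) x * ∑ i, polyFun (w i) x * outwardNormal s v i) ∧
  (∀ z ∈ S.V s,
    (∑ v ∈ s, facetInt (facet s v) fun x =>
        ((∑ i, polyFun (uq.2 i) x * outwardNormal s v i) + S.τ * polyFun uq.1 x) * polyFun z x)
      - cellInt s (fun x => ∑ i, polyFun (uq.2 i) x * polyFun (MvPolynomial.pderiv i z) x)
    = S.τ * ∑ v ∈ s, facetInt (facet s v) fun x => μ (facet s v) x * polyFun z x)

/-- The local problems have exactly one solution for all skeletal data of degree `p`, that is,
the local solvers are well defined. -/
def WellPosed (S : Method k T) (p : ℕ) : Prop :=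
  ∀ μ ∈ T.skeletal p, ∀ s ∈ T.cells, ∃! uq, S.IsLocalSolution μ s uq

/-- The local solver `μ ↦ U μ` (the first part of the local solution on every cell). -/
def U (S : Method k T) (μ : Set (Pt d) → Pt d → ℝ) (s : Finset (Pt d)) : Poly d :=
  (Classical.epsilon (S.IsLocalSolution μ s)).1

/-- The local solver `μ ↦ Q μ` (the second part of the local solution on every cell). -/
def Q (S : Method k T) (μ : Set (Pt d) → Pt d → ℝ) (s : Finset (Pt d)) : Fin d → Poly d :=
  (Classical.epsilon (S.IsLocalSolution μ s)).2

/-- The condensed bilinear form `a`. -/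
def energyForm (S : Method k T) (μ ν : Set (Pt d) → Pt d → ℝ) : ℝ :=
  (∑ s ∈ T.cells, cellInt s fun x => ∑ i, polyFun (S.Q μ s i) x * polyFun (S.Q ν s i) x)
  + ∑ s ∈ T.cells, ∑ v ∈ s, facetInt (facet s v) fun x =>
      S.τ * (polyFun (S.U μ s) x - μ (facet s v) x) * (polyFun (S.U ν s) x - ν (facet s v) x)

/-- The energy norm, `‖μ‖_a² = a(μ, μ)`. -/
def energyNorm (S : Method k T) (μ : Set (Pt d) → Pt d → ℝ) : ℝ := √(S.energyForm μ μ)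

/-- `‖U μ - μ‖_ℓ`. -/
def traceError (S : Method k T) (μ : Set (Pt d) → Pt d → ℝ) : ℝ :=
  T.bdryNorm fun s F x => polyFun (S.U μ s) x - μ F x

/-- The trace of `U μ` approximates `μ`: `‖U μ - μ‖_ℓ ≤ K h ‖Q μ‖_0`. -/
def LS1 (S : Method k T) (p : ℕ) (K : ℝ) : Prop :=
  ∀ μ ∈ T.skeletal p, S.traceError μ ≤ K * (T.meshSize * T.vecNorm0 (S.Q μ))

/-- `Q μ` and `U μ` are bounded by `μ`: `‖Q μ‖_0 ≤ K h⁻¹ ‖μ‖_ℓ` and `‖U μ‖_0 ≤ K ‖μ‖_ℓ`. -/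
def LS2 (S : Method k T) (p : ℕ) (K : ℝ) : Prop :=
  ∀ μ ∈ T.skeletal p,
    T.vecNorm0 (S.Q μ) ≤ K * (T.meshSize⁻¹ * T.skelNorm μ) ∧
    T.norm0 (S.U μ) ≤ K * T.skelNorm μ

/-- `Q μ` approximates `-∇ U μ`: `‖Q μ + ∇ U μ‖_0 ≤ K h⁻¹ ‖U μ - μ‖_ℓ`. -/
def LS3 (S : Method k T) (p : ℕ) (K : ℝ) : Prop :=
  ∀ μ ∈ T.skeletal p,
    T.vecNorm0 (fun s i => S.Q μ s i + MvPolynomial.pderiv i (S.U μ s))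
      ≤ K * (T.meshSize⁻¹ * S.traceError μ)

/-- Consistency: for conforming piecewise linear `w` and its trace `μ`, `Q μ = -∇w` and `U μ = w`. -/
def LS4 (S : Method k T) (p : ℕ) : Prop :=
  ∀ w ∈ T.conforming, ∀ μ ∈ T.skeletal p, μ = T.trace w → ∀ s ∈ T.cells,
    (∀ x ∈ interior (hull s), ∀ i, polyFun (S.Q μ s i) x = -(gradient w x) i) ∧
    (∀ x ∈ hull s, polyFun (S.U μ s) x = w x)

end Method

section Injection

variable {d : ℕ} {Ω : Set (Pt d)} {k p : ℕ} {Tc Tf : SimplicialMesh Ω}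

/-- Stability of the injection: `‖I μ‖_ℓ ≤ K ‖μ‖_{ℓ-1}`. -/
def IA1 (I : Tc.skeletal p →ₗ[ℝ] Tf.skeletal p) (K : ℝ) : Prop :=
  ∀ μ : Tc.skeletal p, Tf.skelNorm (I μ).1 ≤ K * Tc.skelNorm μ.1

/-- Trace identity: the injection maps coarse traces of conforming piecewise linear functions to their
fine traces. -/
def IA2 (I : Tc.skeletal p →ₗ[ℝ] Tf.skeletal p) : Prop :=
  ∀ w ∈ Tc.conforming, ∀ μ : Tc.skeletal p, μ.1 = Tc.trace w → (I μ).1 = Tf.trace w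

/-- `ν` satisfies the defining condition of the Ritz quasi-projection of `μ`:
`a_{coarse}(ν, η) = a_{fine}(μ, I η)` for all coarse skeletal functions `η`. -/
def IsRitz (Sc : Method k Tc) (Sf : Method k Tf) (I : Tc.skeletal p →ₗ[ℝ] Tf.skeletal p)
    (μ : Tf.skeletal p) (ν : Tc.skeletal p) : Prop :=
  ∀ η : Tc.skeletal p, Sc.energyForm ν.1 η.1 = Sf.energyForm μ.1 (I η).1

/-- The Ritz quasi-projection from the fine to the coarse skeletal space. -/
def ritz (Sc : Method k Tc) (Sf : Method k Tf) (I : Tc.skeletal p →ₗ[ℝ] Tf.skeletal p)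
    (μ : Tf.skeletal p) : Tc.skeletal p :=
  Classical.epsilon (IsRitz Sc Sf I μ)

end Injection

end

end HDG

/-! The injection `I` is bounded in the energy norms, and `P`, being its adjoint with respect to the
two energy forms, has the same bound; hence `λ ↦ λ - I (P λ)` is bounded as well.

To bound `I μ`, compare `μ` with the trace of a conforming piecewise affine function `w`: at every
interior vertex, `w` takes the value of the local solution `U μ` in some cell containing the vertex.
Any two cells at an interior vertex are joined by a chain of cells through common facets, every cell
at a boundary vertex is joined in this way to a cell with a boundary facet, where `μ = 0`, and the
jump of `U μ` across a facet is at most the sum of the two values of `|U μ - μ|` there. With the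
inverse inequality, (LS1) and (LS3), both the distance from `μ` to the trace of `w` in the skeletal
norm and `h ‖∇w‖` are therefore at most a multiple of `h ‖Q μ‖`. By (IA2) and (LS4), the energy of
the image under `I` of the trace of `w` is the Dirichlet energy of `w`, whatever the mesh. The
remainder is small in the skeletal norm, so (IA1), (LS1) and (LS2) bound the energy of its image.

The same comparison shows that the energy form is definite: if `Q μ = 0`, then `w` is constant on
every cell and vanishes outside the domain, so `w = 0` and `μ = 0`. -/

/-! ### Simplices and barycentric coordinates -/

namespace HDG

section Hull

variable {d : ℕ} {s : Finset (Pt d)} {v : Pt d}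

lemma convex_hull : Convex ℝ (hull s) := convex_convexHull ℝ _

lemma isCompact_hull : IsCompact (hull s) := s.finite_toSet.isCompact_convexHull ℝ

lemma isClosed_hull : IsClosed (hull s) := isCompact_hull.isClosed

lemma isCompact_facet : IsCompact (facet s v) :=
  (s.finite_toSet.subset sdiff_subset).isCompact_convexHull ℝ

lemma facet_subset_hull : facet s v ⊆ hull s := convexHull_mono sdiff_subset

end Hull

/-- A nondegenerate simplex, given by its `d + 1` vertices. -/
structure IsSimplex {d : ℕ} (s : Finset (Pt d)) : Prop where
  card_eq : s.card = d + 1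
  indep : AffineIndependent ℝ (fun x : s => (x : Pt d))

/-- The affine basis of `ℝ^d` formed by the vertices of a nondegenerate simplex. -/
noncomputable def IsSimplex.basis {d : ℕ} {s : Finset (Pt d)} (h : IsSimplex s) :
    AffineBasis s ℝ (Pt d) where
  toFun := fun x => (x : Pt d)
  ind' := h.indep
  tot' := by
    rw [h.indep.affineSpan_eq_top_iff_card_eq_finrank_add_one]
    simp [h.card_eq]

open Classical in
/-- The barycentric coordinate of the simplex `hull s` belonging to the vertex `v`; it is zero
unless `s` is a nondegenerate simplex with vertex `v`. -/
noncomputable def bary {d : ℕ} (s : Finset (Pt d)) (v : Pt d) : Pt d →ᵃ[ℝ] ℝ :=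
  if h : IsSimplex s ∧ v ∈ s then h.1.basis.coord ⟨v, h.2⟩ else 0

lemma continuous_bary {d : ℕ} (s : Finset (Pt d)) (v : Pt d) : Continuous (bary s v) :=
  (bary s v).continuous_of_finiteDimensional

lemma bary_lineMap {d : ℕ} (s : Finset (Pt d)) (v a b : Pt d) (θ : ℝ) :
    bary s v (AffineMap.lineMap a b θ) = (1 - θ) * bary s v a + θ * bary s v b := by
  rw [AffineMap.apply_lineMap, AffineMap.lineMap_apply_ring]

namespace IsSimplex

variable {d : ℕ} {s t : Finset (Pt d)} {v w x : Pt d}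

lemma bary_eq (h : IsSimplex s) (hv : v ∈ s) : bary s v = h.basis.coord ⟨v, hv⟩ := by
  rw [bary, dif_pos ⟨h, hv⟩]

lemma sum_bary (h : IsSimplex s) (x : Pt d) : ∑ v ∈ s, bary s v x = 1 := by
  rw [← h.basis.sum_coord_apply_eq_one x, ← Finset.sum_coe_sort s]
  exact Finset.sum_congr rfl fun v _ => by rw [h.bary_eq v.2]

lemma sum_bary_smul (h : IsSimplex s) (x : Pt d) : ∑ v ∈ s, bary s v x • v = x := by
  conv_rhs => rw [← h.basis.linear_combination_coord_eq_self x]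
  rw [← Finset.sum_coe_sort s]
  exact Finset.sum_congr rfl fun v _ => by rw [h.bary_eq v.2]; rfl

lemma bary_self (h : IsSimplex s) (hv : v ∈ s) : bary s v v = 1 := by
  rw [h.bary_eq hv]; exact h.basis.coord_apply_eq ⟨v, hv⟩

lemma bary_ne (h : IsSimplex s) (hv : v ∈ s) (hw : w ∈ s) (hvw : v ≠ w) : bary s v w = 0 := by
  rw [h.bary_eq hv]
  exact h.basis.coord_apply_ne (i := ⟨v, hv⟩) (j := ⟨w, hw⟩) (by simpa using hvw)

lemma range_basis (h : IsSimplex s) : range h.basis = (s : Set (Pt d)) :=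
  Subtype.range_coe

lemma mem_hull (h : IsSimplex s) : x ∈ hull s ↔ ∀ v ∈ s, 0 ≤ bary s v x := by
  rw [hull, ← h.range_basis, h.basis.convexHull_eq_nonneg_coord]
  exact ⟨fun hx v hv => by rw [h.bary_eq hv]; exact hx _,
    fun hx v => by rw [← h.bary_eq v.2]; exact hx _ v.2⟩

lemma mem_interior_hull (h : IsSimplex s) :
    x ∈ interior (hull s) ↔ ∀ v ∈ s, 0 < bary s v x := by
  rw [hull, ← h.range_basis, h.basis.interior_convexHull]
  exact ⟨fun hx v hv => by rw [h.bary_eq hv]; exact hx _,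
    fun hx v => by rw [← h.bary_eq v.2]; exact hx _ v.2⟩

lemma mem_convexHull (h : IsSimplex s) {f : Set (Pt d)} (hf : f ⊆ s) :
    x ∈ convexHull ℝ f ↔ x ∈ hull s ∧ ∀ v ∈ s, v ∉ f → bary s v x = 0 := by
  classical
  constructor
  · intro hx
    refine ⟨convexHull_mono hf hx, fun v hv hvf => ?_⟩
    have hzero : f ⊆ bary s v ⁻¹' {0} := fun w hw =>
      h.bary_ne hv (hf hw) fun hvw => hvf (hvw ▸ hw)
    exact convexHull_min hzero ((convex_singleton 0).affine_preimage _) hx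
  · rintro ⟨hxs, hzero⟩
    have hsupp : ∀ v ∈ s, bary s v x ≠ 0 → v ∈ f := fun v hv hne =>
      of_not_not fun hvf => hne (hzero v hv hvf)
    have hcomb : ∑ v ∈ s with v ∈ f, bary s v x • v = x := by
      rw [Finset.sum_filter_of_ne fun v hv hne => hsupp v hv (left_ne_zero_of_smul hne),
        h.sum_bary_smul]
    rw [← hcomb]
    refine (convex_convexHull ℝ f).sum_mem
      (fun v hv => h.mem_hull.1 hxs v (Finset.mem_filter.1 hv).1) ?_
      fun v hv => subset_convexHull ℝ f (Finset.mem_filter.1 hv).2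
    rw [Finset.sum_filter_of_ne hsupp, h.sum_bary]

lemma mem_facet (h : IsSimplex s) (hv : v ∈ s) :
    x ∈ facet s v ↔ x ∈ hull s ∧ bary s v x = 0 := by
  rw [facet, h.mem_convexHull sdiff_subset]
  refine and_congr_right fun _ => ⟨fun hx => hx v hv (by simp), fun hx w hw hwf => ?_⟩
  have hwv : w = v := of_not_not fun hne => hwf ⟨hw, hne⟩
  rwa [hwv]

lemma nonempty (h : IsSimplex s) : s.Nonempty := by
  rw [← Finset.card_pos, h.card_eq]; omega

lemma interior_nonempty (h : IsSimplex s) : (interior (hull s)).Nonempty := by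
  rw [hull, ← h.range_basis]
  exact interior_convexHull_nonempty_iff_affineSpan_eq_top.2 h.basis.tot

lemma exists_bary_pos (h : IsSimplex s) : ∃ c, ∀ v ∈ s, 0 < bary s v c :=
  h.interior_nonempty.imp fun _ => h.mem_interior_hull.1

lemma hull_subset_closure_interior (h : IsSimplex s) : hull s ⊆ closure (interior (hull s)) := by
  rw [convex_hull.closure_interior_eq_closure_of_nonempty_interior h.interior_nonempty]
  exact subset_closure

lemma eq_of_subset (hs : IsSimplex s) (ht : IsSimplex t) (h : s ⊆ t) : s = t :=
  Finset.eq_of_subset_of_card_le h (by rw [hs.card_eq, ht.card_eq])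

end IsSimplex

namespace SimplicialMesh

variable {d : ℕ} {Ω : Set (Pt d)} (T : SimplicialMesh Ω) {s t : Finset (Pt d)} {v x : Pt d}

lemma isSimplex (hs : s ∈ T.cells) : IsSimplex s := ⟨T.card_eq s hs, T.indep s hs⟩

lemma hull_subset (hs : s ∈ T.cells) : hull s ⊆ closure Ω := by
  rw [← T.cover]; exact subset_biUnion_of_mem (u := fun s => hull s) hs

lemma exists_mem_hull (hx : x ∈ closure Ω) : ∃ s ∈ T.cells, x ∈ hull s := by
  rw [← T.cover] at hx
  simpa using hx

lemma mem_of_bary_ne_zero (hs : s ∈ T.cells) (ht : t ∈ T.cells) (hxs : x ∈ hull s)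
    (hxt : x ∈ hull t) (hv : v ∈ s) (h : bary s v x ≠ 0) : v ∈ t := by
  have hx : x ∈ convexHull ℝ ((s : Set (Pt d)) ∩ t) := T.inter_eq s hs t ht ▸ ⟨hxs, hxt⟩
  by_contra hvt
  exact h ((((T.isSimplex hs).mem_convexHull inter_subset_left).1 hx).2 v hv fun h => hvt h.2)

lemma eq_of_mem_interior (hs : s ∈ T.cells) (ht : t ∈ T.cells)
    (hxs : x ∈ interior (hull s)) (hxt : x ∈ hull t) : s = t :=
  (T.isSimplex hs).eq_of_subset (T.isSimplex ht) fun _ hv =>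
    T.mem_of_bary_ne_zero hs ht (interior_subset hxs) hxt hv
      ((T.isSimplex hs).mem_interior_hull.1 hxs _ hv).ne'

lemma bary_eq_bary (hs : s ∈ T.cells) (ht : t ∈ T.cells) (hxs : x ∈ hull s)
    (hxt : x ∈ hull t) (hvs : v ∈ s) (hvt : v ∈ t) : bary s v x = bary t v x := by
  have hx : x ∈ convexHull ℝ ((s : Set (Pt d)) ∩ t) := T.inter_eq s hs t ht ▸ ⟨hxs, hxt⟩
  have hvertices : (s : Set (Pt d)) ∩ t ⊆ (bary s v - bary t v) ⁻¹' {0} := by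
    rintro w ⟨hws, hwt⟩
    obtain rfl | hvw := eq_or_ne v w
    · simp [(T.isSimplex hs).bary_self hvs, (T.isSimplex ht).bary_self hvt]
    · simp [(T.isSimplex hs).bary_ne hvs hws hvw, (T.isSimplex ht).bary_ne hvt hwt hvw]
  exact sub_eq_zero.1 (convexHull_min hvertices ((convex_singleton 0).affine_preimage _) hx)

lemma eventually_mem_hull (x : Pt d) :
    ∀ᶠ y in 𝓝 x, ∀ t ∈ T.cells, y ∈ hull t → x ∈ hull t := by
  rw [Filter.eventually_all_finset]
  intro t _
  by_cases hx : x ∈ hull t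
  · exact Eventually.of_forall fun _ _ => hx
  · filter_upwards [isClosed_hull.isOpen_compl.mem_nhds hx] with y hy hyt
    exact absurd hyt hy

end SimplicialMesh

end HDG

/-! ### Facets, neighbours and vertex stars of a simplicial mesh -/

namespace HDG

variable {d : ℕ} {Ω : Set (Pt d)}

lemma IsLipschitzDomain.mem_closure_compl_closure (hΩ : IsLipschitzDomain Ω) {x : Pt d}
    (hx : x ∈ frontier Ω) : x ∈ closure (closure Ω)ᶜ := by
  obtain ⟨hopen, -, -, hgraph⟩ := hΩ
  obtain ⟨r, e, g, K, hr, he, hg, hge, hΩr⟩ := hgraph x hx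
  have hgx : inner ℝ e x ≤ g x := by
    by_contra hlt
    have hmem : x ∈ Ω ∩ Metric.ball x r := hΩr ▸ ⟨Metric.mem_ball_self hr, not_le.1 hlt⟩
    exact (hopen.frontier_eq ▸ hx).2 hmem.1
  have hlim : Tendsto (fun t : ℝ => x + (-t) • e) (𝓝[>] 0) (𝓝 x) := by
    have hcont : Continuous (fun t : ℝ => x + (-t) • e) := by fun_prop
    simpa using (hcont.tendsto 0).mono_left nhdsWithin_le_nhds
  have hbelow : IsOpen (Metric.ball x r ∩ {z | inner ℝ e z < g z}) :=
    Metric.isOpen_ball.inter (isOpen_lt (by fun_prop) hg.continuous)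
  refine mem_closure_of_tendsto hlim ?_
  filter_upwards [hlim (Metric.ball_mem_nhds x hr), self_mem_nhdsWithin] with t ht (htpos : 0 < t)
  have hmem : x + (-t) • e ∈ Metric.ball x r ∩ {z | inner ℝ e z < g z} := by
    refine ⟨ht, ?_⟩
    simp only [mem_ofPred_eq]
    rw [hge, inner_add_right, inner_smul_right, real_inner_self_eq_norm_sq, he]
    linarith
  intro hcl
  obtain ⟨z, hz, hzΩ⟩ := mem_closure_iff.1 hcl _ hbelow hmem
  have habove : z ∈ {y ∈ Metric.ball x r | g y < inner ℝ e y} := hΩr ▸ ⟨hzΩ, hz.1⟩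
  exact lt_asymm habove.2 hz.2

lemma IsLipschitzDomain.interior_closure (hΩ : IsLipschitzDomain Ω) :
    interior (closure Ω) = Ω := by
  refine Subset.antisymm (fun x hx => ?_) hΩ.1.subset_interior_closure
  by_contra hxΩ
  have hfrontier : x ∈ frontier Ω := hΩ.1.frontier_eq ▸ ⟨interior_subset hx, hxΩ⟩
  have hcl := hΩ.mem_closure_compl_closure hfrontier
  rw [closure_compl] at hcl
  exact hcl hx

section CodimTwo

lemma volume_affineSpan_insert {S : Finset (Pt d)} (hS : S.card < d) (b : Pt d) :
    volume (affineSpan ℝ (insert b (S : Set (Pt d))) : Set (Pt d)) = 0 := by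
  classical
  refine Measure.addHaar_affineSubspace _ _ fun htop => ?_
  obtain ⟨n, hn⟩ : ∃ n, (insert b S).card = n + 1 :=
    Nat.exists_eq_succ_of_ne_zero (Finset.card_ne_zero_of_mem (Finset.mem_insert_self b S))
  have hrank := finrank_vectorSpan_image_finset_le ℝ (id : Pt d → Pt d) (insert b S) hn
  have hspan : vectorSpan ℝ (insert b (S : Set (Pt d))) = ⊤ := by
    rw [← direction_affineSpan, htop, AffineSubspace.direction_top]
  have hcard := Finset.card_insert_le b S
  rw [Finset.coe_image, image_id, Finset.coe_insert, hspan, finrank_top,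
    finrank_euclideanSpace_fin] at hrank
  omega

lemma exists_mem_forall_notMem_affineSpan_insert {S : Finset (Finset (Pt d))}
    (hS : ∀ f ∈ S, f.card < d) {V : Set (Pt d)} (hV : IsOpen V) (hne : V.Nonempty) (b : Pt d) :
    ∃ a ∈ V, ∀ f ∈ S, a ∉ affineSpan ℝ (insert b (f : Set (Pt d))) := by
  by_contra! hcon
  have hsub : V ⊆ ⋃ f ∈ S, (affineSpan ℝ (insert b (f : Set (Pt d))) : Set (Pt d)) := by
    intro a ha
    obtain ⟨f, hf, haf⟩ := hcon a ha
    exact mem_biUnion hf haf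
  have hnull : volume V = 0 := measure_mono_null hsub
    ((measure_biUnion_null_iff S.countable_toSet).2 fun f hf =>
      volume_affineSpan_insert (hS f hf) b)
  exact (hV.measure_pos volume hne).ne' hnull

lemma left_mem_of_lineMap_mem {Q : AffineSubspace ℝ (Pt d)} {a b : Pt d} {θ : ℝ} (hθ : θ ≠ 1)
    (hb : b ∈ Q) (hc : AffineMap.lineMap a b θ ∈ Q) : a ∈ Q := by
  have hθ' : 1 - θ ≠ 0 := sub_ne_zero.2 hθ.symm
  convert AffineMap.lineMap_mem (1 - θ)⁻¹ hb hc using 1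
  simp only [AffineMap.lineMap_apply_module]
  match_scalars <;> field_simp
  ring

/-- A generic segment from one set to the other avoids the finitely many simplices of codimension
two. -/
lemma not_nonempty_interior_inter_of_codim_two {P O U : Set (Pt d)} (hP : IsClosed P)
    (hO : IsClosed O) (hU : Convex ℝ U) (hUo : IsOpen U) (hPO : U ⊆ P ∪ O)
    {S : Finset (Finset (Pt d))} (hS : ∀ f ∈ S, f.card < d)
    (hPOS : ∀ y ∈ P, y ∈ O → y ∈ U → ∃ f ∈ S, y ∈ convexHull ℝ (f : Set (Pt d)))
    (hPU : (interior P ∩ U).Nonempty) : ¬(interior O ∩ U).Nonempty := by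
  intro hOU
  obtain ⟨b, ⟨hbO, hbU⟩, hb⟩ :=
    exists_mem_forall_notMem_affineSpan_insert hS (isOpen_interior.inter hUo) hOU 0
  obtain ⟨a, ⟨haP, haU⟩, ha⟩ :=
    exists_mem_forall_notMem_affineSpan_insert hS (isOpen_interior.inter hUo) hPU b
  have hseg : segment ℝ a b ⊆ U := hU.segment_subset haU hbU
  obtain ⟨c, hc, hcP, hcO⟩ := isPreconnected_closed_iff.1 (convex_segment a b).isPreconnected
    P O hP hO (hseg.trans hPO) ⟨a, left_mem_segment ℝ a b, interior_subset haP⟩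
    ⟨b, right_mem_segment ℝ a b, interior_subset hbO⟩
  obtain ⟨f, hf, hcf⟩ := hPOS c hcP hcO (hseg hc)
  have hcspan : c ∈ affineSpan ℝ (f : Set (Pt d)) := convexHull_subset_affineSpan _ hcf
  rw [segment_eq_image_lineMap] at hc
  obtain ⟨θ, -, rfl⟩ := hc
  refine ha f hf (left_mem_of_lineMap_mem (fun hθ => hb f hf ?_)
    (subset_affineSpan ℝ _ (mem_insert _ _)) (affineSpan_mono ℝ (subset_insert _ _) hcspan))
  rw [hθ, AffineMap.lineMap_apply_one] at hcspan
  exact affineSpan_mono ℝ (subset_insert _ _) hcspan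

end CodimTwo

/-- The relative interior of the facet of `hull s` opposite to the vertex `v`. -/
def facetInterior (s : Finset (Pt d)) (v : Pt d) : Set (Pt d) :=
  {x | bary s v x = 0 ∧ ∀ w ∈ s, w ≠ v → 0 < bary s w x}

/-- The simplex `t` differs from `s` and has all vertices of the facet of `s` opposite to `v`; for
cells of a mesh this says that `t` is the neighbour of `s` across this facet. -/
structure AdjacentAcross (s : Finset (Pt d)) (v : Pt d) (t : Finset (Pt d)) : Prop where
  ne : t ≠ s
  sdiff_subset : (s : Set (Pt d)) \ {v} ⊆ t

namespace IsSimplex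

variable {s t : Finset (Pt d)} {v w x c : Pt d}

lemma mem_hull_of_pos (hs : IsSimplex s) (hx : ∀ w ∈ s, w ≠ v → 0 < bary s w x)
    (hv : 0 ≤ bary s v x) : x ∈ hull s := by
  refine hs.mem_hull.2 fun w hw => ?_
  obtain rfl | hwv := eq_or_ne w v
  exacts [hv, (hx w hw hwv).le]

lemma mem_interior_hull_of_pos (hs : IsSimplex s) (hx : ∀ w ∈ s, w ≠ v → 0 < bary s w x)
    (hv : 0 < bary s v x) : x ∈ interior (hull s) := by
  refine hs.mem_interior_hull.2 fun w hw => ?_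
  obtain rfl | hwv := eq_or_ne w v
  exacts [hv, hx w hw hwv]

lemma facetInterior_subset_hull (hs : IsSimplex s) : facetInterior s v ⊆ hull s :=
  fun _ hx => hs.mem_hull_of_pos hx.2 hx.1.ge

lemma facetInterior_subset_facet (hs : IsSimplex s) (hv : v ∈ s) :
    facetInterior s v ⊆ facet s v :=
  fun _ hx => (hs.mem_facet hv).2 ⟨hs.facetInterior_subset_hull hx, hx.1⟩

lemma facetInterior_nonempty (hs : IsSimplex s) (hv : v ∈ s) (hne : (facet s v).Nonempty) :
    (facetInterior s v).Nonempty := by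
  classical
  obtain ⟨c, hc⟩ := hs.exists_bary_pos
  have hne' : (s.erase v).Nonempty := by
    rw [facet, convexHull_nonempty_iff] at hne
    exact hne.imp fun w hw => Finset.mem_erase.2 ⟨hw.2, hw.1⟩
  have hpos : 0 < 1 - bary s v c := by
    rw [← hs.sum_bary c, ← Finset.add_sum_erase s _ hv, add_sub_cancel_left]
    exact Finset.sum_pos (fun w hw => hc w (Finset.mem_of_mem_erase hw)) hne'
  -- the projection of `c` from the vertex `v` onto the facet
  refine ⟨AffineMap.lineMap v c (1 - bary s v c)⁻¹, ?_, fun w hw hwv => ?_⟩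
  · rw [bary_lineMap, hs.bary_self hv]
    field_simp
    ring
  · rw [bary_lineMap, hs.bary_ne hw hv hwv, mul_zero, zero_add]
    exact mul_pos (inv_pos.2 hpos) (hc w hw)

lemma facet_subset_closure_facetInterior (hs : IsSimplex s) (hv : v ∈ s) :
    facet s v ⊆ closure (facetInterior s v) := by
  intro y hy
  obtain ⟨c, hc⟩ := hs.facetInterior_nonempty hv ⟨y, hy⟩
  obtain ⟨hys, hyv⟩ := (hs.mem_facet hv).1 hy
  have hlim : Tendsto (fun θ : ℝ => AffineMap.lineMap y c θ) (𝓝[>] 0) (𝓝 y) := by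
    have hcont : Continuous fun θ : ℝ => AffineMap.lineMap y c θ := AffineMap.lineMap_continuous
    simpa using (hcont.tendsto 0).mono_left nhdsWithin_le_nhds
  refine mem_closure_of_tendsto hlim ?_
  filter_upwards [Ioo_mem_nhdsGT (zero_lt_one' ℝ)] with θ ⟨hθ0, hθ1⟩
  refine ⟨?_, fun w hw hwv => ?_⟩
  · rw [bary_lineMap, hc.1, hyv, mul_zero, mul_zero, add_zero]
  · rw [bary_lineMap]
    exact add_pos_of_nonneg_of_pos (mul_nonneg (by linarith) (hs.mem_hull.1 hys w hw))
      (mul_pos hθ0 (hc.2 w hw hwv))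

lemma mem_hull_of_lineMap_mem (hs : IsSimplex s) (hv : v ∈ s) {ε : ℝ} (hε : 0 < ε)
    (hmem : AffineMap.lineMap v x ε ∈ hull s) (hx : 0 ≤ bary s v x) : x ∈ hull s := by
  refine hs.mem_hull.2 fun w hw => ?_
  obtain rfl | hwv := eq_or_ne w v
  · exact hx
  · have hnonneg := hs.mem_hull.1 hmem w hw
    rw [bary_lineMap, hs.bary_ne hw hv hwv, mul_zero, zero_add] at hnonneg
    exact nonneg_of_mul_nonneg_right hnonneg hε

end IsSimplex

lemma eventually_pos_of_mem_facetInterior {s : Finset (Pt d)} {v c : Pt d}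
    (hc : c ∈ facetInterior s v) : ∀ᶠ y in 𝓝 c, ∀ w ∈ s, w ≠ v → 0 < bary s w y := by
  rw [Filter.eventually_all_finset]
  intro w hw
  obtain hwv | hwv := eq_or_ne w v
  · exact Eventually.of_forall fun _ h => absurd hwv h
  · exact (((continuous_bary s w).tendsto c).eventually_const_lt (hc.2 w hw hwv)).mono
      fun _ hy _ => hy

namespace AdjacentAcross

variable {s t : Finset (Pt d)} {v : Pt d}

lemma exists_sdiff_eq (hs : IsSimplex s) (ht : IsSimplex t) (hv : v ∈ s)
    (h : AdjacentAcross s v t) :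
    ∃ v' ∈ t, v' ∉ s ∧ (t : Set (Pt d)) \ {v'} = (s : Set (Pt d)) \ {v} := by
  classical
  obtain ⟨v', hv't, hv's⟩ : ∃ v' ∈ t, v' ∉ s := by
    by_contra! hsub
    exact h.ne (ht.eq_of_subset hs hsub)
  refine ⟨v', hv't, hv's, ?_⟩
  have hsub : s.erase v ⊆ t.erase v' := by
    intro w hw
    rw [Finset.mem_erase] at hw ⊢
    exact ⟨fun hwv' => hv's (hwv' ▸ hw.2), h.sdiff_subset ⟨hw.2, hw.1⟩⟩
  have heq := Finset.eq_of_subset_of_card_le hsub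
    (by rw [Finset.card_erase_of_mem hv't, Finset.card_erase_of_mem hv, hs.card_eq, ht.card_eq])
  rw [← Finset.coe_erase, ← Finset.coe_erase, heq]

end AdjacentAcross

namespace SimplicialMesh

variable (T : SimplicialMesh Ω) {s t : Finset (Pt d)} {v x y c : Pt d}

lemma vertex_mem_of_mem_hull (hs : s ∈ T.cells) (ht : t ∈ T.cells) (hv : v ∈ s)
    (hvt : v ∈ hull t) : v ∈ t :=
  T.mem_of_bary_ne_zero hs ht (subset_convexHull ℝ _ hv) hvt hv
    (by rw [(T.isSimplex hs).bary_self hv]; exact one_ne_zero)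

lemma adjacentAcross_of_mem_facetInterior (hs : s ∈ T.cells) (ht : t ∈ T.cells) (hts : t ≠ s)
    (hc : c ∈ facetInterior s v) (hct : c ∈ hull t) : AdjacentAcross s v t :=
  ⟨hts, fun w hw => T.mem_of_bary_ne_zero hs ht ((T.isSimplex hs).facetInterior_subset_hull hc) hct
    hw.1 (hc.2 w hw.1 hw.2).ne'⟩

lemma facetInterior_subset_of_sdiff_eq (hs : s ∈ T.cells) (ht : t ∈ T.cells) (hv : v ∈ s)
    {v' : Pt d} (hv' : v' ∈ t) (heq : (t : Set (Pt d)) \ {v'} = (s : Set (Pt d)) \ {v}) :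
    facetInterior s v ⊆ facetInterior t v' := by
  intro c hc
  have hcs := (T.isSimplex hs).facetInterior_subset_facet hv hc
  have hct : c ∈ facet t v' := by rwa [facet, heq]
  refine ⟨(((T.isSimplex ht).mem_facet hv').1 hct).2, fun w hw hwv' => ?_⟩
  obtain ⟨hws, hwv⟩ : w ∈ (s : Set (Pt d)) \ {v} := heq ▸ ⟨hw, hwv'⟩
  rw [← T.bary_eq_bary hs ht (facet_subset_hull hcs) (facet_subset_hull hct) hws hw]
  exact hc.2 w hws hwv

/-- Otherwise the reflection of a nearby point of neither cell lies in the interior of both. -/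
lemma eventually_mem_hull_union (hs : s ∈ T.cells) (ht : t ∈ T.cells) (hv : v ∈ s)
    (hadj : AdjacentAcross s v t) (hc : c ∈ facetInterior s v) :
    ∀ᶠ y in 𝓝 c, y ∈ hull s ∪ hull t := by
  obtain ⟨v', hv', -, heq⟩ := hadj.exists_sdiff_eq (T.isSimplex hs) (T.isSimplex ht) hv
  have hc' := T.facetInterior_subset_of_sdiff_eq hs ht hv hv' heq hc
  have hreflect : Tendsto (fun y : Pt d => AffineMap.lineMap y c (2 : ℝ)) (𝓝 c) (𝓝 c) := by
    have hcont : Continuous fun y : Pt d => AffineMap.lineMap y c (2 : ℝ) := by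
      simp only [AffineMap.lineMap_apply_module]; fun_prop
    simpa using hcont.tendsto c
  have hpos := (eventually_pos_of_mem_facetInterior hc).and
    (eventually_pos_of_mem_facetInterior hc')
  filter_upwards [hpos, hreflect.eventually hpos] with y ⟨hys, hyt⟩ ⟨hrs, hrt⟩
  by_contra hy
  rw [mem_union, not_or] at hy
  have hneg : bary s v y < 0 := by
    by_contra! hnonneg
    exact hy.1 ((T.isSimplex hs).mem_hull_of_pos hys hnonneg)
  have hneg' : bary t v' y < 0 := by
    by_contra! hnonneg
    exact hy.2 ((T.isSimplex ht).mem_hull_of_pos hyt hnonneg)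
  refine hadj.ne (T.eq_of_mem_interior hs ht (x := AffineMap.lineMap y c (2 : ℝ))
    ((T.isSimplex hs).mem_interior_hull_of_pos hrs ?_)
    ((T.isSimplex ht).mem_hull_of_pos hrt (le_of_lt ?_))).symm
  · rw [bary_lineMap, hc.1]; linarith
  · rw [bary_lineMap, hc'.1]; linarith

lemma exists_adjacentAcross_of_mem_facetInterior (hΩ : IsOpen Ω) (hs : s ∈ T.cells) (hv : v ∈ s)
    (hc : c ∈ facetInterior s v) (hcΩ : c ∈ Ω) : ∃ t ∈ T.cells, AdjacentAcross s v t := by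
  by_contra! hno
  have hev : ∀ᶠ y in 𝓝 c, y ∈ hull s := by
    filter_upwards [hΩ.mem_nhds hcΩ, T.eventually_mem_hull c] with y hyΩ hy
    obtain ⟨t, ht, hyt⟩ := T.exists_mem_hull (subset_closure hyΩ)
    obtain rfl | hts := eq_or_ne t s
    · exact hyt
    · exact absurd (T.adjacentAcross_of_mem_facetInterior hs ht hts hc (hy t ht hyt)) (hno t ht)
  have hlim : Tendsto (fun θ : ℝ => AffineMap.lineMap c v θ) (𝓝[<] 0) (𝓝 c) := by
    have hcont : Continuous fun θ : ℝ => AffineMap.lineMap c v θ := AffineMap.lineMap_continuous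
    simpa using (hcont.tendsto 0).mono_left nhdsWithin_le_nhds
  obtain ⟨θ, hθ, hθneg : θ < 0⟩ := ((hlim.eventually hev).and self_mem_nhdsWithin).exists
  have hnonneg := (T.isSimplex hs).mem_hull.1 hθ v hv
  rw [bary_lineMap, hc.1, (T.isSimplex hs).bary_self hv] at hnonneg
  linarith

lemma exists_adjacentAcross_or_facet_subset_frontier (hΩ : IsOpen Ω) (hs : s ∈ T.cells)
    (hv : v ∈ s) : (∃ t ∈ T.cells, AdjacentAcross s v t) ∨ facet s v ⊆ frontier Ω := by
  refine or_iff_not_imp_left.2 fun hno =>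
    ((T.isSimplex hs).facet_subset_closure_facetInterior hv).trans
      (closure_minimal (fun c hc => ?_) isClosed_frontier)
  rw [hΩ.frontier_eq]
  exact ⟨T.hull_subset hs ((T.isSimplex hs).facetInterior_subset_hull hc), fun hcΩ =>
    hno (T.exists_adjacentAcross_of_mem_facetInterior hΩ hs hv hc hcΩ)⟩

lemma bary_eq_bary_of_lineMap_mem (hs : s ∈ T.cells) (ht : t ∈ T.cells) (hvs : v ∈ s)
    (hvt : v ∈ t) {ε : ℝ} (hε : ε ∈ Ioc (0 : ℝ) 1) (hxs : x ∈ hull s)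
    (hxt : AffineMap.lineMap v x ε ∈ hull t) : bary s v x = bary t v x := by
  have hscaled := T.bary_eq_bary hs ht
    (convex_hull.lineMap_mem (subset_convexHull ℝ _ hvs) hxs ⟨hε.1.le, hε.2⟩) hxt hvs hvt
  rw [bary_lineMap, bary_lineMap, (T.isSimplex hs).bary_self hvs,
    (T.isSimplex ht).bary_self hvt] at hscaled
  exact mul_left_cancel₀ hε.1.ne' (add_left_cancel hscaled)

/-- If `v` were an interior point, then a homothety with centre `v` would carry a neighbourhood of
`v` that is covered by the cells with vertex `v` to a neighbourhood of `x` in the closure. -/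
lemma vertex_mem_frontier (hΩ : IsOpen Ω) (hreg : interior (closure Ω) = Ω) (hs : s ∈ T.cells)
    (hx : x ∈ frontier Ω) (hxs : x ∈ hull s) (hv : v ∈ s) (hpos : 0 < bary s v x) :
    v ∈ frontier Ω := by
  have hvs : v ∈ hull s := subset_convexHull ℝ _ hv
  rw [hΩ.frontier_eq] at hx ⊢
  refine ⟨T.hull_subset hs hvs, fun hvΩ => hx.2 (hreg ▸ ?_)⟩
  have hcont : Continuous (fun q : ℝ × Pt d => (AffineMap.lineMap v q.2 q.1 : Pt d)) := by
    simp only [AffineMap.lineMap_apply_module]; fun_prop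
  have hlim : Tendsto (fun q : ℝ × Pt d => (AffineMap.lineMap v q.2 q.1 : Pt d)) (𝓝 (0, x))
      (𝓝 v) := by
    simpa using hcont.tendsto (0, x)
  have hnear := hlim.eventually ((hΩ.eventually_mem hvΩ).and (T.eventually_mem_hull v))
  obtain ⟨ε, hε, hεmem⟩ := ((hnear.curry_nhds.filter_mono
    (nhdsWithin_le_nhds (s := Ioi 0))).and (Ioc_mem_nhdsGT (zero_lt_one' ℝ))).exists
  have hscale := (hcont.comp (Continuous.prodMk_right ε)).tendsto x
  have hcoord : ∀ᶠ y in 𝓝 x, ∀ t ∈ T.cells, 0 < bary t v x → 0 < bary t v y := by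
    rw [Filter.eventually_all_finset]
    intro t _
    by_cases h : 0 < bary t v x
    · filter_upwards [((continuous_bary t v).tendsto x).eventually_const_lt h] with y hy _ using hy
    · exact Eventually.of_forall fun _ h' => absurd h' h
  rw [mem_interior_iff_mem_nhds]
  filter_upwards [hε, hscale.eventually (T.eventually_mem_hull _), hcoord]
    with y ⟨hyΩ, hyv⟩ hyx hycoord
  obtain ⟨t, ht, hyt⟩ := T.exists_mem_hull (subset_closure hyΩ)
  have hvt : v ∈ t := T.vertex_mem_of_mem_hull hs ht hv (hyv t ht hyt)
  have hbary := T.bary_eq_bary_of_lineMap_mem hs ht hv hvt hεmem hxs (hyx t ht hyt)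
  exact T.hull_subset ht ((T.isSimplex ht).mem_hull_of_lineMap_mem hvt hεmem.1 hyt
    (hycoord t ht (hbary ▸ hpos)).le)

lemma exists_card_lt_of_notMem_interior (hΩ : IsOpen Ω) (hs : s ∈ T.cells) (hys : y ∈ hull s)
    (hy : y ∉ interior (closure Ω)) (hbd : ∀ v ∈ s, bary s v y = 0 → ¬facet s v ⊆ frontier Ω) :
    ∃ f ⊆ s, f.card < d ∧ y ∈ convexHull ℝ (f : Set (Pt d)) := by
  classical
  have hs' := T.isSimplex hs
  obtain ⟨v, hv, hv0⟩ : ∃ v ∈ s, bary s v y = 0 := by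
    by_contra! hne
    exact hy (interior_mono (T.hull_subset hs) (hs'.mem_interior_hull.2 fun w hw =>
      (hs'.mem_hull.1 hys w hw).lt_of_ne' (hne w hw)))
  obtain ⟨w, hw, hwv, hw0⟩ : ∃ w ∈ s, w ≠ v ∧ bary s w y = 0 := by
    by_contra! hne
    have hyint : y ∈ facetInterior s v :=
      ⟨hv0, fun w hw hwv => (hs'.mem_hull.1 hys w hw).lt_of_ne' (hne w hw hwv)⟩
    obtain ⟨t, ht, hadj⟩ :=
      (T.exists_adjacentAcross_or_facet_subset_frontier hΩ hs hv).resolve_right (hbd v hv hv0)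
    refine hy (mem_interior_iff_mem_nhds.2 ?_)
    filter_upwards [T.eventually_mem_hull_union hs ht hv hadj hyint] with z hz
    exact hz.elim (fun h => T.hull_subset hs h) fun h => T.hull_subset ht h
  refine ⟨(s.erase v).erase w, (Finset.erase_subset _ _).trans (Finset.erase_subset _ _), ?_, ?_⟩
  · have hpair := Finset.card_le_card (Finset.insert_subset hw (Finset.singleton_subset_iff.2 hv))
    rw [Finset.card_pair hwv, hs'.card_eq] at hpair
    rw [Finset.card_erase_of_mem (Finset.mem_erase.2 ⟨hwv, hw⟩), Finset.card_erase_of_mem hv,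
      hs'.card_eq]
    omega
  · rw [hs'.mem_convexHull (by
      exact_mod_cast (Finset.erase_subset _ _).trans (Finset.erase_subset _ _))]
    refine ⟨hys, fun u hu huf => ?_⟩
    by_contra hne
    exact huf (Finset.mem_erase.2 ⟨fun huw => hne (huw ▸ hw0),
      Finset.mem_erase.2 ⟨fun huv => hne (huv ▸ hv0), hu⟩⟩)

open Classical in
lemma exists_adjacentAcross_or_card_inter_lt (hs : IsSimplex s) (ht : IsSimplex t) (hts : t ≠ s) :
    (∃ v ∈ s, v ∉ t ∧ AdjacentAcross s v t) ∨ (s ∩ t).card < d := by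
  refine or_iff_not_imp_right.2 fun hcard => ?_
  have hsdiff : (s \ t).card ≤ 1 := by
    have hsum := Finset.card_inter_add_card_sdiff s t
    rw [hs.card_eq] at hsum
    omega
  obtain ⟨v, hv⟩ : (s \ t).Nonempty :=
    Finset.sdiff_nonempty.2 fun hst => hts (hs.eq_of_subset ht hst).symm
  refine ⟨v, (Finset.mem_sdiff.1 hv).1, (Finset.mem_sdiff.1 hv).2, hts, fun w hw => ?_⟩
  by_contra hwt
  exact hw.2 (Finset.card_le_one.1 hsdiff w (Finset.mem_sdiff.2 ⟨hw.1, hwt⟩) v hv)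

/-- A set `A` of cells with the vertex `x` that is closed under passing to the neighbour across a
facet containing `x` and in which no facet containing `x` lies in the boundary. -/
structure IsClosedStar (x : Pt d) (A : Finset (Finset (Pt d))) : Prop where
  mem_cells : ∀ s ∈ A, s ∈ T.cells
  vertex_mem : ∀ s ∈ A, x ∈ s
  adjacent_mem : ∀ s ∈ A, ∀ v ∈ s, v ≠ x → ∀ t ∈ T.cells, AdjacentAcross s v t → t ∈ A
  not_subset_frontier : ∀ s ∈ A, ∀ v ∈ s, v ≠ x → ¬facet s v ⊆ frontier Ω

/-- Near the vertex `x`, the closure of the complement of the union of the cells in `A`. -/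
def starComplement (x : Pt d) (A : Finset (Finset (Pt d))) : Set (Pt d) :=
  (interior (closure Ω))ᶜ ∪ ⋃ t ∈ {t ∈ (T.cells : Set (Finset (Pt d))) | x ∈ t ∧ t ∉ A}, hull t

namespace IsClosedStar

variable {T} {A : Finset (Finset (Pt d))}

lemma isClosed_starComplement : IsClosed (T.starComplement x A) :=
  isOpen_interior.isClosed_compl.union
    ((T.cells.finite_toSet.sep _).isClosed_biUnion fun _ _ => isClosed_hull)

lemma exists_card_lt_of_mem_starComplement (hΩ : IsOpen Ω) (hA : T.IsClosedStar x A) (hs : s ∈ A)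
    (hys : y ∈ hull s) (hpos : 0 < bary s x y) (hy : y ∈ T.starComplement x A) :
    ∃ f ⊆ s, f.card < d ∧ y ∈ convexHull ℝ (f : Set (Pt d)) := by
  classical
  have hsT := hA.mem_cells s hs
  rcases hy with hy | hy
  · refine T.exists_card_lt_of_notMem_interior hΩ hsT hys hy fun v hv hv0 =>
      hA.not_subset_frontier s hs v hv ?_
    rintro rfl
    exact hpos.ne' hv0
  · simp only [mem_iUnion, exists_prop] at hy
    obtain ⟨t, ⟨ht, hxt, htA⟩, hyt⟩ := hy
    refine ⟨s ∩ t, Finset.inter_subset_left, ?_, ?_⟩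
    · refine (exists_adjacentAcross_or_card_inter_lt (T.isSimplex hsT) (T.isSimplex ht)
        fun hts => htA (hts ▸ hs)).resolve_left ?_
      rintro ⟨v, hv, hvt, hadj⟩
      exact htA (hA.adjacent_mem s hs v hv (fun hvx => hvt (hvx ▸ hxt)) t ht hadj)
    · rw [Finset.coe_inter, ← T.inter_eq s hsT t ht]
      exact ⟨hys, hyt⟩

lemma eventually_bary_pos (hA : T.IsClosedStar x A) : ∀ᶠ y in 𝓝 x, ∀ s ∈ A, 0 < bary s x y := by
  rw [Filter.eventually_all_finset]
  intro s hs
  refine ((continuous_bary s x).tendsto x).eventually_const_lt ?_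
  rw [(T.isSimplex (hA.mem_cells s hs)).bary_self (hA.vertex_mem s hs)]
  exact one_pos

lemma exists_ball_disjoint_interior_starComplement (hΩ : IsOpen Ω) (hA : T.IsClosedStar x A)
    (hne : A.Nonempty) :
    ∃ δ > 0, ¬(interior (T.starComplement x A) ∩ Metric.ball x δ).Nonempty := by
  classical
  obtain ⟨s₀, hs₀⟩ := hne
  have hs₀T := hA.mem_cells s₀ hs₀
  have hxs₀ : x ∈ hull s₀ := subset_convexHull ℝ _ (hA.vertex_mem s₀ hs₀)
  obtain ⟨δ, hδ, hball⟩ :=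
    Metric.eventually_nhds_iff_ball.1 ((T.eventually_mem_hull x).and hA.eventually_bary_pos)
  refine ⟨δ, hδ, not_nonempty_interior_inter_of_codim_two (P := ⋃ s ∈ A, hull s)
    (S := {f ∈ T.cells.biUnion Finset.powerset | f.card < d})
    (A.finite_toSet.isClosed_biUnion fun _ _ => isClosed_hull) isClosed_starComplement
    (convex_ball x δ) Metric.isOpen_ball (fun y hy => ?_)
    (fun f hf => (Finset.mem_filter.1 hf).2) (fun y hyA hy hyball => ?_) ?_⟩
  · by_cases hyΩ : y ∈ interior (closure Ω)
    · obtain ⟨t, ht, hyt⟩ := T.exists_mem_hull (interior_subset hyΩ)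
      have hxt := T.vertex_mem_of_mem_hull hs₀T ht (hA.vertex_mem s₀ hs₀) ((hball y hy).1 t ht hyt)
      by_cases htA : t ∈ A
      · exact Or.inl (mem_biUnion htA hyt)
      · exact Or.inr (Or.inr (mem_biUnion ⟨ht, hxt, htA⟩ hyt))
    · exact Or.inr (Or.inl hyΩ)
  · simp only [mem_iUnion, exists_prop] at hyA
    obtain ⟨s, hs, hys⟩ := hyA
    obtain ⟨f, hfs, hcard, hyf⟩ := hA.exists_card_lt_of_mem_starComplement hΩ hs hys
      ((hball y hyball).2 s hs) hy
    exact ⟨f, Finset.mem_filter.2 ⟨Finset.mem_biUnion.2 ⟨s, hA.mem_cells s hs,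
      Finset.mem_powerset.2 hfs⟩, hcard⟩, hyf⟩
  · have hcl := (T.isSimplex hs₀T).hull_subset_closure_interior hxs₀
    obtain ⟨y, hyball, hy⟩ := mem_closure_iff_nhds.1 hcl _ (Metric.ball_mem_nhds x hδ)
    exact ⟨y, interior_mono (subset_biUnion_of_mem (u := fun s => hull s) hs₀) hy, hyball⟩

lemma notMem_closure_of_subset_starComplement (hΩ : IsOpen Ω) (hA : T.IsClosedStar x A)
    (hne : A.Nonempty) {V : Set (Pt d)} (hV : IsOpen V) (hsub : V ⊆ T.starComplement x A) :
    x ∉ closure V := by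
  intro hx
  obtain ⟨δ, hδ, hdisj⟩ := hA.exists_ball_disjoint_interior_starComplement hΩ hne
  obtain ⟨y, hyball, hyV⟩ := mem_closure_iff_nhds.1 hx _ (Metric.ball_mem_nhds x hδ)
  exact hdisj ⟨y, interior_maximal hsub hV hyV, hyball⟩

lemma mem_interior_closure (hΩ : IsOpen Ω) (hA : T.IsClosedStar x A) (hne : A.Nonempty) :
    x ∈ interior (closure Ω) := by
  have hx := hA.notMem_closure_of_subset_starComplement hΩ hne isClosed_closure.isOpen_compl
    ((compl_subset_compl.2 interior_subset).trans subset_union_left)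
  rwa [closure_compl, notMem_compl_iff] at hx

lemma mem_of_vertex_mem (hΩ : IsOpen Ω) (hA : T.IsClosedStar x A) (hne : A.Nonempty)
    (ht : t ∈ T.cells) (hxt : x ∈ t) : t ∈ A := by
  by_contra htA
  have hsub : hull t ⊆ T.starComplement x A := (subset_biUnion_of_mem (u := fun s => hull s)
    (show t ∈ {t ∈ (T.cells : Set (Finset (Pt d))) | x ∈ t ∧ t ∉ A} from
      ⟨ht, hxt, htA⟩)).trans subset_union_right
  exact hA.notMem_closure_of_subset_starComplement hΩ hne isOpen_interior
    (interior_subset.trans hsub)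
    ((T.isSimplex ht).hull_subset_closure_interior (subset_convexHull ℝ _ hxt))

end IsClosedStar

end SimplicialMesh

end HDG

/-! ### Truncated mollification and membership in `H^1_0` -/

namespace HDG

lemma exists_frequently_mem_of_iUnion_eq_univ {α β ι : Type*} [Finite ι] {C : ι → Set α}
    (hcov : ⋃ i, C i = univ) (γ : β → α) (l : Filter β) [l.NeBot] :
    ∃ i, ∃ᶠ τ in l, γ τ ∈ C i := by
  by_contra! hnot
  obtain ⟨τ, hτ⟩ := (Filter.eventually_all.2 hnot).exists
  obtain ⟨i, hi⟩ := mem_iUnion.1 (hcov ▸ mem_univ (γ τ))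
  exact hτ i hi

/-- Along a segment, the Lipschitz estimate propagates beyond every parameter for which it holds,
since the segment stays frequently in one of the closed sets. -/
lemma lipschitzWith_of_finite_closed_cover {E F ι : Type*} [NormedAddCommGroup E]
    [NormedSpace ℝ E] [PseudoMetricSpace F] [Finite ι] {f : E → F} {C : ι → Set E} {K : NNReal}
    (hC : ∀ i, IsClosed (C i)) (hcov : ⋃ i, C i = univ) (hf : ∀ i, LipschitzOnWith K f (C i)) :
    LipschitzWith K f := by
  have hcont : Continuous f :=
    (locallyFinite_of_finite C).continuous hcov hC fun i => (hf i).continuousOn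
  refine LipschitzWith.of_dist_le_mul fun x y => ?_
  let γ : ℝ → E := AffineMap.lineMap x y
  have hγ : Continuous γ := AffineMap.lineMap_continuous
  let S : Set ℝ := {θ | dist (f (γ θ)) (f x) ≤ K * (θ * dist x y)}
  have hS : IsClosed (S ∩ Icc 0 1) := by
    refine IsClosed.inter (isClosed_le ?_ ?_) isClosed_Icc <;> fun_prop
  have hstart : (0 : ℝ) ∈ S := by simp [S, γ]
  have hstep : ∀ θ ∈ S ∩ Ico 0 1, ∀ z ∈ Ioi θ, (S ∩ Ioc θ z).Nonempty := by
    rintro θ ⟨hθS, -⟩ z hz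
    obtain ⟨i, hi⟩ := exists_frequently_mem_of_iUnion_eq_univ hcov γ (𝓝[>] θ)
    have hθi : γ θ ∈ C i :=
      (hC i).mem_of_frequently_of_tendsto hi ((hγ.tendsto θ).mono_left nhdsWithin_le_nhds)
    obtain ⟨τ, hτi, hτ⟩ := (hi.and_eventually (Ioc_mem_nhdsGT hz)).exists
    have hlocal : dist (f (γ τ)) (f (γ θ)) ≤ K * ((τ - θ) * dist x y) := by
      have hdist := (hf i).dist_le_mul _ hτi _ hθi
      rwa [dist_lineMap_lineMap, Real.dist_eq τ, abs_of_pos (sub_pos.2 hτ.1)] at hdist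
    refine ⟨τ, ?_, hτ⟩
    calc dist (f (γ τ)) (f x) ≤ dist (f (γ τ)) (f (γ θ)) + dist (f (γ θ)) (f x) :=
          dist_triangle _ _ _
      _ ≤ K * ((τ - θ) * dist x y) + K * (θ * dist x y) := add_le_add hlocal hθS
      _ = K * (τ * dist x y) := by ring
  have hend := hS.Icc_subset_of_forall_exists_gt hstart hstep (right_mem_Icc.2 zero_le_one)
  simp only [S, γ, mem_ofPred_eq, AffineMap.lineMap_apply_one, one_mul] at hend
  rwa [dist_comm] at hend

lemma tendsto_eLpNorm_of_bounded {α E : Type*} [MeasurableSpace α] [NormedAddCommGroup E]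
    {μ : Measure α} [IsFiniteMeasure μ] {p : ℝ≥0∞} (hp : 1 ≤ p) (hp' : p ≠ ⊤) {f : ℕ → α → E}
    {B : ℝ} (hf : ∀ n, AEStronglyMeasurable (f n) μ) (hB : ∀ n x, ‖f n x‖ ≤ B)
    (hlim : ∀ᵐ x ∂μ, Tendsto (fun n => f n x) atTop (𝓝 0)) :
    Tendsto (fun n => eLpNorm (f n) p μ) atTop (𝓝 0) := by
  have hui : UnifIntegrable f p μ := by
    refine unifIntegrable_of hp hp' hf fun ε _ => ⟨Real.toNNReal B + 1, fun n => ?_⟩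
    have hempty : {x | Real.toNNReal B + 1 ≤ ‖f n x‖₊} = ∅ := by
      refine eq_empty_of_forall_notMem fun x hx => ?_
      have hlarge : (Real.toNNReal B + 1 : ℝ) ≤ ‖f n x‖ := by exact_mod_cast hx
      linarith [hB n x, Real.le_coe_toNNReal B]
    simp [hempty]
  simpa using tendsto_Lp_finite_of_tendsto_ae hp hp' hf (MemLp.zero (ε := E) (p := p)) hui (g := 0)
    (by simpa using hlim)

section Mollifier

variable {d : ℕ}

/-- Mollification with the standard bump function supported in the ball of radius `δ`. -/
noncomputable def mollify (δ : ℝ) (hδ : 0 < δ) (g : Pt d → ℝ) : Pt d → ℝ :=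
  convolution ((⟨δ / 2, δ, half_pos hδ, half_lt_self hδ⟩ : ContDiffBump (0 : Pt d)).normed volume) g
    (ContinuousLinearMap.lsmul ℝ ℝ) volume

variable {δ : ℝ} {hδ : 0 < δ} {g : Pt d → ℝ}

lemma contDiff_mollify (hg : Continuous g) : ContDiff ℝ ∞ (mollify δ hδ g) :=
  HasCompactSupport.contDiff_convolution_left _ (ContDiffBump.hasCompactSupport_normed _)
    (ContDiffBump.contDiff_normed _) hg.locallyIntegrable

lemma abs_mollify_sub_sub_le (hg : Continuous g) {x y : Pt d} {a c : ℝ}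
    (h : ∀ t, ‖t‖ ≤ δ → |g (x - t) - g (y - t) - a| ≤ c) :
    |mollify δ hδ g x - mollify δ hδ g y - a| ≤ c := by
  let φ : ContDiffBump (0 : Pt d) := ⟨δ / 2, δ, half_pos hδ, half_lt_self hδ⟩
  let ρ := φ.normed volume
  have hintegrable : ∀ f : Pt d → ℝ, Continuous f → Integrable (fun t => ρ t * f t) := fun f hf =>
    (φ.continuous_normed.mul hf).integrable_of_hasCompactSupport
      φ.hasCompactSupport_normed.mul_right
  have hconst : ∀ b : ℝ, ∫ t, ρ t * b = b := fun b => by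
    rw [integral_mul_const, φ.integral_normed, one_mul]
  have hdiff : mollify δ hδ g x - mollify δ hδ g y - a
      = ∫ t, ρ t * (g (x - t) - g (y - t) - a) := by
    have hx := hintegrable (fun t => g (x - t)) (by fun_prop)
    have hy := hintegrable (fun t => g (y - t)) (by fun_prop)
    calc mollify δ hδ g x - mollify δ hδ g y - a
        = (∫ t, ρ t * g (x - t)) - (∫ t, ρ t * g (y - t)) - ∫ t, ρ t * a := by rw [hconst a]; rfl
      _ = ∫ t, (ρ t * g (x - t) - ρ t * g (y - t) - ρ t * a) := by
          rw [← integral_sub hx hy]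
          exact (integral_sub (hx.sub hy) (hintegrable _ continuous_const)).symm
      _ = ∫ t, ρ t * (g (x - t) - g (y - t) - a) := by simp only [mul_sub]
  rw [hdiff, ← hconst c, ← Real.norm_eq_abs]
  refine (norm_integral_le_integral_norm _).trans
    (integral_mono (hintegrable _ (by fun_prop)).norm (hintegrable _ continuous_const) fun t => ?_)
  have hρ : 0 ≤ ρ t := φ.nonneg_normed t
  simp only [Real.norm_eq_abs, abs_mul, abs_of_nonneg hρ]
  by_cases ht : ‖t‖ ≤ δ
  · exact mul_le_mul_of_nonneg_left (h t ht) hρ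
  · have hzero : ρ t = 0 := by
      have hmem : t ∉ Function.support ρ := by
        rw [φ.support_normed_eq, Metric.mem_ball, dist_zero_right]
        exact fun hlt => ht hlt.le
      simpa using hmem
    simp [hzero]

lemma abs_mollify_sub_le (hg : Continuous g) {x : Pt d} {c : ℝ}
    (h : ∀ y, dist y x < δ → |g y - g x| ≤ c) : |mollify δ hδ g x - g x| ≤ c :=
  ContDiffBump.dist_normed_convolution_le hg.aestronglyMeasurable h

lemma lipschitzWith_mollify {K : NNReal} (hg : LipschitzWith K g) :
    LipschitzWith K (mollify δ hδ g) := by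
  refine LipschitzWith.of_dist_le_mul fun x y => ?_
  rw [Real.dist_eq]
  simpa using abs_mollify_sub_sub_le (hδ := hδ) hg.continuous (x := x) (y := y) (a := 0)
    (c := K * dist x y) fun t _ => by
      simpa [Real.dist_eq, dist_sub_right] using hg.dist_le_mul (x - t) (y - t)

lemma gradient_eq_of_eventually {f g : Pt d → ℝ} {x : Pt d} {c : ℝ}
    (h : ∀ᶠ z in 𝓝 x, f z = g z + c) : gradient f x = gradient g x := by
  rw [gradient, gradient, Filter.EventuallyEq.fderiv_eq (show f =ᶠ[𝓝 x] fun z => g z + c from h)]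
  simp

lemma gradient_mollify_eq (hg : Continuous g) {f : Pt d →ᵃ[ℝ] ℝ} {x : Pt d} {r c : ℝ}
    (hδr : δ < r) (h : ∀ y ∈ Metric.ball x r, g y = f y + c) :
    gradient (mollify δ hδ g) x = gradient f x := by
  refine gradient_eq_of_eventually (c := mollify δ hδ g x - f x) ?_
  filter_upwards [Metric.ball_mem_nhds x (sub_pos.2 hδr)] with y hy
  have hshift : ∀ z ∈ Metric.ball x (r - δ), ∀ t : Pt d, ‖t‖ ≤ δ → z - t ∈ Metric.ball x r := by
    intro z hz t ht
    have htri := dist_triangle (z - t) z x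
    have hdist : dist (z - t) z = ‖t‖ := by simp
    rw [Metric.mem_ball] at hz ⊢
    linarith
  have hzero := abs_mollify_sub_sub_le (hδ := hδ) hg (x := y) (y := x) (a := f y - f x)
    (c := 0) fun t ht => by
      have htranslate : f (y - t) - f (x - t) = f y - f x := by
        simp only [← vsub_eq_sub, ← f.linearMap_vsub]
        simp
      rw [h _ (hshift y hy t ht),
        h _ (hshift x (Metric.mem_ball_self (sub_pos.2 hδr)) t ht)]
      simp [htranslate]
  linarith [abs_nonpos_iff.1 hzero]

end Mollifier

section SoftThreshold

/-- Soft thresholding: the values are moved towards zero by `ε`, without changing the sign. -/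
def softThreshold (ε t : ℝ) : ℝ := max (t - ε) (min (t + ε) 0)

lemma lipschitzWith_softThreshold (ε : ℝ) : LipschitzWith 1 (softThreshold ε) := by
  have hsub : LipschitzWith 1 (fun t : ℝ => t - ε) := by
    simpa using LipschitzWith.id.sub (LipschitzWith.const ε)
  have hadd : LipschitzWith 1 (fun t : ℝ => t + ε) := by
    simpa using LipschitzWith.id.add (LipschitzWith.const ε)
  have hmax := hsub.max (hadd.min_const 0)
  rwa [max_self] at hmax

variable {ε t : ℝ}

lemma softThreshold_of_le (hε : 0 ≤ ε) (h : ε ≤ t) : softThreshold ε t = t - ε := by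
  rw [softThreshold, min_eq_right (by linarith), max_eq_left (by linarith)]

lemma softThreshold_of_le_neg (hε : 0 ≤ ε) (h : t ≤ -ε) : softThreshold ε t = t + ε := by
  rw [softThreshold, min_eq_left (by linarith), max_eq_right (by linarith)]

lemma softThreshold_of_abs_le (h : |t| ≤ ε) : softThreshold ε t = 0 := by
  obtain ⟨hl, hr⟩ := abs_le.1 h
  rw [softThreshold, min_eq_right (by linarith), max_eq_right (by linarith)]

lemma abs_softThreshold_sub_le (hε : 0 ≤ ε) (t : ℝ) : |softThreshold ε t - t| ≤ ε := by
  rcases le_total ε t with h | h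
  · rw [softThreshold_of_le hε h, abs_le]; constructor <;> linarith
  · rcases le_total t (-ε) with h' | h'
    · rw [softThreshold_of_le_neg hε h', abs_le]; constructor <;> linarith
    · rw [softThreshold_of_abs_le (abs_le.2 ⟨h', h⟩), abs_le]; constructor <;> linarith

lemma exists_forall_ball_softThreshold_eq_add {X : Type*} [PseudoMetricSpace X] {w : X → ℝ} {x : X}
    (hw : ContinuousAt w x) (hx : w x ≠ 0 ∨ w =ᶠ[𝓝 x] 0) :
    ∃ r > 0, ∀ᶠ ε in 𝓝[>] 0, ∃ c, ∀ y ∈ Metric.ball x r, softThreshold ε (w y) = w y + c := by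
  rcases hx with hx | hx
  · rcases hx.lt_or_gt with hneg | hpos
    · obtain ⟨r, hr, hball⟩ := Metric.eventually_nhds_iff_ball.1
        (hw.eventually_lt_const (show w x < w x / 2 by linarith))
      refine ⟨r, hr, ?_⟩
      filter_upwards [Ioo_mem_nhdsGT (show 0 < -(w x / 2) by linarith)] with ε ⟨hε, hεw⟩
      exact ⟨ε, fun y hy => softThreshold_of_le_neg hε.le (by linarith [hball y hy])⟩
    · obtain ⟨r, hr, hball⟩ := Metric.eventually_nhds_iff_ball.1
        (hw.eventually_const_lt (show w x / 2 < w x by linarith))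
      refine ⟨r, hr, ?_⟩
      filter_upwards [Ioo_mem_nhdsGT (half_pos hpos)] with ε ⟨hε, hεw⟩
      exact ⟨-ε, fun y hy => by
        rw [softThreshold_of_le hε.le (hεw.trans (hball y hy)).le, sub_eq_add_neg]⟩
  · obtain ⟨r, hr, hball⟩ := Metric.eventually_nhds_iff_ball.1 hx
    refine ⟨r, hr, eventually_mem_nhdsWithin.mono fun ε (hε : 0 < ε) => ⟨0, fun y hy => ?_⟩⟩
    rw [hball y hy, Pi.zero_apply, softThreshold_of_abs_le (by simpa using hε.le), add_zero]

variable {d : ℕ} {Ω : Set (Pt d)} {w : Pt d → ℝ} {K : NNReal} {δ : ℝ} {hδ : 0 < δ}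

lemma lipschitzWith_softThreshold_comp (hw : LipschitzWith K w) :
    LipschitzWith K fun x => softThreshold ε (w x) := by
  have hcomp := (lipschitzWith_softThreshold ε).comp hw
  rwa [one_mul] at hcomp

lemma abs_mollify_softThreshold_sub_le (hw : LipschitzWith K w) (hKδ : K * δ ≤ ε) (x : Pt d) :
    |mollify δ hδ (fun x => softThreshold ε (w x)) x - w x| ≤ 2 * ε := by
  have hv := lipschitzWith_softThreshold_comp (ε := ε) hw
  have hmollify := abs_mollify_sub_le (hδ := hδ) hv.continuous (x := x) (c := ε) fun y hy =>
    (hv.dist_le_mul y x).trans ((mul_le_mul_of_nonneg_left hy.le K.2).trans hKδ)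
  have hε : 0 ≤ ε := (mul_nonneg K.2 hδ.le).trans hKδ
  linarith [abs_softThreshold_sub_le hε (w x), abs_sub_le
    (mollify δ hδ (fun x => softThreshold ε (w x)) x) (softThreshold ε (w x)) (w x)]

lemma mollify_softThreshold_eq_zero (hw : LipschitzWith K w) (hKδ : K * δ ≤ ε / 2) {x : Pt d}
    (hx : |w x| < ε / 2) : mollify δ hδ (fun x => softThreshold ε (w x)) x = 0 := by
  have hzero : ∀ y, dist y x < δ → softThreshold ε (w y) = 0 := fun y hy => by
    have hdist : |w y - w x| ≤ ε / 2 :=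
      (hw.dist_le_mul y x).trans ((mul_le_mul_of_nonneg_left hy.le K.2).trans hKδ)
    exact softThreshold_of_abs_le (by linarith [abs_sub_abs_le_abs_sub (w y) (w x)])
  have hx0 := hzero x (by rwa [dist_self])
  have hdiff := abs_mollify_sub_le (hδ := hδ)
    (lipschitzWith_softThreshold_comp (ε := ε) hw).continuous (x := x) (c := 0) fun y hy => by
      rw [hzero y hy, hx0, sub_zero, abs_zero]
  rwa [hx0, sub_zero, abs_nonpos_iff] at hdiff

lemma tsupport_mollify_softThreshold_subset (hw : LipschitzWith K w) (hKδ : K * δ ≤ ε / 2)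
    (hε : 0 < ε) (hwΩ : ∀ x ∉ Ω, w x = 0) :
    tsupport (mollify δ hδ fun x => softThreshold ε (w x)) ⊆ Ω := by
  have hclosed : IsClosed {x | ε / 2 ≤ |w x|} := isClosed_le continuous_const hw.continuous.abs
  refine (closure_minimal (fun x hx => ?_) hclosed).trans fun x (hx : ε / 2 ≤ |w x|) => ?_
  · by_contra hlt
    exact hx (mollify_softThreshold_eq_zero hw hKδ (not_le.1 hlt))
  · by_contra hxΩ
    rw [hwΩ x hxΩ, abs_zero] at hx
    linarith

end SoftThreshold

section Sobolev

variable {d : ℕ} {Ω : Set (Pt d)} {w : Pt d → ℝ} {K : NNReal}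

lemma norm_gradient_le_of_lipschitzWith (hw : LipschitzWith K w) (x : Pt d) :
    ‖gradient w x‖ ≤ K := by
  rw [gradient, LinearIsometryEquiv.norm_map]
  exact norm_fderiv_le_of_lipschitz ℝ hw

lemma measurable_gradient (f : Pt d → ℝ) : Measurable (gradient f) :=
  (InnerProductSpace.toDual ℝ (Pt d)).symm.continuous.measurable.comp (measurable_fderiv ℝ f)

lemma exists_abs_le_of_bounded_support (hΩ : Bornology.IsBounded Ω) (hw : Continuous w)
    (hwΩ : ∀ x ∉ Ω, w x = 0) : ∃ B, ∀ x, |w x| ≤ B := by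
  obtain ⟨B, hB⟩ := hΩ.isCompact_closure.exists_bound_of_continuousOn hw.continuousOn
  refine ⟨max B 0, fun x => ?_⟩
  by_cases hx : x ∈ Ω
  · exact (hB x (subset_closure hx)).trans (le_max_left _ _)
  · rw [hwΩ x hx, abs_zero]
    exact le_max_right _ _

lemma eventually_gradient_mollify_softThreshold_eq (hw : Continuous w) {f : Pt d →ᵃ[ℝ] ℝ}
    {x : Pt d} (hf : w =ᶠ[𝓝 x] f) (hx : w x ≠ 0 ∨ w =ᶠ[𝓝 x] 0) {ε δ : ℕ → ℝ}
    (hδ : ∀ n, 0 < δ n) (hεlim : Tendsto ε atTop (𝓝[>] 0)) (hδlim : Tendsto δ atTop (𝓝 0)) :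
    ∀ᶠ n in atTop,
      gradient (mollify (δ n) (hδ n) fun x => softThreshold (ε n) (w x)) x = gradient w x := by
  obtain ⟨r, hr, hthreshold⟩ := exists_forall_ball_softThreshold_eq_add hw.continuousAt hx
  obtain ⟨r', hr', haffine⟩ := Metric.eventually_nhds_iff_ball.1 hf
  filter_upwards [hεlim.eventually hthreshold, hδlim.eventually_lt_const (lt_min hr hr')]
    with n ⟨c, hc⟩ hn
  have hcont : Continuous fun x => softThreshold (ε n) (w x) :=
    (lipschitzWith_softThreshold _).continuous.comp hw
  rw [gradient_mollify_eq (f := f) (c := c) hcont hn fun y hy => ?_,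
    gradient_eq_of_eventually (f := w) (g := f) (c := 0)
      (hf.mono fun y hy => by rw [hy, add_zero])]
  rw [hc y (Metric.ball_subset_ball (min_le_left _ _) hy),
    haffine y (Metric.ball_subset_ball (min_le_right _ _) hy)]

lemma memH10_of_lipschitzWith (hΩ : Bornology.IsBounded Ω) (hw : LipschitzWith K w)
    (hwΩ : ∀ x ∉ Ω, w x = 0)
    (haffine : ∀ᵐ x ∂(volume.restrict Ω),
      (∃ f : Pt d →ᵃ[ℝ] ℝ, w =ᶠ[𝓝 x] f) ∧ (w x ≠ 0 ∨ w =ᶠ[𝓝 x] 0)) : MemH10 Ω w := by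
  have hfinite : IsFiniteMeasure (volume.restrict Ω) :=
    ⟨by rw [Measure.restrict_apply_univ]; exact hΩ.measure_lt_top⟩
  obtain ⟨B, hB⟩ := exists_abs_le_of_bounded_support hΩ hw.continuous hwΩ
  let ε : ℕ → ℝ := fun n => 1 / ((n : ℝ) + 1)
  have hε : ∀ n, 0 < ε n := fun n => Nat.one_div_pos_of_nat
  have hε_le : ∀ n, ε n ≤ 1 := fun n =>
    div_le_one_of_le₀ (by linarith [n.cast_nonneg (α := ℝ)]) (by positivity)
  have hεlim : Tendsto ε atTop (𝓝 0) := tendsto_one_div_add_atTop_nhds_zero_nat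
  let δ : ℕ → ℝ := fun n => ε n / (2 * (K + 1))
  have hδ : ∀ n, 0 < δ n := fun n => div_pos (hε n) (by positivity)
  have hKδ : ∀ n, K * δ n ≤ ε n / 2 := fun n => by
    have hδε : (K + 1 : ℝ) * δ n = ε n / 2 := by simp only [δ]; field_simp
    linarith [hδ n]
  have hδlim : Tendsto δ atTop (𝓝 0) := by simpa using hεlim.div_const (2 * ((K : ℝ) + 1))
  let φ : ℕ → Pt d → ℝ := fun n => mollify (δ n) (hδ n) fun x => softThreshold (ε n) (w x)
  have hφ : ∀ n, ContDiff ℝ ∞ (φ n) := fun n =>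
    contDiff_mollify (lipschitzWith_softThreshold_comp hw).continuous
  have hφw : ∀ n x, |φ n x - w x| ≤ 2 * ε n := fun n =>
    abs_mollify_softThreshold_sub_le hw (by linarith [hKδ n, hε n])
  have hsupp : ∀ n, tsupport (φ n) ⊆ Ω := fun n =>
    tsupport_mollify_softThreshold_subset hw (hKδ n) (hε n) hwΩ
  refine ⟨MemLp.of_bound hw.continuous.aestronglyMeasurable B (Eventually.of_forall hB),
    gradient w, φ, MemLp.of_bound (measurable_gradient w).aestronglyMeasurable K
      (Eventually.of_forall (norm_gradient_le_of_lipschitzWith hw)), fun n => ⟨hφ n,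
    hΩ.isCompact_closure.of_isClosed_subset (isClosed_tsupport _) ((hsupp n).trans subset_closure),
    hsupp n⟩, ?_, ?_⟩
  · refine tendsto_eLpNorm_of_bounded one_le_two ENNReal.ofNat_ne_top (B := 2)
      (fun n => ((hφ n).continuous.sub hw.continuous).aestronglyMeasurable)
      (fun n x => (hφw n x).trans (by linarith [hε_le n])) (Eventually.of_forall fun x => ?_)
    exact squeeze_zero_norm (hφw · x) (by simpa using hεlim.const_mul 2)
  · refine tendsto_eLpNorm_of_bounded one_le_two ENNReal.ofNat_ne_top (B := K + K) (fun n =>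
      ((measurable_gradient _).sub (measurable_gradient _)).aestronglyMeasurable) (fun n x =>
      (norm_sub_le _ _).trans (add_le_add (norm_gradient_le_of_lipschitzWith
        (lipschitzWith_mollify (lipschitzWith_softThreshold_comp hw)) x)
        (norm_gradient_le_of_lipschitzWith hw x))) ?_
    filter_upwards [haffine] with x ⟨⟨f, hf⟩, hx⟩
    refine tendsto_const_nhds.congr' ?_
    filter_upwards [eventually_gradient_mollify_softThreshold_eq hw.continuous hf hx hδ
      (tendsto_nhdsWithin_iff.2 ⟨hεlim, Eventually.of_forall hε⟩) hδlim] with n hn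
    exact (sub_eq_zero.2 hn).symm

lemma volume_affineMap_eq_zero (f : Pt d →ᵃ[ℝ] ℝ) (hf : f ≠ 0) : volume {x | f x = 0} = 0 := by
  let A : AffineSubspace ℝ (Pt d) := (AffineSubspace.mk' (0 : ℝ) ⊥).comap f
  have hmem : ∀ x, x ∈ A ↔ f x = 0 := fun x => by
    rw [AffineSubspace.mem_comap, AffineSubspace.mem_mk']
    simp
  have hA : {x | f x = 0} = (A : Set (Pt d)) := ext fun x => (hmem x).symm
  rw [hA]
  refine Measure.addHaar_affineSubspace _ _ fun htop => hf ?_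
  ext x
  exact (hmem x).1 (htop ▸ AffineSubspace.mem_top ℝ _ x)

end Sobolev

namespace SimplicialMesh

variable {d : ℕ} {Ω : Set (Pt d)} (T : SimplicialMesh Ω)

lemma ae_mem_interior : ∀ᵐ x ∂(volume.restrict Ω), ∃ s ∈ T.cells, x ∈ interior (hull s) := by
  have hnull : volume (⋃ s ∈ T.cells, frontier (hull s)) = 0 :=
    (measure_biUnion_null_iff T.cells.countable_toSet).2 fun s _ =>
      convex_hull.addHaar_frontier volume
  have hclosure : ∀ᵐ x ∂(volume.restrict Ω), x ∈ closure Ω :=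
    ae_restrict_of_ae_restrict_of_subset subset_closure
      (ae_restrict_mem isClosed_closure.measurableSet)
  filter_upwards [ae_restrict_of_ae (measure_eq_zero_iff_ae_notMem.1 hnull), hclosure]
    with x hx hxΩ
  obtain ⟨s, hs, hxs⟩ := T.exists_mem_hull hxΩ
  refine ⟨s, hs, of_not_not fun hns => hx (mem_biUnion hs ?_)⟩
  rw [frontier, isClosed_hull.closure_eq]
  exact ⟨hxs, hns⟩

lemma ae_eventuallyEq_affineMap {w : Pt d → ℝ}
    (hw : ∀ s ∈ T.cells, ∃ f : Pt d →ᵃ[ℝ] ℝ, EqOn w f (hull s)) :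
    ∀ᵐ x ∂(volume.restrict Ω),
      (∃ f : Pt d →ᵃ[ℝ] ℝ, w =ᶠ[𝓝 x] f) ∧ (w x ≠ 0 ∨ w =ᶠ[𝓝 x] 0) := by
  choose! f hf using hw
  have hnull : ∀ᵐ x ∂(volume : Measure (Pt d)), ∀ s ∈ T.cells, f s ≠ 0 → f s x ≠ 0 := by
    refine (ae_ball_iff T.cells.countable_toSet).2 fun s _ => ?_
    by_cases hs : f s = 0
    · exact Eventually.of_forall fun _ h => absurd hs h
    · filter_upwards [measure_eq_zero_iff_ae_notMem.1 (volume_affineMap_eq_zero (f s) hs)]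
        with x hx _ using hx
  filter_upwards [T.ae_mem_interior, ae_restrict_of_ae hnull] with x ⟨s, hs, hxs⟩ hx
  have hnear : w =ᶠ[𝓝 x] f s := (hf s hs).eventuallyEq_of_mem (mem_interior_iff_mem_nhds.1 hxs)
  refine ⟨⟨f s, hnear⟩, or_iff_not_imp_left.2 fun hwx => ?_⟩
  have hzero : f s = 0 := by
    by_contra hne
    exact hx s hs hne (hnear.eq_of_nhds ▸ not_not.1 hwx)
  rw [hzero] at hnear
  exact hnear

end SimplicialMesh

end HDG

/-! ### Polynomials and the inverse inequality -/

namespace HDG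

section Polynomials

variable {m n : ℕ}

@[fun_prop]
lemma continuous_polyFun (q : Poly n) : Continuous (polyFun q) :=
  (MvPolynomial.continuous_eval q).comp (by fun_prop)

lemma polyFun_add (q r : Poly n) (x : Pt n) : polyFun (q + r) x = polyFun q x + polyFun r x :=
  map_add (MvPolynomial.eval _) q r

lemma polyFun_sub (q r : Poly n) (x : Pt n) : polyFun (q - r) x = polyFun q x - polyFun r x :=
  map_sub (MvPolynomial.eval _) q r

lemma polyFun_smul (c : ℝ) (q : Poly n) (x : Pt n) : polyFun (c • q) x = c * polyFun q x :=
  MvPolynomial.smul_eval _ q c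

lemma exists_polyFun_eq_affineMap (f : Pt n →ᵃ[ℝ] ℝ) :
    ∃ q : Poly n, q.totalDegree ≤ 1 ∧ ∀ x, polyFun q x = f x := by
  refine ⟨MvPolynomial.C (f 0) + ∑ i, MvPolynomial.C (f.linear (EuclideanSpace.single i 1)) *
    MvPolynomial.X i, ?_, fun x => ?_⟩
  · refine (MvPolynomial.totalDegree_add _ _).trans (max_le (by simp) ?_)
    refine MvPolynomial.totalDegree_finsetSum_le fun i _ =>
      (MvPolynomial.totalDegree_mul _ _).trans ?_
    simp
  · have hcoord : x = ∑ i, x i • EuclideanSpace.single i (1 : ℝ) := by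
      ext j
      simp [Pi.single_apply]
    rw [congrFun f.decomp x, Pi.add_apply]
    conv_rhs => rw [hcoord]
    simp [polyFun, mul_comm, add_comm]

lemma exists_polyFun_eq_comp_affineMap (q : Poly n) (A : Pt m →ᵃ[ℝ] Pt n) :
    ∃ q' : Poly m, q'.totalDegree ≤ q.totalDegree ∧ ∀ x, polyFun q' x = polyFun q (A x) := by
  choose a ha hax using fun i : Fin n => exists_polyFun_eq_affineMap
    ((EuclideanSpace.proj (𝕜 := ℝ) i).toLinearMap.toAffineMap.comp A)
  refine ⟨∑ e ∈ q.support, MvPolynomial.C (q.coeff e) * ∏ i, a i ^ e i, ?_, fun x => ?_⟩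
  · refine MvPolynomial.totalDegree_finsetSum_le fun e he => ?_
    calc (MvPolynomial.C (q.coeff e) * ∏ i, a i ^ e i).totalDegree
        ≤ (MvPolynomial.C (q.coeff e)).totalDegree + (∏ i, a i ^ e i).totalDegree :=
          MvPolynomial.totalDegree_mul _ _
      _ ≤ 0 + ∑ i, (a i ^ e i).totalDegree :=
          add_le_add (MvPolynomial.totalDegree_C _).le (MvPolynomial.totalDegree_finsetProd _ _)
      _ ≤ 0 + ∑ i, e i := by
          gcongr with i
          refine (MvPolynomial.totalDegree_pow _ _).trans ?_
          simpa using Nat.mul_le_mul_left (e i) (ha i)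
      _ = e.sum fun _ j => j := by rw [zero_add, Finsupp.sum_fintype _ _ fun _ => rfl]
      _ ≤ q.totalDegree := MvPolynomial.le_totalDegree he
  · have hcoord : ∀ i, MvPolynomial.eval (fun j => x j) (a i) = A x i := fun i => hax i x
    rw [polyFun, polyFun, MvPolynomial.eval_eq' _ q]
    simp [hcoord]

lemma eq_zero_of_polyFun_eqOn_zero {q : Poly n} {U : Set (Pt n)} (hU : IsOpen U)
    (hne : U.Nonempty) (h : EqOn (polyFun q) 0 U) : q = 0 := by
  obtain ⟨x, hx⟩ := hne
  have hopen : IsOpen ((fun f : Fin n → ℝ => (WithLp.toLp 2 f : Pt n)) ⁻¹' U) :=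
    hU.preimage (by fun_prop)
  obtain ⟨η, hη, hball⟩ := Metric.isOpen_iff.1 hopen (fun i => x i) (by simpa using hx)
  refine MvPolynomial.funext_set (fun i => Metric.ball (x i) η) (fun i => ?_) fun f hf => ?_
  · rw [Real.ball_eq_Ioo]
    exact Ioo_infinite (by linarith)
  · have hmem : f ∈ Metric.ball (fun i => x i) η := by rwa [ball_pi _ hη]
    simpa [polyFun] using h (hball hmem)

lemma eq_zero_of_setIntegral_polyFun_sq_eq_zero {q : Poly n} {A : Set (Pt n)} (hA : IsCompact A)
    (hne : (interior A).Nonempty) (h : ∫ x in A, polyFun q x ^ 2 = 0) : q = 0 := by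
  have hcont : Continuous fun x => polyFun q x ^ 2 := by fun_prop
  have hae := (setIntegral_eq_zero_iff_of_nonneg_ae (Eventually.of_forall fun _ => sq_nonneg _)
    (hcont.continuousOn.integrableOn_compact hA)).1 h
  have hzero := Measure.eqOn_open_of_ae_eq
    (ae_restrict_of_ae_restrict_of_subset interior_subset hae) isOpen_interior hcont.continuousOn
    continuousOn_const
  exact eq_zero_of_polyFun_eqOn_zero isOpen_interior hne fun x hx => pow_eq_zero_iff two_ne_zero
    |>.1 (hzero hx)

end Polynomials

lemma exists_norm_le_mul_norm_of_injective {E F G : Type*} [AddCommGroup E] [Module ℝ E]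
    [FiniteDimensional ℝ E] [NormedAddCommGroup F] [NormedSpace ℝ F] [SeminormedAddCommGroup G]
    [NormedSpace ℝ G] (Φ : E →ₗ[ℝ] F) (hΦ : Function.Injective Φ) (Ψ : E →ₗ[ℝ] G) :
    ∃ C > 0, ∀ v, ‖Ψ v‖ ≤ C * ‖Φ v‖ := by
  let e := LinearEquiv.ofInjective Φ hΦ
  obtain ⟨C, hC, hbound⟩ := (LinearMap.toContinuousLinearMap (Ψ ∘ₗ e.symm.toLinearMap)).bound
  refine ⟨C, hC, fun v => ?_⟩
  simpa [e] using hbound (e v)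

section InverseInequality

variable {n : ℕ}

/-- Restriction of polynomial functions to a set, as a linear map to the continuous functions. -/
noncomputable def polyRestrict (A : Set (Pt n)) : Poly n →ₗ[ℝ] C(A, ℝ) where
  toFun q := ⟨fun x => polyFun q x, by fun_prop⟩
  map_add' q r := ContinuousMap.ext fun x => polyFun_add q r x
  map_smul' c q := ContinuousMap.ext fun x => polyFun_smul c q x

lemma norm_toLp_polyRestrict_sq {A : Set (Pt n)} [CompactSpace A]
    [IsFiniteMeasure ((volume : Measure (Pt n)).comap ((↑) : A → Pt n))] (q : Poly n) :
    ‖ContinuousMap.toLp 2 ((volume : Measure (Pt n)).comap ((↑) : A → Pt n)) ℝ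
      (polyRestrict A q)‖ ^ 2 = ∫ x in A, polyFun q x ^ 2 := by
  have hA : MeasurableSet A := (isCompact_iff_compactSpace.2 inferInstance).measurableSet
  rw [← real_inner_self_eq_norm_sq, ContinuousMap.inner_toLp, ← integral_subtype_comap hA]
  simp [polyRestrict, sq]

lemma exists_polyFun_sq_le_mul_setIntegral {A B : Set (Pt n)} (hA : IsCompact A)
    (hne : (interior A).Nonempty) (hB : IsCompact B) (m : ℕ) :
    ∃ C > 0, ∀ q : Poly n, q.totalDegree ≤ m → ∀ x ∈ B,
      polyFun q x ^ 2 ≤ C * ∫ z in A, polyFun q z ^ 2 := by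
  have hcompactA := isCompact_iff_compactSpace.1 hA
  have hcompactB := isCompact_iff_compactSpace.1 hB
  let volA : Measure A := (volume : Measure (Pt n)).comap (↑)
  have hfinite : IsFiniteMeasure volA :=
    ⟨by rw [comap_subtype_coe_apply hA.measurableSet]
        exact (measure_mono (Subtype.coe_image_subset A univ)).trans_lt hA.measure_lt_top⟩
  let inclusion := (MvPolynomial.restrictTotalDegree (Fin n) ℝ m).subtype
  let Φ := (ContinuousMap.toLp 2 volA ℝ).toLinearMap ∘ₗ polyRestrict A ∘ₗ inclusion
  have hΦ : ∀ q, ‖Φ q‖ ^ 2 = ∫ x in A, polyFun (q : Poly n) x ^ 2 := fun q =>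
    norm_toLp_polyRestrict_sq q.1
  have hinj : Function.Injective Φ := (injective_iff_map_eq_zero Φ).2 fun q hq => Subtype.ext <|
    eq_zero_of_setIntegral_polyFun_sq_eq_zero hA hne (by rw [← hΦ, hq]; simp)
  obtain ⟨C, hC, hbound⟩ :=
    exists_norm_le_mul_norm_of_injective Φ hinj (polyRestrict B ∘ₗ inclusion)
  refine ⟨C ^ 2, by positivity, fun q hq x hx => ?_⟩
  let q' : MvPolynomial.restrictTotalDegree (Fin n) ℝ m :=
    ⟨q, (MvPolynomial.mem_restrictTotalDegree _ _ _).2 hq⟩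
  have hx_le : |polyFun q x| ≤ C * ‖Φ q'‖ :=
    (ContinuousMap.norm_coe_le_norm (polyRestrict B q) ⟨x, hx⟩).trans (hbound q')
  calc polyFun q x ^ 2 = |polyFun q x| ^ 2 := (sq_abs _).symm
    _ ≤ (C * ‖Φ q'‖) ^ 2 := by gcongr
    _ = C ^ 2 * ∫ z in A, polyFun q z ^ 2 := by rw [mul_pow, hΦ]

lemma setIntegral_closedBall_comp_add_smul (f : Pt n → ℝ) (y : Pt n) {r : ℝ} (hr : 0 < r) :
    ∫ z in Metric.closedBall (0 : Pt n) 1, f (y + r • z)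
      = (r ^ n)⁻¹ * ∫ z in Metric.closedBall y r, f z := by
  rw [Measure.setIntegral_comp_smul_of_pos volume (fun z => f (y + z)) _ hr,
    smul_closedBall _ _ zero_le_one, smul_zero, Real.norm_eq_abs, abs_of_pos hr, mul_one,
    finrank_euclideanSpace_fin, smul_eq_mul,
    ← (measurePreserving_add_left volume y).setIntegral_preimage_emb
      (Homeomorph.addLeft y).measurableEmbedding f (Metric.closedBall y r)]
  simp

/-- By affine scaling, the constant of the unit ball serves for all balls. -/
lemma exists_inverse_inequality (n m : ℕ) (ρ : ℝ) :
    ∃ C > 0, ∀ q : Poly n, q.totalDegree ≤ m → ∀ (y : Pt n) (r : ℝ), 0 < r →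
      ∀ x ∈ Metric.closedBall y (ρ * r),
        polyFun q x ^ 2 ≤ C * ((r ^ n)⁻¹ * ∫ z in Metric.closedBall y r, polyFun q z ^ 2) := by
  have hne : (interior (Metric.closedBall (0 : Pt n) 1)).Nonempty :=
    ⟨0, Metric.ball_subset_interior_closedBall (Metric.mem_ball_self one_pos)⟩
  obtain ⟨C, hC, hunit⟩ := exists_polyFun_sq_le_mul_setIntegral (isCompact_closedBall _ _) hne
    (isCompact_closedBall 0 ρ) m
  refine ⟨C, hC, fun q hq y r hr x hx => ?_⟩
  let A : Pt n →ᵃ[ℝ] Pt n := AffineMap.const ℝ (Pt n) y + r • AffineMap.id ℝ (Pt n)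
  have hA : ∀ z, A z = y + r • z := fun z => by simp [A]
  obtain ⟨q', hq', hqA⟩ := exists_polyFun_eq_comp_affineMap q A
  have hscaled := hunit q' (hq'.trans hq) (r⁻¹ • (x - y)) (by
    rw [mem_closedBall_zero_iff, norm_smul, Real.norm_eq_abs, abs_of_pos (inv_pos.2 hr),
      inv_mul_le_iff₀ hr, ← dist_eq_norm, mul_comm]
    exact hx)
  simpa only [hqA, hA, smul_inv_smul₀ hr.ne', add_sub_cancel,
    setIntegral_closedBall_comp_add_smul (fun z => polyFun q z ^ 2) y hr] using hscaled

end InverseInequality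

end HDG

/-! ### Piecewise affine functions -/

namespace HDG

variable {d : ℕ} {Ω : Set (Pt d)}

/-- The affine function on the simplex `hull s` with prescribed values at the vertices. -/
noncomputable def affineInterp (s : Finset (Pt d)) (g : Pt d → ℝ) : Pt d →ᵃ[ℝ] ℝ :=
  ∑ v ∈ s, g v • bary s v

lemma affineInterp_apply (s : Finset (Pt d)) (g : Pt d → ℝ) (x : Pt d) :
    affineInterp s g x = ∑ v ∈ s, g v * bary s v x :=
  map_sum (AddMonoidHom.mk' (fun f : Pt d →ᵃ[ℝ] ℝ => f x) fun _ _ => rfl)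
    (fun v => g v • bary s v) s

namespace SimplicialMesh

variable (T : SimplicialMesh Ω) {s t : Finset (Pt d)} {w : Pt d → ℝ} {x : Pt d}

lemma isBounded (T : SimplicialMesh Ω) : Bornology.IsBounded Ω := by
  have hcompact : IsCompact (closure Ω) := by
    rw [← T.cover]
    exact T.cells.isCompact_biUnion fun _ _ => isCompact_hull
  exact hcompact.isBounded.subset subset_closure

lemma affineInterp_eq_sum_inter (g : Pt d → ℝ) (hs : s ∈ T.cells) (ht : t ∈ T.cells)
    (hxs : x ∈ hull s) (hxt : x ∈ hull t) :
    affineInterp s g x = ∑ v ∈ s with v ∈ t, g v * bary s v x := by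
  rw [affineInterp_apply]
  refine (Finset.sum_subset (Finset.filter_subset _ _) fun v hv hvt => ?_).symm
  have hzero : bary s v x = 0 := by
    by_contra hne
    exact hvt (Finset.mem_filter.2 ⟨hv, T.mem_of_bary_ne_zero hs ht hxs hxt hv hne⟩)
  rw [hzero, mul_zero]

lemma affineInterp_eq_affineInterp (g : Pt d → ℝ) (hs : s ∈ T.cells) (ht : t ∈ T.cells)
    (hxs : x ∈ hull s) (hxt : x ∈ hull t) : affineInterp s g x = affineInterp t g x := by
  rw [T.affineInterp_eq_sum_inter g hs ht hxs hxt, T.affineInterp_eq_sum_inter g ht hs hxt hxs]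
  refine Finset.sum_congr (by ext v; simp [and_comm]) fun v hv => ?_
  obtain ⟨hvt, hvs⟩ := Finset.mem_filter.1 hv
  rw [T.bary_eq_bary hs ht hxs hxt hvs hvt]

open Classical in
/-- The piecewise affine function with prescribed values at the vertices of the mesh, extended by
zero to all of `ℝ^d`. -/
noncomputable def interp (g : Pt d → ℝ) (x : Pt d) : ℝ :=
  if h : ∃ s ∈ T.cells, x ∈ hull s then affineInterp h.choose g x else 0

lemma interp_eqOn (g : Pt d → ℝ) (hs : s ∈ T.cells) :
    EqOn (T.interp g) (affineInterp s g) (hull s) := by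
  intro x hxs
  have h : ∃ s ∈ T.cells, x ∈ hull s := ⟨s, hs, hxs⟩
  rw [interp, dif_pos h]
  exact T.affineInterp_eq_affineInterp g h.choose_spec.1 hs h.choose_spec.2 hxs

lemma interp_eq_zero (hΩ : IsOpen Ω) (hreg : interior (closure Ω) = Ω) {g : Pt d → ℝ}
    (hg : ∀ v ∈ frontier Ω, g v = 0) (hx : x ∉ Ω) : T.interp g x = 0 := by
  by_cases h : ∃ s ∈ T.cells, x ∈ hull s
  · obtain ⟨s, hs, hxs⟩ := h
    have hxf : x ∈ frontier Ω := by
      rw [hΩ.frontier_eq]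
      exact ⟨T.hull_subset hs hxs, hx⟩
    rw [T.interp_eqOn g hs hxs, affineInterp_apply]
    refine Finset.sum_eq_zero fun v hv => ?_
    rcases ((T.isSimplex hs).mem_hull.1 hxs v hv).eq_or_lt with hzero | hpos
    · rw [← hzero, mul_zero]
    · rw [hg v (T.vertex_mem_frontier hΩ hreg hs hxf hxs hv hpos), zero_mul]
  · rw [interp, dif_neg h]

/-- The functions that vanish outside of the domain and are affine on every closed cell. These are
the elements of `T.conforming`, in a representation for which continuity is automatic. -/
structure IsConformingAffine (w : Pt d → ℝ) : Prop where
  eq_zero : ∀ x ∉ Ω, w x = 0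
  affine : ∀ s ∈ T.cells, ∃ f : Pt d →ᵃ[ℝ] ℝ, EqOn w f (hull s)

variable {T}

lemma isConformingAffine_interp (hΩ : IsOpen Ω) (hreg : interior (closure Ω) = Ω) {g : Pt d → ℝ}
    (hg : ∀ v ∈ frontier Ω, g v = 0) : T.IsConformingAffine (T.interp g) where
  eq_zero _ hx := T.interp_eq_zero hΩ hreg hg hx
  affine s hs := ⟨affineInterp s g, T.interp_eqOn g hs⟩

lemma lipschitzWith_of_lipschitzOnWith_hull (hΩ : IsOpen Ω) {K : NNReal}
    (hwΩ : ∀ x ∉ Ω, w x = 0) (hw : ∀ s ∈ T.cells, LipschitzOnWith K w (hull s)) :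
    LipschitzWith K w := by
  refine lipschitzWith_of_finite_closed_cover (ι := Option T.cells)
    (C := fun i => i.elim Ωᶜ fun s => hull s.1) ?_ ?_ ?_
  · rintro (_ | s)
    · exact hΩ.isClosed_compl
    · exact isClosed_hull
  · refine eq_univ_of_forall fun x => ?_
    by_cases hx : x ∈ Ω
    · obtain ⟨s, hs, hxs⟩ := T.exists_mem_hull (subset_closure hx)
      exact mem_iUnion.2 ⟨some ⟨s, hs⟩, hxs⟩
    · exact mem_iUnion.2 ⟨none, hx⟩
  · rintro (_ | s)
    · refine LipschitzOnWith.of_dist_le_mul fun x hx y hy => ?_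
      rw [hwΩ x hx, hwΩ y hy, dist_self]
      positivity
    · exact hw s.1 s.2

lemma eq_zero_of_const_on_cells (hd : 1 ≤ d) (hΩ : IsOpen Ω) (hwΩ : ∀ x ∉ Ω, w x = 0)
    (hw : ∀ s ∈ T.cells, ∀ x ∈ hull s, ∀ y ∈ hull s, w x = w y) : w = 0 := by
  have hlip : LipschitzWith 0 w := lipschitzWith_of_lipschitzOnWith_hull (T := T) hΩ hwΩ fun s hs =>
    LipschitzOnWith.of_dist_le_mul fun x hx y hy => by rw [hw s hs x hx y hy]; simp
  have hnonempty : Nonempty (Fin d) := ⟨⟨0, hd⟩⟩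
  obtain ⟨y, hy⟩ : ∃ y, y ∉ Ω := by
    by_contra! huniv
    exact NormedSpace.unbounded_univ ℝ (Pt d) (T.isBounded.subset fun x _ => huniv x)
  funext x
  simpa [hwΩ y hy] using hlip.dist_le_mul x y

namespace IsConformingAffine

lemma exists_lipschitzWith (hw : T.IsConformingAffine w) (hΩ : IsOpen Ω) :
    ∃ K, LipschitzWith K w := by
  choose! f hf using hw.affine
  choose K hK using fun s => (f s).lipschitzWith_of_finiteDimensional
  refine ⟨∑ s ∈ T.cells, K s,
    lipschitzWith_of_lipschitzOnWith_hull (T := T) hΩ hw.eq_zero fun s hs => ?_⟩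
  have hlip : LipschitzOnWith (K s) w (hull s) :=
    LipschitzOnWith.of_dist_le_mul fun x hx y hy => by
      rw [hf s hs hx, hf s hs hy]
      exact (hK s).dist_le_mul x y
  exact hlip.weaken (Finset.single_le_sum (fun _ _ => zero_le) hs)

lemma mem_conforming (hw : T.IsConformingAffine w) (hΩ : IsOpen Ω) : w ∈ T.conforming := by
  obtain ⟨K, hK⟩ := hw.exists_lipschitzWith hΩ
  refine ⟨memH10_of_lipschitzWith T.isBounded hK hw.eq_zero (T.ae_eventuallyEq_affineMap hw.affine),
    fun s hs => ?_⟩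
  obtain ⟨f, hf⟩ := hw.affine s hs
  obtain ⟨q, hq, hqf⟩ := exists_polyFun_eq_affineMap f
  exact ⟨q, hq, fun x hx => by rw [hf hx, hqf]⟩

end IsConformingAffine

variable (T) in
lemma facet_mem_faces (hs : s ∈ T.cells) {v : Pt d} (hv : v ∈ s) : facet s v ∈ T.faces :=
  ⟨s, hs, v, hv, rfl⟩

lemma trace_apply (hs : s ∈ T.cells) {v : Pt d} (hv : v ∈ s) (hx : x ∈ facet s v) :
    T.trace w (facet s v) x = w x := by
  rw [trace, indicator_of_mem (T.facet_mem_faces hs hv), indicator_of_mem hx]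

namespace IsConformingAffine

lemma trace_mem_skeletal (hw : T.IsConformingAffine w) (hΩ : IsOpen Ω) {p : ℕ} (hp : 1 ≤ p) :
    T.trace w ∈ T.skeletal p := by
  refine ⟨fun F hF => ?_, fun F hF hFΩ => ?_, fun F hF => ?_⟩
  · obtain ⟨s, hs, v, hv, rfl⟩ := hF
    obtain ⟨f, hf⟩ := hw.affine s hs
    obtain ⟨q, hq, hqf⟩ := exists_polyFun_eq_affineMap f
    refine ⟨q, hq.trans hp, ?_⟩
    rw [trace, indicator_of_mem (T.facet_mem_faces hs hv)]
    exact indicator_congr fun x hx => by rw [hf (facet_subset_hull hx), hqf]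
  · rw [trace, indicator_of_mem hF, indicator_eq_zero']
    refine disjoint_left.2 fun x hx hxF => hx (hw.eq_zero x ?_)
    exact (hΩ.frontier_eq ▸ hFΩ hxF).2
  · rw [trace, indicator_of_notMem hF]

end IsConformingAffine

lemma Refines.exists_hull_subset {Tf Tc : SimplicialMesh Ω} (h : Tf.Refines Tc)
    (ht : t ∈ Tf.cells) : ∃ s ∈ Tc.cells, hull t ⊆ hull s := by
  obtain ⟨y, hy⟩ := (Tf.isSimplex ht).interior_nonempty
  obtain ⟨s, hs, hys⟩ := Tc.exists_mem_hull (Tf.hull_subset ht (interior_subset hy))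
  obtain ⟨A, hA, hsA⟩ := h s hs
  obtain ⟨t', ht', hyt'⟩ := mem_iUnion₂.1 (hsA ▸ hys)
  obtain rfl := Tf.eq_of_mem_interior ht (hA ht') hy hyt'
  exact ⟨s, hs, hsA ▸ subset_biUnion_of_mem (u := fun t => hull t) ht'⟩

lemma IsConformingAffine.of_refines {Tf Tc : SimplicialMesh Ω} (h : Tf.Refines Tc)
    (hw : Tc.IsConformingAffine w) : Tf.IsConformingAffine w where
  eq_zero := hw.eq_zero
  affine _ ht := by
    obtain ⟨s, hs, hts⟩ := h.exists_hull_subset ht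
    obtain ⟨f, hf⟩ := hw.affine s hs
    exact ⟨f, hf.mono hts⟩

end SimplicialMesh

end HDG

/-! ### Facets and surface measure -/

namespace HDG

variable {d : ℕ} {s : Finset (Pt d)} {v x y : Pt d} {r h : ℝ}

/-- An isometric parametrization, by `ℝ^(d-1)`, of the hyperplane that contains a facet. It turns
surface integrals over the facet into Lebesgue integrals. -/
structure IsFacetChart (s : Finset (Pt d)) (v : Pt d) (J : Pt (d - 1) →ᵃ[ℝ] Pt d) : Prop where
  isometry : Isometry J
  range_eq : range J = {x | bary s v x = 0}

lemma IsSimplex.bary_linear_ne_zero (hs : IsSimplex s) (hd : 1 ≤ d) (hv : v ∈ s) :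
    (bary s v).linear ≠ 0 := by
  intro hzero
  obtain ⟨w, hw, hwv⟩ : ∃ w ∈ s, w ≠ v := Finset.exists_mem_ne (by have := hs.card_eq; lia) v
  have hdiff := (bary s v).linearMap_vsub v w
  rw [hzero, hs.bary_self hv, hs.bary_ne hv hw hwv.symm] at hdiff
  exact zero_ne_one (hdiff.trans (sub_zero _))

lemma IsSimplex.exists_isFacetChart (hs : IsSimplex s) (hd : 1 ≤ d) (hv : v ∈ s)
    (hy : bary s v y = 0) : ∃ J, IsFacetChart s v J ∧ J 0 = y := by
  let N := (bary s v).linear.ker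
  have hrank : Module.finrank ℝ N = d - 1 := by
    have hsum := (bary s v).linear.finrank_range_add_finrank_ker
    rw [LinearMap.range_eq_top.2 (LinearMap.surjective (hs.bary_linear_ne_zero hd hv)),
      finrank_top, Module.finrank_self, finrank_euclideanSpace_fin] at hsum
    exact Nat.eq_sub_of_add_eq' hsum
  let b := (stdOrthonormalBasis ℝ N).reindex (finCongr hrank)
  let L : Pt (d - 1) →ₗᵢ[ℝ] Pt d := N.subtypeₗᵢ.comp b.repr.symm.toLinearIsometry
  let J : Pt (d - 1) →ᵃ[ℝ] Pt d := AffineMap.const ℝ (Pt (d - 1)) y + L.toLinearMap.toAffineMap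
  have hJ : ∀ z, J z = y + L z := fun _ => rfl
  have hbary : ∀ x, bary s v x = (bary s v).linear (x - y) := fun x => by
    simpa [hy] using ((bary s v).linearMap_vsub x y).symm
  refine ⟨J, ⟨(isometry_add_left y).comp L.isometry, Subset.antisymm ?_ fun x hx => ?_⟩, ?_⟩
  · rintro _ ⟨z, rfl⟩
    rw [mem_ofPred_eq, hbary, hJ, add_sub_cancel_left]
    exact (b.repr.symm z).2
  · have hker : x - y ∈ N := by rwa [LinearMap.mem_ker, ← hbary]
    exact ⟨b.repr ⟨x - y, hker⟩, by simp [hJ, L]⟩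
  · rw [hJ, map_zero, add_zero]

lemma facetInt_congr {f g : Pt d → ℝ} (hfg : EqOn f g (facet s v)) :
    facetInt (facet s v) f = facetInt (facet s v) g :=
  setIntegral_congr_fun isCompact_facet.measurableSet hfg

lemma cellInt_congr {f g : Pt d → ℝ} (hfg : EqOn f g (hull s)) : cellInt s f = cellInt s g :=
  setIntegral_congr_fun isCompact_hull.measurableSet hfg

lemma facetInt_nonneg {F : Set (Pt d)} {f : Pt d → ℝ} (hf : ∀ x, 0 ≤ f x) : 0 ≤ facetInt F f :=
  integral_nonneg hf

lemma cellInt_nonneg {f : Pt d → ℝ} (hf : ∀ x, 0 ≤ f x) : 0 ≤ cellInt s f :=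
  integral_nonneg hf

lemma cellInt_one : cellInt s (fun _ => 1) = volume.real (hull s) := by
  simp [cellInt]

lemma integrableOn_hull {f : Pt d → ℝ} (hf : Continuous f) : IntegrableOn f (hull s) :=
  hf.continuousOn.integrableOn_compact isCompact_hull

lemma cellInt_mono {f g : Pt d → ℝ} (hf : Continuous f) (hg : Continuous g)
    (hfg : ∀ x ∈ hull s, f x ≤ g x) : cellInt s f ≤ cellInt s g :=
  setIntegral_mono_on (integrableOn_hull hf) (integrableOn_hull hg) isCompact_hull.measurableSet hfg

lemma restrict_euclideanHausdorffMeasure {J : Pt (d - 1) → Pt d} (hJ : Isometry J)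
    {F : Set (Pt d)} (hF : F ⊆ range J) :
    (Measure.euclideanHausdorffMeasure (d - 1) : Measure (Pt d)).restrict F
      = (Measure.map J volume).restrict F := by
  rw [← EuclideanSpace.euclideanHausdorffMeasure_eq_volume, hJ.map_euclideanHausdorffMeasure,
    Measure.restrict_restrict_of_subset hF]

namespace IsFacetChart

variable {J : Pt (d - 1) →ᵃ[ℝ] Pt d}

lemma facet_subset_range (hJ : IsFacetChart s v J) (hs : IsSimplex s) (hv : v ∈ s) :
    facet s v ⊆ range J := by
  rw [hJ.range_eq]
  exact fun x hx => ((hs.mem_facet hv).1 hx).2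

lemma isCompact_preimage_facet (hJ : IsFacetChart s v J) : IsCompact (J ⁻¹' facet s v) :=
  hJ.isometry.isClosedEmbedding.isCompact_preimage isCompact_facet

lemma facetInt_eq (hJ : IsFacetChart s v J) (hs : IsSimplex s) (hv : v ∈ s) (f : Pt d → ℝ) :
    facetInt (facet s v) f = ∫ z in J ⁻¹' facet s v, f (J z) := by
  rw [facetInt, restrict_euclideanHausdorffMeasure hJ.isometry (hJ.facet_subset_range hs hv)]
  exact hJ.isometry.isClosedEmbedding.measurableEmbedding.setIntegral_map f (facet s v)

lemma facetInt_one (hJ : IsFacetChart s v J) (hs : IsSimplex s) (hv : v ∈ s) :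
    facetInt (facet s v) (fun _ => 1) = volume.real (J ⁻¹' facet s v) := by
  simp [hJ.facetInt_eq hs hv]

end IsFacetChart

lemma hull_subset_closedBall (hdiam : Metric.diam (hull s) ≤ h) (hx : x ∈ hull s) :
    hull s ⊆ Metric.closedBall x h := fun _ hy =>
  (Metric.dist_le_diam_of_mem isCompact_hull.isBounded hy hx).trans hdiam

lemma IsFacetChart.preimage_subset_closedBall {J : Pt (d - 1) →ᵃ[ℝ] Pt d}
    (hJ : IsFacetChart s v J) (hJ0 : J 0 ∈ facet s v) (hdiam : Metric.diam (hull s) ≤ h) :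
    J ⁻¹' facet s v ⊆ Metric.closedBall 0 h := fun z hz => by
  rw [Metric.mem_closedBall, ← hJ.isometry.dist_eq]
  exact hull_subset_closedBall hdiam (facet_subset_hull hJ0) (facet_subset_hull hz)

namespace IsSimplex

lemma facet_nonempty (hs : IsSimplex s) (hd : 1 ≤ d) : (facet s v).Nonempty := by
  obtain ⟨w, hw, hwv⟩ : ∃ w ∈ s, w ≠ v := Finset.exists_mem_ne (by have := hs.card_eq; lia) v
  exact ⟨w, subset_convexHull ℝ _ ⟨hw, hwv⟩⟩

lemma bary_lt_one_of_mem_interior (hs : IsSimplex s) (hd : 1 ≤ d) (hv : v ∈ s)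
    (hx : x ∈ interior (hull s)) : bary s v x < 1 := by
  have hpos := hs.mem_interior_hull.1 hx
  obtain ⟨w, hw, hwv⟩ : ∃ w ∈ s, w ≠ v := Finset.exists_mem_ne (by have := hs.card_eq; lia) v
  calc bary s v x < ∑ u ∈ s, bary s u x :=
        Finset.single_lt_sum hwv hv hw (hpos w hw) fun u hu _ => (hpos u hu).le
    _ = 1 := hs.sum_bary x

/-- The ball is projected onto the facet from the opposite vertex, which does not shrink it. -/
lemma exists_ball_subset_facet (hs : IsSimplex s) (hd : 1 ≤ d) (hv : v ∈ s) (hr : 0 < r)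
    (hx : Metric.closedBall x r ⊆ hull s) :
    ∃ y ∈ facet s v, ∀ z, bary s v z = 0 → dist z y ≤ r → z ∈ facet s v := by
  have hxint : x ∈ interior (hull s) :=
    interior_mono hx (Metric.ball_subset_interior_closedBall (Metric.mem_ball_self hr))
  have hpos : 0 < bary s v x := hs.mem_interior_hull.1 hxint v hv
  have hlt : 0 < 1 - bary s v x := sub_pos.2 (hs.bary_lt_one_of_mem_interior hd hv hxint)
  set θ := 1 - bary s v x
  set y : Pt d := AffineMap.lineMap v x θ⁻¹ with hy
  have hxy : AffineMap.lineMap v y θ = x := by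
    simp only [hy, AffineMap.lineMap_apply_module]
    match_scalars <;> field_simp
    ring
  have hbary_y : bary s v y = 0 := by
    rw [hy, bary_lineMap, hs.bary_self hv, show bary s v x = 1 - θ by simp [θ]]
    field_simp
    ring
  have hball : ∀ z, bary s v z = 0 → dist z y ≤ r → z ∈ facet s v := by
    intro z hz hzr
    refine (hs.mem_facet hv).2 ⟨hs.mem_hull.2 fun w hw => ?_, hz⟩
    rcases eq_or_ne w v with rfl | hwv
    · exact hz.ge
    have hmem : AffineMap.lineMap v z θ ∈ hull s := by
      have hle : θ ≤ 1 := sub_le_self _ hpos.le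
      refine hx ?_
      calc dist (AffineMap.lineMap v z θ) x
          = dist (AffineMap.lineMap v z θ) (AffineMap.lineMap v y θ) := by rw [hxy]
        _ = θ * dist z y := by
            simp only [AffineMap.lineMap_apply_module, dist_add_left, dist_smul₀,
              Real.norm_of_nonneg hlt.le]
        _ ≤ r := (mul_le_of_le_one_left dist_nonneg hle).trans hzr
    have hnonneg := hs.mem_hull.1 hmem w hw
    rw [bary_lineMap, hs.bary_ne hw hv hwv, mul_zero, zero_add] at hnonneg
    exact nonneg_of_mul_nonneg_right hnonneg hlt
  exact ⟨y, hball y hbary_y (by simpa using hr.le), hball⟩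

lemma exists_isFacetChart_closedBall_subset (hs : IsSimplex s) (hd : 1 ≤ d) (hv : v ∈ s)
    (hr : 0 < r) (hx : Metric.closedBall x r ⊆ hull s) :
    ∃ J, IsFacetChart s v J ∧ J 0 ∈ facet s v ∧ Metric.closedBall 0 r ⊆ J ⁻¹' facet s v := by
  obtain ⟨y, hy, hball⟩ := hs.exists_ball_subset_facet hd hv hr hx
  obtain ⟨J, hJ, rfl⟩ := hs.exists_isFacetChart hd hv ((hs.mem_facet hv).1 hy).2
  refine ⟨J, hJ, hy, fun z hz => hball _ ?_ (by rwa [hJ.isometry.dist_eq])⟩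
  have hmem : J z ∈ {x | bary s v x = 0} := hJ.range_eq ▸ mem_range_self z
  exact hmem

lemma integrableOn_facet (hs : IsSimplex s) (hd : 1 ≤ d) (hv : v ∈ s) {f : Pt d → ℝ}
    (hf : ContinuousOn f (facet s v)) :
    IntegrableOn f (facet s v) (Measure.euclideanHausdorffMeasure (d - 1)) := by
  obtain ⟨y, hy⟩ := hs.facet_nonempty (v := v) hd
  obtain ⟨J, hJ, -⟩ := hs.exists_isFacetChart hd hv ((hs.mem_facet hv).1 hy).2
  rw [IntegrableOn, restrict_euclideanHausdorffMeasure hJ.isometry (hJ.facet_subset_range hs hv),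
    ← IntegrableOn, hJ.isometry.isClosedEmbedding.measurableEmbedding.integrableOn_map_iff]
  exact (hf.comp hJ.isometry.continuous.continuousOn (mapsTo_preimage _ _)).integrableOn_compact
    hJ.isCompact_preimage_facet

lemma facetInt_mono (hs : IsSimplex s) (hd : 1 ≤ d) (hv : v ∈ s) {f g : Pt d → ℝ}
    (hf : ContinuousOn f (facet s v)) (hg : ContinuousOn g (facet s v))
    (hfg : ∀ x ∈ facet s v, f x ≤ g x) :
    facetInt (facet s v) f ≤ facetInt (facet s v) g :=
  setIntegral_mono_on (hs.integrableOn_facet hd hv hf) (hs.integrableOn_facet hd hv hg)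
    isCompact_facet.measurableSet hfg

end IsSimplex

/-- The volume of the unit ball of `ℝ^n`. -/
noncomputable def ballVol (n : ℕ) : ℝ := (volume : Measure (Pt n)).real (Metric.closedBall 0 1)

lemma ballVol_pos (n : ℕ) : 0 < ballVol n :=
  ENNReal.toReal_pos (Metric.measure_closedBall_pos _ _ one_pos).ne' measure_closedBall_lt_top.ne

lemma volume_real_closedBall {n : ℕ} (x : Pt n) (hr : 0 ≤ r) :
    (volume : Measure (Pt n)).real (Metric.closedBall x r) = r ^ n * ballVol n := by
  rw [Measure.addHaar_real_closedBall' _ x hr, finrank_euclideanSpace_fin, ballVol]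

lemma le_volume_hull (hr : 0 ≤ r) (hx : Metric.closedBall x r ⊆ hull s) :
    r ^ d * ballVol d ≤ volume.real (hull s) := by
  rw [← volume_real_closedBall x hr]
  exact measureReal_mono hx isCompact_hull.measure_lt_top.ne

lemma volume_hull_le (hh : 0 ≤ h) (hx : hull s ⊆ Metric.closedBall x h) :
    volume.real (hull s) ≤ h ^ d * ballVol d := by
  rw [← volume_real_closedBall x hh]
  exact measureReal_mono hx measure_closedBall_lt_top.ne

namespace IsSimplex

lemma facetInt_one_le (hs : IsSimplex s) (hd : 1 ≤ d) (hv : v ∈ s) (hh : 0 ≤ h)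
    (hdiam : Metric.diam (hull s) ≤ h) :
    facetInt (facet s v) (fun _ => 1) ≤ h ^ (d - 1) * ballVol (d - 1) := by
  obtain ⟨y, hy⟩ := hs.facet_nonempty (v := v) hd
  obtain ⟨J, hJ, rfl⟩ := hs.exists_isFacetChart hd hv ((hs.mem_facet hv).1 hy).2
  rw [hJ.facetInt_one hs hv, ← volume_real_closedBall 0 hh]
  exact measureReal_mono (hJ.preimage_subset_closedBall hy hdiam) measure_closedBall_lt_top.ne

lemma facetInt_one_pos (hs : IsSimplex s) (hd : 1 ≤ d) (hv : v ∈ s) (hr : 0 < r)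
    (hx : Metric.closedBall x r ⊆ hull s) : 0 < facetInt (facet s v) (fun _ => 1) := by
  obtain ⟨J, hJ, -, hball⟩ := hs.exists_isFacetChart_closedBall_subset hd hv hr hx
  have hpos : 0 < r ^ (d - 1) * ballVol (d - 1) := mul_pos (pow_pos hr _) (ballVol_pos _)
  rw [hJ.facetInt_one hs hv]
  rw [← volume_real_closedBall 0 hr.le] at hpos
  exact hpos.trans_le (measureReal_mono hball hJ.isCompact_preimage_facet.measure_lt_top.ne)

end IsSimplex

lemma exists_inverse_inequality_cell (d m : ℕ) (ρ : ℝ) :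
    ∃ C > 0, ∀ q : Poly d, q.totalDegree ≤ m → ∀ (s : Finset (Pt d)) (x : Pt d) (r : ℝ),
      0 < r → Metric.closedBall x r ⊆ hull s → Metric.diam (hull s) ≤ ρ * r →
      ∀ y ∈ hull s, polyFun q y ^ 2 ≤ C * ((r ^ d)⁻¹ * cellInt s fun z => polyFun q z ^ 2) := by
  obtain ⟨C, hC, hball⟩ := exists_inverse_inequality d m ρ
  refine ⟨C, hC, fun q hq s x r hr hx hdiam y hy => ?_⟩
  have hxs : x ∈ hull s := hx (Metric.mem_closedBall_self hr.le)
  refine (hball q hq x r hr y (hull_subset_closedBall hdiam hxs hy)).trans ?_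
  gcongr
  exact setIntegral_mono_set (integrableOn_hull (by fun_prop))
    (Eventually.of_forall fun _ => sq_nonneg _) (Eventually.of_forall hx)

lemma exists_inverse_inequality_facet (d m : ℕ) (hd : 1 ≤ d) (ρ : ℝ) :
    ∃ C > 0, ∀ q : Poly d, q.totalDegree ≤ m → ∀ s : Finset (Pt d), IsSimplex s → ∀ v ∈ s,
      ∀ (x : Pt d) (r : ℝ),
      0 < r → Metric.closedBall x r ⊆ hull s → Metric.diam (hull s) ≤ ρ * r →
      ∀ y ∈ facet s v, polyFun q y ^ 2
        ≤ C * ((r ^ (d - 1))⁻¹ * facetInt (facet s v) fun z => polyFun q z ^ 2) := by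
  obtain ⟨C, hC, hball⟩ := exists_inverse_inequality (d - 1) m ρ
  refine ⟨C, hC, fun q hq s hs v hv x r hr hx hdiam y hy => ?_⟩
  obtain ⟨J, hJ, hJ0, hsub⟩ := hs.exists_isFacetChart_closedBall_subset hd hv hr hx
  obtain ⟨q', hq', hqJ⟩ := exists_polyFun_eq_comp_affineMap q J
  obtain ⟨z, rfl⟩ := hJ.facet_subset_range hs hv hy
  have hintegrable : IntegrableOn (fun z => polyFun q' z ^ 2) (J ⁻¹' facet s v) :=
    (Continuous.continuousOn (by fun_prop)).integrableOn_compact hJ.isCompact_preimage_facet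
  rw [hJ.facetInt_eq hs hv]
  simp only [← hqJ]
  refine (hball q' (hq'.trans hq) 0 r hr z (hJ.preimage_subset_closedBall hJ0 hdiam hy)).trans ?_
  gcongr
  exact Eventually.of_forall fun _ => sq_nonneg _

end HDG

/-! ### The condensed bilinear form -/

namespace HDG

variable {d : ℕ} {Ω : Set (Pt d)} {s : Finset (Pt d)} {v : Pt d}

lemma cellInt_eq_mul_add {f g F : Pt d → ℝ} {c : ℝ} (hf : Continuous f) (hg : Continuous g)
    (hF : ∀ x ∈ hull s, F x = c * f x + g x) : cellInt s F = c * cellInt s f + cellInt s g := by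
  rw [cellInt_congr hF, cellInt, integral_add ((integrableOn_hull hf).const_mul c)
    (integrableOn_hull hg), integral_const_mul]
  rfl

lemma IsSimplex.sum_facetInt_eq_mul_add (hs : IsSimplex s) (hd : 1 ≤ d)
    {f g F : Pt d → Pt d → ℝ} {c : ℝ} (hf : ∀ v ∈ s, ContinuousOn (f v) (facet s v))
    (hg : ∀ v ∈ s, ContinuousOn (g v) (facet s v))
    (hF : ∀ v ∈ s, ∀ x ∈ facet s v, F v x = c * f v x + g v x) :
    ∑ v ∈ s, facetInt (facet s v) (F v)
      = c * ∑ v ∈ s, facetInt (facet s v) (f v) + ∑ v ∈ s, facetInt (facet s v) (g v) := by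
  rw [Finset.mul_sum, ← Finset.sum_add_distrib]
  refine Finset.sum_congr rfl fun v hv => ?_
  rw [facetInt_congr (hF v hv), facetInt,
    integral_add ((hs.integrableOn_facet hd hv (hf v hv)).const_mul c)
      (hs.integrableOn_facet hd hv (hg v hv)), integral_const_mul]
  rfl

namespace SimplicialMesh

variable (T : SimplicialMesh Ω) {p : ℕ} {μ : Set (Pt d) → Pt d → ℝ}

lemma exists_eqOn_polyFun (hμ : μ ∈ T.skeletal p) (hs : s ∈ T.cells) (hv : v ∈ s) :
    ∃ q : Poly d, q.totalDegree ≤ p ∧ EqOn (μ (facet s v)) (polyFun q) (facet s v) := by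
  obtain ⟨q, hq, hμq⟩ := hμ.1 _ (T.facet_mem_faces hs hv)
  exact ⟨q, hq, fun x hx => by rw [hμq, indicator_of_mem hx]⟩

lemma continuousOn_facet (hμ : μ ∈ T.skeletal p) (hs : s ∈ T.cells) (hv : v ∈ s) :
    ContinuousOn (μ (facet s v)) (facet s v) := by
  obtain ⟨q, -, hq⟩ := T.exists_eqOn_polyFun hμ hs hv
  exact (continuous_polyFun q).continuousOn.congr hq

lemma finite_faces : T.faces.Finite := by
  have hfaces : T.faces = ⋃ s ∈ T.cells, (facet s) '' (s : Set (Pt d)) := by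
    ext F
    simp only [faces, mem_ofPred_eq, mem_iUnion, mem_image, exists_prop, Finset.mem_coe, eq_comm]
  rw [hfaces]
  exact T.cells.finite_toSet.biUnion fun s _ => s.finite_toSet.image _

instance finiteDimensional_skeletal : FiniteDimensional ℝ (T.skeletal p) := by
  classical
  have : Finite T.faces := T.finite_faces
  let extend : (T.faces → MvPolynomial.restrictTotalDegree (Fin d) ℝ p) →ₗ[ℝ]
      (Set (Pt d) → Pt d → ℝ) :=
    { toFun := fun c F => if h : F ∈ T.faces then F.indicator (polyFun (c ⟨F, h⟩ : Poly d)) else 0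
      map_add' := fun a b => by
        funext F x
        by_cases h : F ∈ T.faces <;> by_cases hx : x ∈ F <;> simp [h, hx, polyFun]
      map_smul' := fun c a => by
        funext F x
        by_cases h : F ∈ T.faces <;> by_cases hx : x ∈ F <;> simp [h, hx, polyFun] }
  have hle : T.skeletal p ≤ extend.range := by
    rintro μ ⟨hpoly, -, hzero⟩
    choose! q hq hμq using hpoly
    refine ⟨fun F => ⟨q F, (MvPolynomial.mem_restrictTotalDegree _ _ _).2 (hq F F.2)⟩, ?_⟩
    funext F
    by_cases h : F ∈ T.faces
    · simp [extend, h, hμq F h]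
    · simp [extend, h, hzero F h]
  exact Submodule.finiteDimensional_of_le hle

end SimplicialMesh

lemma SimplicialMesh.sum_facetInt_smul_add_mul (T : SimplicialMesh Ω) {μ ν : Set (Pt d) → Pt d → ℝ}
    {p : ℕ} (hd : 1 ≤ d) (hμ : μ ∈ T.skeletal p) (hν : ν ∈ T.skeletal p) (hs : s ∈ T.cells)
    (c : ℝ) {g : Pt d → Pt d → ℝ} (hg : ∀ v, Continuous (g v)) :
    ∑ v ∈ s, facetInt (facet s v) (fun x => (c • μ + ν) (facet s v) x * g v x)
      = c * ∑ v ∈ s, facetInt (facet s v) (fun x => μ (facet s v) x * g v x)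
        + ∑ v ∈ s, facetInt (facet s v) (fun x => ν (facet s v) x * g v x) :=
  (T.isSimplex hs).sum_facetInt_eq_mul_add hd
    (fun v hv => (T.continuousOn_facet hμ hs hv).mul (hg v).continuousOn)
    (fun v hv => (T.continuousOn_facet hν hs hv).mul (hg v).continuousOn)
    fun v _ x _ => by simp only [Pi.add_apply, Pi.smul_apply, smul_eq_mul]; ring

namespace Method

variable {k p : ℕ} {T : SimplicialMesh Ω} {S : Method k T} {μ ν η : Set (Pt d) → Pt d → ℝ}
  {a b : Poly d × (Fin d → Poly d)} {c : ℝ}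

lemma IsLocalSolution.smul_add (hd : 1 ≤ d) (hμ : μ ∈ T.skeletal p) (hν : ν ∈ T.skeletal p)
    (hs : s ∈ T.cells) (ha : S.IsLocalSolution μ s a) (hb : S.IsLocalSolution ν s b) (c : ℝ) :
    S.IsLocalSolution (c • μ + ν) s (c • a + b) := by
  obtain ⟨haV, haW, haq, hau⟩ := ha
  obtain ⟨hbV, hbW, hbq, hbu⟩ := hb
  have hpoly : ∀ q r : Poly d, ∀ x, polyFun (c • q + r) x = c * polyFun q x + polyFun r x :=
    fun q r x => by rw [polyFun_add, polyFun_smul]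
  have hvec : ∀ g : Fin d → Pt d → ℝ, ∀ x, ∑ i, polyFun ((c • a + b).2 i) x * g i x
      = c * ∑ i, polyFun (a.2 i) x * g i x + ∑ i, polyFun (b.2 i) x * g i x := fun g x => by
    simp only [Prod.snd_add, Prod.smul_snd, Pi.add_apply, Pi.smul_apply, hpoly, add_mul, mul_assoc,
      Finset.sum_add_distrib, Finset.mul_sum]
  have hscal : ∀ g : Pt d → ℝ, ∀ x, polyFun (c • a + b).1 x * g x
      = c * (polyFun a.1 x * g x) + polyFun b.1 x * g x := fun g x => by
    rw [Prod.fst_add, Prod.smul_fst, hpoly]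
    ring
  refine ⟨add_mem (Submodule.smul_mem _ _ haV) hbV, add_mem (Submodule.smul_mem _ _ haW) hbW,
    fun w hw => ?_, fun z hz => ?_⟩
  · rw [T.sum_facetInt_smul_add_mul hd hμ hν hs c
        (g := fun v x => ∑ i, polyFun (w i) x * outwardNormal s v i) (fun v => by fun_prop),
      cellInt_eq_mul_add (by fun_prop) (by fun_prop) fun x _ => hvec (fun i => polyFun (w i)) x,
      cellInt_eq_mul_add (by fun_prop) (by fun_prop)
        fun x _ => hscal (fun x => ∑ i, polyFun (MvPolynomial.pderiv i (w i)) x) x]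
    linear_combination c * haq w hw + hbq w hw
  · rw [T.sum_facetInt_smul_add_mul hd hμ hν hs c (g := fun _ => polyFun z) (fun _ => by fun_prop),
      cellInt_eq_mul_add (by fun_prop) (by fun_prop)
        fun x _ => hvec (fun i => polyFun (MvPolynomial.pderiv i z)) x,
      (T.isSimplex hs).sum_facetInt_eq_mul_add hd
        (f := fun v x =>
          ((∑ i, polyFun (a.2 i) x * outwardNormal s v i) + S.τ * polyFun a.1 x) * polyFun z x)
        (g := fun v x =>
          ((∑ i, polyFun (b.2 i) x * outwardNormal s v i) + S.τ * polyFun b.1 x) * polyFun z x)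
        (fun v _ => by fun_prop) (fun v _ => by fun_prop)
        fun v _ x _ => by
          have hnormal := hvec (fun i _ => outwardNormal s v i) x
          rw [hnormal, Prod.fst_add, Prod.smul_fst, hpoly]
          ring]
    linear_combination c * hau z hz + hbu z hz

lemma exists_eqOn_polyFun_sub (hμ : μ ∈ T.skeletal p) (hs : s ∈ T.cells) (hv : v ∈ s)
    {q : Poly d} (hq : q.totalDegree ≤ k) : ∃ r : Poly d, r.totalDegree ≤ max k p ∧
      EqOn (fun x => polyFun q x - μ (facet s v) x) (polyFun r) (facet s v) := by
  obtain ⟨q', hq', hμq⟩ := T.exists_eqOn_polyFun hμ hs hv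
  refine ⟨q - q', (MvPolynomial.totalDegree_sub _ _).trans (max_le_max hq hq'), fun x hx => ?_⟩
  simp only [hμq hx, polyFun_sub]

lemma energyForm_comm (μ ν : Set (Pt d) → Pt d → ℝ) : S.energyForm μ ν = S.energyForm ν μ := by
  rw [energyForm, energyForm]
  simp only [mul_comm, mul_left_comm, mul_assoc]

lemma energyForm_self_nonneg (μ : Set (Pt d) → Pt d → ℝ) : 0 ≤ S.energyForm μ μ := by
  refine add_nonneg (Finset.sum_nonneg fun s _ => cellInt_nonneg fun x =>
    Finset.sum_nonneg fun i _ => mul_self_nonneg _)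
    (Finset.sum_nonneg fun s _ => Finset.sum_nonneg fun v _ => facetInt_nonneg fun x => ?_)
  rw [mul_assoc]
  exact mul_nonneg S.τ_nonneg (mul_self_nonneg _)

namespace WellPosed

lemma isLocalSolution (hS : S.WellPosed p) (hμ : μ ∈ T.skeletal p) (hs : s ∈ T.cells) :
    S.IsLocalSolution μ s (S.U μ s, S.Q μ s) :=
  Classical.epsilon_spec (hS μ hμ s hs).exists

lemma totalDegree_U_le (hS : S.WellPosed p) (hμ : μ ∈ T.skeletal p) (hs : s ∈ T.cells) :
    (S.U μ s).totalDegree ≤ k :=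
  S.V_degree s hs _ (hS.isLocalSolution hμ hs).1

lemma U_Q_smul_add (hS : S.WellPosed p) (hd : 1 ≤ d) (hμ : μ ∈ T.skeletal p)
    (hν : ν ∈ T.skeletal p) (hs : s ∈ T.cells) (c : ℝ) :
    S.U (c • μ + ν) s = c • S.U μ s + S.U ν s ∧ S.Q (c • μ + ν) s = c • S.Q μ s + S.Q ν s := by
  have hmem : c • μ + ν ∈ T.skeletal p := add_mem (Submodule.smul_mem _ _ hμ) hν
  have heq := (hS _ hmem s hs).unique (hS.isLocalSolution hmem hs)
    ((hS.isLocalSolution hμ hs).smul_add hd hμ hν hs (hS.isLocalSolution hν hs) c)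
  exact ⟨congrArg Prod.fst heq, congrArg Prod.snd heq⟩

lemma energyForm_smul_add (hS : S.WellPosed p) (hd : 1 ≤ d) (hμ : μ ∈ T.skeletal p)
    (hν : ν ∈ T.skeletal p) (hη : η ∈ T.skeletal p) (c : ℝ) :
    S.energyForm (c • μ + ν) η = c * S.energyForm μ η + S.energyForm ν η := by
  have hcell : ∀ s ∈ T.cells,
      cellInt s (fun x => ∑ i, polyFun (S.Q (c • μ + ν) s i) x * polyFun (S.Q η s i) x)
        = c * cellInt s (fun x => ∑ i, polyFun (S.Q μ s i) x * polyFun (S.Q η s i) x)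
          + cellInt s (fun x => ∑ i, polyFun (S.Q ν s i) x * polyFun (S.Q η s i) x) := fun s hs =>
    cellInt_eq_mul_add (by fun_prop) (by fun_prop) fun x _ => by
      simp only [(hS.U_Q_smul_add hd hμ hν hs c).2, Pi.add_apply, Pi.smul_apply, polyFun_add,
        polyFun_smul, add_mul, mul_assoc, Finset.sum_add_distrib, Finset.mul_sum]
  have hfacet : ∀ s ∈ T.cells,
      ∑ v ∈ s, facetInt (facet s v) (fun x =>
          S.τ * (polyFun (S.U (c • μ + ν) s) x - (c • μ + ν) (facet s v) x)
            * (polyFun (S.U η s) x - η (facet s v) x))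
        = c * ∑ v ∈ s, facetInt (facet s v) (fun x =>
            S.τ * (polyFun (S.U μ s) x - μ (facet s v) x)
              * (polyFun (S.U η s) x - η (facet s v) x))
          + ∑ v ∈ s, facetInt (facet s v) (fun x =>
            S.τ * (polyFun (S.U ν s) x - ν (facet s v) x)
              * (polyFun (S.U η s) x - η (facet s v) x)) := by
    intro s hs
    have hcont : ∀ {ξ}, ξ ∈ T.skeletal p → ∀ v ∈ s,
        ContinuousOn (fun x => polyFun (S.U ξ s) x - ξ (facet s v) x) (facet s v) := fun hξ v hv =>
      (continuous_polyFun _).continuousOn.sub (T.continuousOn_facet hξ hs hv)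
    exact (T.isSimplex hs).sum_facetInt_eq_mul_add hd
      (fun v hv => (continuousOn_const.mul (hcont hμ v hv)).mul (hcont hη v hv))
      (fun v hv => (continuousOn_const.mul (hcont hν v hv)).mul (hcont hη v hv))
      fun v _ x _ => by
        simp only [(hS.U_Q_smul_add hd hμ hν hs c).1, Pi.add_apply, Pi.smul_apply, smul_eq_mul,
          polyFun_add, polyFun_smul]
        ring
  rw [energyForm, energyForm, energyForm, Finset.sum_congr rfl hcell, Finset.sum_congr rfl hfacet]
  simp only [Finset.sum_add_distrib, Finset.mul_sum, mul_add]
  ring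

lemma energyForm_add (hS : S.WellPosed p) (hd : 1 ≤ d) (hμ : μ ∈ T.skeletal p)
    (hν : ν ∈ T.skeletal p) (hη : η ∈ T.skeletal p) :
    S.energyForm (μ + ν) η = S.energyForm μ η + S.energyForm ν η := by
  simpa using hS.energyForm_smul_add hd hμ hν hη 1

lemma energyForm_smul (hS : S.WellPosed p) (hd : 1 ≤ d) (hμ : μ ∈ T.skeletal p)
    (hη : η ∈ T.skeletal p) (c : ℝ) : S.energyForm (c • μ) η = c * S.energyForm μ η := by
  have hzero : S.energyForm 0 η = 0 := by
    simpa using hS.energyForm_smul_add hd (zero_mem _) (zero_mem _) hη 1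
  simpa [hzero] using hS.energyForm_smul_add hd hμ (zero_mem _) hη c

/-- The condensed bilinear form on the skeletal space, as a bundled bilinear form. -/
noncomputable def form (hS : S.WellPosed p) (hd : 1 ≤ d) : LinearMap.BilinForm ℝ (T.skeletal p) :=
  LinearMap.mk₂ ℝ (fun μ ν => S.energyForm μ.1 ν.1)
    (fun μ ν η => hS.energyForm_add hd μ.2 ν.2 η.2)
    (fun c μ η => hS.energyForm_smul hd μ.2 η.2 c)
    (fun η μ ν => by
      simp only [energyForm_comm η.1]
      exact hS.energyForm_add hd μ.2 ν.2 η.2)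
    (fun c η μ => by
      simp only [energyForm_comm η.1]
      exact hS.energyForm_smul hd μ.2 η.2 c)

lemma form_apply (hS : S.WellPosed p) (hd : 1 ≤ d) (μ ν : T.skeletal p) :
    hS.form hd μ ν = S.energyForm μ.1 ν.1 := rfl

end WellPosed

end Method

section BilinForm

variable {V W : Type*} [AddCommGroup V] [Module ℝ V] [AddCommGroup W] [Module ℝ W]
  {a : LinearMap.BilinForm ℝ V} {b : LinearMap.BilinForm ℝ W} {I : V →ₗ[ℝ] W} {C : ℝ} {μ : W}
  {ν : V}

lemma abs_apply_le_sqrt_mul_sqrt (hb : ∀ x, 0 ≤ b x x) (hsymm : LinearMap.IsSymm b) (x y : W) :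
    |b x y| ≤ √(b x x) * √(b y y) := by
  rw [← Real.sqrt_mul (hb x), ← Real.sqrt_sq_eq_abs]
  exact Real.sqrt_le_sqrt (LinearMap.BilinForm.apply_sq_le_of_symm b hb hsymm x y)

lemma sqrt_apply_sub_le (hb : ∀ x, 0 ≤ b x x) (hsymm : LinearMap.IsSymm b) (x y : W) :
    √(b (x - y) (x - y)) ≤ √(b x x) + √(b y y) := by
  refine Real.sqrt_le_iff.2 ⟨by positivity, ?_⟩
  have hcross := (abs_le.1 (abs_apply_le_sqrt_mul_sqrt hb hsymm x y)).1
  have hyx : b y x = b x y := (hsymm.eq x y).symm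
  simp only [map_sub, LinearMap.sub_apply, hyx]
  nlinarith [Real.sq_sqrt (hb x), Real.sq_sqrt (hb y)]

lemma existsUnique_forall_apply_eq [FiniteDimensional ℝ V] (ha : ∀ x, a x x = 0 → x = 0)
    (f : V →ₗ[ℝ] ℝ) : ∃! ν, ∀ η, a ν η = f η := by
  have hinj : Function.Injective a :=
    (injective_iff_map_eq_zero a).2 fun x hx => ha x (by rw [hx, LinearMap.zero_apply])
  have hsurj : Function.Surjective a :=
    (LinearMap.injective_iff_surjective_of_finrank_eq_finrank (by simp)).1 hinj
  obtain ⟨ν, rfl⟩ := hsurj f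
  exact ⟨ν, fun _ => rfl, fun ν' hν' => hinj (LinearMap.ext hν')⟩

lemma sqrt_apply_ritz_le (ha : ∀ x, 0 ≤ a x x) (hb : ∀ x, 0 ≤ b x x) (hsymm : LinearMap.IsSymm b)
    (hC : 0 ≤ C) (hI : ∀ x, √(b (I x) (I x)) ≤ C * √(a x x)) (hν : ∀ η, a ν η = b μ (I η)) :
    √(a ν ν) ≤ C * √(b μ μ) := by
  rcases (Real.sqrt_nonneg (a ν ν)).eq_or_lt with h0 | hpos
  · rw [← h0]
    positivity
  refine le_of_mul_le_mul_right ?_ hpos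
  calc √(a ν ν) * √(a ν ν) = b μ (I ν) := by rw [Real.mul_self_sqrt (ha ν), hν ν]
    _ ≤ √(b μ μ) * √(b (I ν) (I ν)) :=
        (le_abs_self _).trans (abs_apply_le_sqrt_mul_sqrt hb hsymm _ _)
    _ ≤ √(b μ μ) * (C * √(a ν ν)) := by gcongr; exact hI ν
    _ = C * √(b μ μ) * √(a ν ν) := by ring

lemma sqrt_apply_sub_ritz_le (ha : ∀ x, 0 ≤ a x x) (hb : ∀ x, 0 ≤ b x x)
    (hsymm : LinearMap.IsSymm b) (hC : 0 ≤ C) (hI : ∀ x, √(b (I x) (I x)) ≤ C * √(a x x))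
    (hν : ∀ η, a ν η = b μ (I η)) :
    √(b (μ - I ν) (μ - I ν)) ≤ (1 + C ^ 2) * √(b μ μ) :=
  calc √(b (μ - I ν) (μ - I ν)) ≤ √(b μ μ) + √(b (I ν) (I ν)) := sqrt_apply_sub_le hb hsymm _ _
    _ ≤ √(b μ μ) + C * √(a ν ν) := by gcongr; exact hI ν
    _ ≤ √(b μ μ) + C * (C * √(b μ μ)) := by
        gcongr
        exact sqrt_apply_ritz_le ha hb hsymm hC hI hν
    _ = (1 + C ^ 2) * √(b μ μ) := by ring

end BilinForm

end HDG

/-! ### Quasi-interpolation -/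

namespace HDG

section PolynomialDerivatives

variable {n : ℕ}

lemma totalDegree_pderiv_le (i : Fin n) (q : Poly n) :
    (MvPolynomial.pderiv i q).totalDegree ≤ q.totalDegree := by
  conv_lhs => rw [q.as_sum, map_sum]
  refine MvPolynomial.totalDegree_finsetSum_le fun e he => ?_
  rw [MvPolynomial.pderiv_monomial]
  refine (MvPolynomial.totalDegree_monomial_le _ _).trans
    (le_trans ?_ (MvPolynomial.le_totalDegree he))
  rw [Finsupp.sum_fintype _ _ fun _ => rfl, Finsupp.sum_fintype _ _ fun _ => rfl]
  exact Finset.sum_le_sum fun j _ => tsub_le_self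

lemma polyFun_pderiv_mul_X (q : Poly n) (i j : Fin n) (y : Pt n) :
    polyFun (MvPolynomial.pderiv i (q * MvPolynomial.X j)) y
      = polyFun (MvPolynomial.pderiv i q) y * y j + if i = j then polyFun q y else 0 := by
  rw [MvPolynomial.pderiv_mul]
  obtain rfl | hij := eq_or_ne i j
  · simp [polyFun]
  · simp [polyFun, hij, MvPolynomial.pderiv_X_of_ne hij.symm]

lemma hasDerivAt_polyFun_line (q : Poly n) (x v : Pt n) (t : ℝ) :
    HasDerivAt (fun t : ℝ => polyFun q (x + t • v))
      (∑ i, v i * polyFun (MvPolynomial.pderiv i q) (x + t • v)) t := by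
  induction q using MvPolynomial.induction_on with
  | C a => simpa [polyFun] using hasDerivAt_const t a
  | add q r hq hr =>
    simp only [polyFun_add, map_add, mul_add, Finset.sum_add_distrib]
    exact hq.add hr
  | mul_X q j hq =>
    have hcoord : HasDerivAt (fun t : ℝ => x j + t * v j) (v j) t := by
      simpa using ((hasDerivAt_id t).mul_const (v j)).const_add (x j)
    have hfun : (fun t : ℝ => polyFun (q * MvPolynomial.X j) (x + t • v))
        = fun t => polyFun q (x + t • v) * (x j + t * v j) := by
      funext t
      simp [polyFun]
    rw [hfun]
    refine (hq.mul hcoord).congr_deriv ?_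
    simp only [polyFun_pderiv_mul_X, mul_add, Finset.sum_add_distrib, mul_ite, mul_zero,
      Finset.sum_ite_eq', Finset.mem_univ, if_true, PiLp.add_apply, PiLp.smul_apply, smul_eq_mul,
      Finset.sum_mul, mul_assoc, mul_comm (v j)]

lemma abs_polyFun_sub_le (q : Poly n) {s : Set (Pt n)} (hs : Convex ℝ s) {M : ℝ} (hM : 0 ≤ M)
    (h : ∀ x ∈ s, ∑ i, polyFun (MvPolynomial.pderiv i q) x ^ 2 ≤ M ^ 2) {x y : Pt n}
    (hx : x ∈ s) (hy : y ∈ s) : |polyFun q y - polyFun q x| ≤ M * dist y x := by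
  have hbound : ∀ t ∈ Ico (0 : ℝ) 1,
      ‖∑ i, (y - x) i * polyFun (MvPolynomial.pderiv i q) (x + t • (y - x))‖ ≤ M * dist y x := by
    intro t ht
    have hmem : x + t • (y - x) ∈ s := hs.add_smul_sub_mem hx hy ⟨ht.1, ht.2.le⟩
    rw [Real.norm_eq_abs]
    refine abs_le_of_sq_le_sq ((Finset.sum_mul_sq_le_sq_mul_sq _ _ _).trans ?_)
      (mul_nonneg hM dist_nonneg)
    rw [← EuclideanSpace.real_norm_sq_eq, ← dist_eq_norm, mul_pow, mul_comm]
    gcongr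
    exact h _ hmem
  simpa using norm_image_sub_le_of_norm_deriv_le_segment_01'
    (f := fun t : ℝ => polyFun q (x + t • (y - x)))
    (fun t _ => (hasDerivAt_polyFun_line q x (y - x) t).hasDerivWithinAt) hbound

end PolynomialDerivatives

lemma abs_sub_le_of_reachable {V : Type*} [Fintype V] {G : SimpleGraph V} {a E : V → ℝ}
    (hE : ∀ x, 0 ≤ E x) (hadj : ∀ u v, G.Adj u v → |a u - a v| ≤ E u + E v) {u v : V}
    (h : G.Reachable u v) : |a u - a v| ≤ 2 * ∑ x, E x := by
  classical
  have hwalk : ∀ {u v : V} (p : G.Walk u v),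
      |a u - a v| ≤ 2 * (p.support.map E).sum - E u - E v := by
    intro u v p
    induction p with
    | @nil x =>
      rw [sub_self, abs_zero, SimpleGraph.Walk.support_nil, List.map_singleton, List.sum_singleton]
      linarith
    | @cons x y z hxy p ih =>
      simp only [SimpleGraph.Walk.support_cons, List.map_cons, List.sum_cons]
      linarith [hadj x y hxy, abs_sub_le (a x) (a y) (a z)]
  obtain ⟨p, hp⟩ := h.exists_isPath
  have hsum : (p.support.map E).sum ≤ ∑ x, E x := by
    rw [← List.sum_toFinset E hp.support_nodup]
    exact Finset.sum_le_sum_of_subset_of_nonneg (Finset.subset_univ _) fun x _ _ => hE x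
  linarith [hwalk p, hE u, hE v]

variable {d : ℕ} {Ω : Set (Pt d)}

namespace SimplicialMesh

variable (T : SimplicialMesh Ω) {s t : Finset (Pt d)} {x : Pt d}

open Classical in
/-- The cells with vertex `x`. -/
noncomputable def star (x : Pt d) : Finset (Finset (Pt d)) := T.cells.filter (x ∈ ·)

open Classical in
/-- The cells that share a vertex with the cell `s`. -/
noncomputable def neighbours (s : Finset (Pt d)) : Finset (Finset (Pt d)) :=
  T.cells.filter fun t => (s ∩ t).Nonempty

/-- The graph on the cells with vertex `x` in which two cells are adjacent if they share a facet
that contains `x`. -/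
def starGraph (x : Pt d) : SimpleGraph (T.star x) :=
  SimpleGraph.fromRel fun s t => ∃ v ∈ s.1, v ≠ x ∧ AdjacentAcross s.1 v t.1

lemma mem_star : s ∈ T.star x ↔ s ∈ T.cells ∧ x ∈ s := by
  simp [star]

lemma mem_neighbours : t ∈ T.neighbours s ↔ t ∈ T.cells ∧ ∃ x ∈ s, x ∈ t := by
  simp [neighbours, Finset.Nonempty]

lemma self_mem_neighbours (hs : s ∈ T.cells) : s ∈ T.neighbours s := by
  obtain ⟨x, hx⟩ := (T.isSimplex hs).nonempty
  exact T.mem_neighbours.2 ⟨hs, x, hx, hx⟩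

lemma star_subset_neighbours (hx : x ∈ s) : T.star x ⊆ T.neighbours s := fun _ ht =>
  T.mem_neighbours.2 ⟨(T.mem_star.1 ht).1, x, hx, (T.mem_star.1 ht).2⟩

lemma reachable_starGraph_or_exists_facet_subset_frontier (hΩ : IsOpen Ω) (s : T.star x) :
    (x ∈ interior (closure Ω) ∧ ∀ t, (T.starGraph x).Reachable s t) ∨
      ∃ t, (T.starGraph x).Reachable s t ∧ ∃ v ∈ t.1, v ≠ x ∧ facet t.1 v ⊆ frontier Ω := by
  classical
  rw [or_iff_not_imp_right]
  intro hfrontier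
  have hmem {t : Finset (Pt d)} : t ∈ {t : T.star x | (T.starGraph x).Reachable s t}.toFinset.image
      Subtype.val ↔ ∃ ht : t ∈ T.star x, (T.starGraph x).Reachable s ⟨t, ht⟩ := by
    simp
  have hA : T.IsClosedStar x
      ({t : T.star x | (T.starGraph x).Reachable s t}.toFinset.image Subtype.val) :=
    { mem_cells := fun t ht => (T.mem_star.1 (hmem.1 ht).1).1
      vertex_mem := fun t ht => (T.mem_star.1 (hmem.1 ht).1).2
      adjacent_mem := fun t ht v hv hvx t' ht' hadj => by
        obtain ⟨htx, hreach⟩ := hmem.1 ht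
        have hxt' : x ∈ t' := hadj.sdiff_subset ⟨(T.mem_star.1 htx).2, hvx.symm⟩
        refine hmem.2 ⟨T.mem_star.2 ⟨ht', hxt'⟩, hreach.trans (SimpleGraph.Adj.reachable ?_)⟩
        rw [starGraph, SimpleGraph.fromRel_adj]
        exact ⟨fun h => hadj.ne (congrArg Subtype.val h).symm, Or.inl ⟨v, hv, hvx, hadj⟩⟩
      not_subset_frontier := fun t ht v hv hvx hF =>
        hfrontier ⟨⟨t, (hmem.1 ht).1⟩, (hmem.1 ht).2, v, hv, hvx, hF⟩ }
  have hne : ({t : T.star x | (T.starGraph x).Reachable s t}.toFinset.image Subtype.val).Nonempty :=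
    ⟨s, hmem.2 ⟨s.2, SimpleGraph.Reachable.refl _⟩⟩
  refine ⟨hA.mem_interior_closure hΩ hne, fun t => ?_⟩
  obtain ⟨ht, hxt⟩ := T.mem_star.1 t.2
  exact (hmem.1 (hA.mem_of_vertex_mem hΩ hne ht hxt)).2

/-- `E s` bounds the oscillation of the cellwise function `u` on the cell `s`, and its distance to
the skeletal function `μ` on the facets of `s`. -/
structure HasOscJumpBound (μ : Set (Pt d) → Pt d → ℝ) (u : Finset (Pt d) → Pt d → ℝ)
    (E : Finset (Pt d) → ℝ) : Prop where
  nonneg : ∀ s, 0 ≤ E s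
  osc : ∀ s ∈ T.cells, ∀ y ∈ hull s, ∀ z ∈ hull s, |u s y - u s z| ≤ E s
  jump : ∀ s ∈ T.cells, ∀ v ∈ s, ∀ y ∈ facet s v, |u s y - μ (facet s v) y| ≤ E s

namespace HasOscJumpBound

variable {T} {p : ℕ} {μ : Set (Pt d) → Pt d → ℝ} {u : Finset (Pt d) → Pt d → ℝ}
  {E : Finset (Pt d) → ℝ}

lemma abs_sub_le_of_adjacentAcross (h : T.HasOscJumpBound μ u E) (hs : s ∈ T.cells)
    (ht : t ∈ T.cells) {v : Pt d} (hv : v ∈ s) (hadj : AdjacentAcross s v t)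
    (hx : x ∈ facet s v) : |u s x - u t x| ≤ E s + E t := by
  obtain ⟨v', hv', -, heq⟩ := hadj.exists_sdiff_eq (T.isSimplex hs) (T.isSimplex ht) hv
  have hfacet : facet t v' = facet s v := by rw [facet, facet, heq]
  have hjs := h.jump s hs v hv x hx
  have hjt := h.jump t ht v' hv' x (hfacet ▸ hx)
  rw [hfacet, abs_sub_comm] at hjt
  linarith [abs_sub_le (u s x) (μ (facet s v) x) (u t x)]

lemma abs_sub_le_of_reachable (h : T.HasOscJumpBound μ u E) {s t : T.star x}
    (hst : (T.starGraph x).Reachable s t) :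
    |u s.1 x - u t.1 x| ≤ 2 * ∑ t ∈ T.star x, E t := by
  rw [← Finset.sum_coe_sort (T.star x) E]
  refine HDG.abs_sub_le_of_reachable (a := fun s : T.star x => u s.1 x)
    (E := fun s : T.star x => E s.1) (fun s => h.nonneg s.1) (fun s t hadj => ?_) hst
  obtain ⟨hs, hxs⟩ := T.mem_star.1 s.2
  obtain ⟨ht, hxt⟩ := T.mem_star.1 t.2
  obtain ⟨-, ⟨v, hv, hvx, hadj⟩ | ⟨v, hv, hvx, hadj⟩⟩ := (SimpleGraph.fromRel_adj _ _ _).1 hadj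
  · exact h.abs_sub_le_of_adjacentAcross hs ht hv hadj (subset_convexHull ℝ _ ⟨hxs, hvx.symm⟩)
  · rw [abs_sub_comm, add_comm]
    exact h.abs_sub_le_of_adjacentAcross ht hs hv hadj (subset_convexHull ℝ _ ⟨hxt, hvx.symm⟩)

lemma abs_le_of_facet_subset_frontier (h : T.HasOscJumpBound μ u E) (hμ : μ ∈ T.skeletal p)
    (hs : s ∈ T.cells) {v : Pt d} (hv : v ∈ s) (hF : facet s v ⊆ frontier Ω)
    (hx : x ∈ facet s v) : |u s x| ≤ E s := by
  simpa [hμ.2.1 _ (T.facet_mem_faces hs hv) hF] using h.jump s hs v hv x hx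

lemma exists_vertex_value (h : T.HasOscJumpBound μ u E) (hμ : μ ∈ T.skeletal p)
    (hΩ : IsOpen Ω) (hreg : interior (closure Ω) = Ω) (x : Pt d) :
    ∃ c : ℝ, (x ∈ frontier Ω → c = 0) ∧ ∀ s ∈ T.star x, |u s x - c| ≤ 3 * ∑ t ∈ T.star x, E t := by
  have hsum : 0 ≤ ∑ t ∈ T.star x, E t := Finset.sum_nonneg fun t _ => h.nonneg t
  by_cases hxf : x ∈ frontier Ω
  · refine ⟨0, fun _ => rfl, fun s hs => ?_⟩
    obtain ⟨hxΩ, -⟩ | ⟨t, hreach, v, hv, hvx, hF⟩ :=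
      T.reachable_starGraph_or_exists_facet_subset_frontier hΩ ⟨s, hs⟩
    · exact absurd (hreg ▸ hxΩ) (hΩ.frontier_eq ▸ hxf).2
    obtain ⟨ht, hxt⟩ := T.mem_star.1 t.2
    have hut := h.abs_le_of_facet_subset_frontier hμ ht hv hF
      (subset_convexHull ℝ _ ⟨hxt, hvx.symm⟩)
    have hEt : E t ≤ ∑ t ∈ T.star x, E t := Finset.single_le_sum (fun t _ => h.nonneg t) t.2
    have hst : |u s x - u t.1 x| ≤ 2 * ∑ t ∈ T.star x, E t := h.abs_sub_le_of_reachable hreach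
    rw [sub_zero]
    linarith [abs_sub_abs_le_abs_sub (u s x) (u t.1 x)]
  · obtain hempty | ⟨s₀, hs₀⟩ := (T.star x).eq_empty_or_nonempty
    · exact ⟨0, fun _ => rfl, by simp [hempty]⟩
    refine ⟨u s₀ x, fun hx => absurd hx hxf, fun s hs => ?_⟩
    obtain ⟨-, hreach⟩ | ⟨t, -, v, -, hvx, hF⟩ :=
      T.reachable_starGraph_or_exists_facet_subset_frontier hΩ ⟨s, hs⟩
    · linarith [h.abs_sub_le_of_reachable (hreach ⟨s₀, hs₀⟩)]
    · exact absurd (hF (subset_convexHull ℝ _ ⟨(T.mem_star.1 t.2).2, hvx.symm⟩)) hxf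

lemma exists_quasi_interpolant (h : T.HasOscJumpBound μ u E) (hμ : μ ∈ T.skeletal p)
    (hΩ : IsOpen Ω) (hreg : interior (closure Ω) = Ω) :
    ∃ w, T.IsConformingAffine w ∧
      ∀ s ∈ T.cells, ∀ y ∈ hull s, |u s y - w y| ≤ 4 * ∑ t ∈ T.neighbours s, E t := by
  choose g hg_zero hg using h.exists_vertex_value hμ hΩ hreg
  refine ⟨T.interp g, T.isConformingAffine_interp hΩ hreg hg_zero, fun s hs y hy => ?_⟩
  have hvertex : ∀ v ∈ s, |u s y - g v| ≤ 4 * ∑ t ∈ T.neighbours s, E t := by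
    intro v hv
    have hstar : ∑ t ∈ T.star v, E t ≤ ∑ t ∈ T.neighbours s, E t :=
      Finset.sum_le_sum_of_subset_of_nonneg (T.star_subset_neighbours hv) fun t _ _ => h.nonneg t
    have hEs : E s ≤ ∑ t ∈ T.neighbours s, E t :=
      Finset.single_le_sum (fun t _ => h.nonneg t) (T.self_mem_neighbours hs)
    linarith [h.osc s hs y hy v (subset_convexHull ℝ _ hv), hg v s (T.mem_star.2 ⟨hs, hv⟩),
      abs_sub_le (u s y) (u s v) (g v)]
  have hbary := (T.isSimplex hs).mem_hull.1 hy
  have hcomb : u s y - T.interp g y = ∑ v ∈ s, bary s v y * (u s y - g v) := by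
    rw [T.interp_eqOn g hs hy, affineInterp_apply]
    simp only [mul_sub, Finset.sum_sub_distrib, ← Finset.sum_mul, (T.isSimplex hs).sum_bary,
      one_mul, mul_comm (g _)]
  calc |u s y - T.interp g y|
      ≤ ∑ v ∈ s, |bary s v y * (u s y - g v)| := hcomb ▸ Finset.abs_sum_le_sum_abs _ _
    _ ≤ ∑ v ∈ s, bary s v y * (4 * ∑ t ∈ T.neighbours s, E t) :=
        Finset.sum_le_sum fun v hv => by
          rw [abs_mul, abs_of_nonneg (hbary v hv)]
          exact mul_le_mul_of_nonneg_left (hvertex v hv) (hbary v hv)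
    _ = 4 * ∑ t ∈ T.neighbours s, E t := by
        rw [← Finset.sum_mul, (T.isSimplex hs).sum_bary, one_mul]

end HasOscJumpBound

end SimplicialMesh

end HDG

/-! ### Quasi-uniform meshes -/

namespace HDG

variable {d : ℕ} {Ω : Set (Pt d)}

namespace SimplicialMesh

variable {T : SimplicialMesh Ω} {s : Finset (Pt d)} {ρ : ℝ}

lemma meshSize_nonneg (T : SimplicialMesh Ω) : 0 ≤ T.meshSize :=
  Real.iSup_nonneg fun _ => Metric.diam_nonneg

lemma diam_le_meshSize (hs : s ∈ T.cells) : Metric.diam (hull s) ≤ T.meshSize :=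
  le_ciSup (f := fun s : {s : Finset (Pt d) // s ∈ T.cells} => Metric.diam (hull s.1))
    (Set.finite_range _).bddAbove ⟨s, hs⟩

/-- Shape regularity and quasi-uniformity combined: every cell contains a ball of radius `h / ρ`,
where the mesh size `h` is positive. As `h` is a common upper bound of the cell diameters, all
scaling arguments can be carried out in terms of `h` alone. -/
structure IsUniform (T : SimplicialMesh Ω) (ρ : ℝ) : Prop where
  meshSize_pos : 0 < T.meshSize
  exists_closedBall_subset : ∀ s ∈ T.cells, ∃ x, Metric.closedBall x (T.meshSize / ρ) ⊆ hull s

lemma ShapeRegular.diam_pos {σ : ℝ} (hT : T.ShapeRegular σ) (hd : 1 ≤ d) (hs : s ∈ T.cells) :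
    0 < Metric.diam (hull s) := by
  obtain ⟨x, r, hr, -, hx⟩ := hT s hs
  have : Nonempty (Fin d) := ⟨⟨0, hd⟩⟩
  have hball := Metric.diam_mono hx isCompact_hull.isBounded
  rw [Metric.diam_closedBall_eq x hr.le] at hball
  linarith

lemma ShapeRegular.isUniform {σ κ : ℝ} (hσ : T.ShapeRegular σ) (hκ : T.QuasiUniform κ)
    (hd : 1 ≤ d) (hΩ : Ω.Nonempty) (hρ : 0 < ρ) (hσκ : κ * σ ≤ ρ) : T.IsUniform ρ := by
  refine ⟨?_, fun s hs => ?_⟩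
  · obtain ⟨y, hy⟩ := hΩ
    obtain ⟨s, hs, -⟩ := T.exists_mem_hull (subset_closure hy)
    exact (hσ.diam_pos hd hs).trans_le (diam_le_meshSize hs)
  · obtain ⟨x, r, hr, hdiam, hx⟩ := hσ s hs
    have hκ_nonneg : 0 ≤ κ := by
      by_contra! hneg
      nlinarith [hσ.diam_pos hd hs, hκ s hs, T.meshSize_nonneg]
    refine ⟨x, (Metric.closedBall_subset_closedBall ?_).trans hx⟩
    rw [div_le_iff₀ hρ]
    calc T.meshSize ≤ κ * (σ * r) := (hκ s hs).trans (by gcongr)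
      _ = κ * σ * r := (mul_assoc _ _ _).symm
      _ ≤ ρ * r := by gcongr
      _ = r * ρ := mul_comm _ _

lemma pairwiseDisjoint_interior (T : SimplicialMesh Ω) :
    (T.cells : Set (Finset (Pt d))).PairwiseDisjoint fun s => interior (hull s) :=
  fun _s hs _t ht hst => Set.disjoint_left.2 fun _x hxs hxt =>
    hst (T.eq_of_mem_interior hs ht hxs (interior_subset hxt))

lemma neighbours_subset_closedBall {t : Finset (Pt d)} {x y : Pt d} (hs : s ∈ T.cells)
    (hx : x ∈ hull s) (ht : t ∈ T.neighbours s) (hy : y ∈ hull t) :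
    y ∈ Metric.closedBall x (2 * T.meshSize) := by
  obtain ⟨htc, z, hzs, hzt⟩ := T.mem_neighbours.1 ht
  have hyz := hull_subset_closedBall (diam_le_meshSize htc) (subset_convexHull ℝ _ hzt) hy
  have hzx := hull_subset_closedBall (diam_le_meshSize hs) hx (subset_convexHull ℝ _ hzs)
  rw [Metric.mem_closedBall] at hyz hzx ⊢
  linarith [dist_triangle y z x]

/-- Disjoint balls of radius `h / (2 * ρ)` inside the neighbours all lie in a ball of radius
`2 * h`. -/
lemma IsUniform.card_neighbours_le (hT : T.IsUniform ρ) (hρ : 0 < ρ) (hs : s ∈ T.cells) :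
    ((T.neighbours s).card : ℝ) ≤ (4 * ρ) ^ d := by
  have hh := hT.meshSize_pos
  set r := T.meshSize / ρ
  have hr : 0 < r := div_pos hh hρ
  have hh_eq : T.meshSize = ρ * r := (mul_div_cancel₀ _ hρ.ne').symm
  choose! c hc using hT.exists_closedBall_subset
  obtain ⟨x, hx⟩ := (T.isSimplex hs).nonempty
  have hmem : ∀ t ∈ T.neighbours s, t ∈ T.cells := fun t ht => (T.mem_neighbours.1 ht).1
  have hball : ∀ t ∈ T.neighbours s, Metric.closedBall (c t) (r / 2) ⊆ interior (hull t) :=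
    fun t ht => (Metric.closedBall_subset_ball (half_lt_self hr)).trans
      (interior_maximal (Metric.ball_subset_closedBall.trans (hc t (hmem t ht))) Metric.isOpen_ball)
  have hdisj : (T.neighbours s : Set (Finset (Pt d))).PairwiseDisjoint
      fun t => Metric.closedBall (c t) (r / 2) := fun a ha b hb hab =>
    (T.pairwiseDisjoint_interior (hmem a ha) (hmem b hb) hab).mono (hball a ha) (hball b hb)
  have hsub : ⋃ t ∈ T.neighbours s, Metric.closedBall (c t) (r / 2)
      ⊆ Metric.closedBall x (2 * T.meshSize) := iUnion₂_subset fun t ht y hy =>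
    neighbours_subset_closedBall hs (subset_convexHull ℝ _ hx) ht (interior_subset (hball t ht hy))
  have hvol : ((T.neighbours s).card : ℝ) * ((r / 2) ^ d * ballVol d)
      ≤ (2 * T.meshSize) ^ d * ballVol d := by
    have hle := measureReal_mono (μ := (volume : Measure (Pt d))) hsub measure_closedBall_lt_top.ne
    rw [measureReal_biUnion_finset hdisj (fun t _ => Metric.isClosed_closedBall.measurableSet)
      (fun t _ => measure_closedBall_lt_top.ne), volume_real_closedBall _ (by positivity)] at hle
    simpa only [volume_real_closedBall _ (half_pos hr).le, Finset.sum_const, nsmul_eq_mul] using hle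
  refine le_of_mul_le_mul_right (hvol.trans_eq ?_)
    (mul_pos (pow_pos (half_pos hr) d) (ballVol_pos d))
  rw [hh_eq, ← mul_assoc ((4 * ρ) ^ d), ← mul_pow]
  ring

lemma sum_sq_sum_neighbours_le {N : ℝ} (hN : ∀ s ∈ T.cells, ((T.neighbours s).card : ℝ) ≤ N)
    (E : Finset (Pt d) → ℝ) :
    ∑ s ∈ T.cells, (∑ t ∈ T.neighbours s, E t) ^ 2 ≤ N ^ 2 * ∑ s ∈ T.cells, E s ^ 2 := by
  have hcomm : ∀ s t, s ∈ T.cells ∧ t ∈ T.neighbours s ↔ s ∈ T.neighbours t ∧ t ∈ T.cells := by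
    simp only [mem_neighbours]
    grind
  calc ∑ s ∈ T.cells, (∑ t ∈ T.neighbours s, E t) ^ 2
      ≤ ∑ s ∈ T.cells, N * ∑ t ∈ T.neighbours s, E t ^ 2 :=
        Finset.sum_le_sum fun s hs => sq_sum_le_card_mul_sum_sq.trans
          (mul_le_mul_of_nonneg_right (hN s hs) (Finset.sum_nonneg fun _ _ => sq_nonneg _))
    _ = ∑ t ∈ T.cells, N * ((T.neighbours t).card * E t ^ 2) := by
        rw [← Finset.mul_sum, Finset.sum_comm' hcomm, Finset.mul_sum]
        simp only [Finset.sum_const, nsmul_eq_mul]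
    _ ≤ ∑ t ∈ T.cells, N * (N * E t ^ 2) := Finset.sum_le_sum fun t ht =>
        mul_le_mul_of_nonneg_left (mul_le_mul_of_nonneg_right (hN t ht) (sq_nonneg _))
          ((Nat.cast_nonneg _).trans (hN t ht))
    _ = N ^ 2 * ∑ s ∈ T.cells, E s ^ 2 := by
        rw [Finset.mul_sum]
        exact Finset.sum_congr rfl fun t _ => by ring

end SimplicialMesh

section Scaling

open SimplicialMesh

variable {s : Finset (Pt d)} {x : Pt d} {h r ρ : ℝ}

lemma cellRatio_nonneg (s : Finset (Pt d)) : 0 ≤ cellRatio s :=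
  div_nonneg (cellInt_nonneg fun _ => zero_le_one)
    (Finset.sum_nonneg fun _ _ => facetInt_nonneg fun _ => zero_le_one)

lemma IsSimplex.sum_facetInt_one_pos (hs : IsSimplex s) (hd : 1 ≤ d) (hr : 0 < r)
    (hx : Metric.closedBall x r ⊆ hull s) : 0 < ∑ v ∈ s, facetInt (facet s v) fun _ => 1 :=
  Finset.sum_pos (fun _ hv => hs.facetInt_one_pos hd hv hr hx) hs.nonempty

lemma IsSimplex.cellRatio_mul_sum_facetInt_one (hs : IsSimplex s) (hd : 1 ≤ d) (hr : 0 < r)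
    (hx : Metric.closedBall x r ⊆ hull s) :
    cellRatio s * ∑ v ∈ s, facetInt (facet s v) (fun _ => 1) = volume.real (hull s) := by
  rw [cellRatio, div_mul_cancel₀ _ (hs.sum_facetInt_one_pos hd hr hx).ne', cellInt_one]

lemma exists_mul_le_cellRatio (d : ℕ) (hd : 1 ≤ d) (hρ : 0 < ρ) : ∃ c : ℝ, 0 < c ∧
    ∀ (s : Finset (Pt d)) (x : Pt d) (h : ℝ), IsSimplex s → 0 < h → Metric.diam (hull s) ≤ h →
      Metric.closedBall x (h / ρ) ⊆ hull s → c * h ≤ cellRatio s := by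
  have hb := ballVol_pos d
  have hb' := ballVol_pos (d - 1)
  refine ⟨ballVol d / ρ ^ d / ((d + 1) * ballVol (d - 1)), by positivity,
    fun s x h hs hh hdiam hx => ?_⟩
  have hr := div_pos hh hρ
  have harea : ∑ v ∈ s, facetInt (facet s v) (fun _ => 1)
      ≤ (d + 1) * (h ^ (d - 1) * ballVol (d - 1)) := by
    refine (Finset.sum_le_sum fun v hv => hs.facetInt_one_le hd hv hh.le hdiam).trans_eq ?_
    rw [Finset.sum_const, hs.card_eq, nsmul_eq_mul, Nat.cast_add_one]
  rw [cellRatio, cellInt_one, le_div_iff₀ (hs.sum_facetInt_one_pos hd hr hx)]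
  calc ballVol d / ρ ^ d / ((d + 1) * ballVol (d - 1)) * h *
        ∑ v ∈ s, facetInt (facet s v) (fun _ => 1)
      ≤ ballVol d / ρ ^ d / ((d + 1) * ballVol (d - 1)) * h *
        ((d + 1) * (h ^ (d - 1) * ballVol (d - 1))) := by gcongr
    _ = ballVol d / ρ ^ d * (h * h ^ (d - 1)) := by field_simp
    _ = (h / ρ) ^ d * ballVol d := by
        rw [mul_pow_sub_one (Nat.one_le_iff_ne_zero.1 hd), div_pow]
        ring
    _ ≤ volume.real (hull s) := le_volume_hull hr.le hx

lemma cellInt_sum {ι : Type*} (A : Finset ι) {f : ι → Pt d → ℝ} (hf : ∀ i, Continuous (f i)) :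
    cellInt s (fun x => ∑ i ∈ A, f i x) = ∑ i ∈ A, cellInt s (f i) :=
  integral_finsetSum _ fun i _ => integrableOn_hull (hf i)

lemma exists_pow_mul_sq_sub_le (d m : ℕ) (hρ : 0 < ρ) : ∃ C : ℝ, 0 < C ∧
    ∀ q : Poly d, q.totalDegree ≤ m → ∀ (s : Finset (Pt d)) (x : Pt d) (h : ℝ), 0 < h →
      Metric.diam (hull s) ≤ h → Metric.closedBall x (h / ρ) ⊆ hull s →
      ∀ y ∈ hull s, ∀ z ∈ hull s, h ^ d * (polyFun q y - polyFun q z) ^ 2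
        ≤ C * (h ^ 2 * cellInt s fun x => ∑ i, polyFun (MvPolynomial.pderiv i q) x ^ 2) := by
  obtain ⟨C, hC, hinv⟩ := exists_inverse_inequality_cell d m ρ
  refine ⟨C * ρ ^ d, by positivity, fun q hq s x h hh hdiam hx y hy z hz => ?_⟩
  set D := cellInt s fun x => ∑ i, polyFun (MvPolynomial.pderiv i q) x ^ 2 with hD
  have hD_nonneg : 0 ≤ D := cellInt_nonneg fun _ => Finset.sum_nonneg fun _ _ => sq_nonneg _
  have hM : 0 ≤ C * (((h / ρ) ^ d)⁻¹ * D) := by positivity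
  have hgrad : ∀ y ∈ hull s, ∑ i, polyFun (MvPolynomial.pderiv i q) y ^ 2
      ≤ √(C * (((h / ρ) ^ d)⁻¹ * D)) ^ 2 := fun y hy => by
    rw [Real.sq_sqrt hM, hD, cellInt_sum _ fun i => by fun_prop, Finset.mul_sum, Finset.mul_sum]
    exact Finset.sum_le_sum fun i _ => hinv _ ((totalDegree_pderiv_le i q).trans hq) s x (h / ρ)
      (div_pos hh hρ) hx (hdiam.trans_eq (mul_div_cancel₀ h hρ.ne').symm) y hy
  have hdist : dist y z ≤ h :=
    (Metric.dist_le_diam_of_mem isCompact_hull.isBounded hy hz).trans hdiam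
  have hyz : (polyFun q y - polyFun q z) ^ 2 ≤ C * (((h / ρ) ^ d)⁻¹ * D) * h ^ 2 := by
    rw [← Real.sq_sqrt hM, ← mul_pow, ← sq_abs]
    exact pow_le_pow_left₀ (abs_nonneg _) ((abs_polyFun_sub_le q convex_hull (Real.sqrt_nonneg _)
      hgrad hz hy).trans (mul_le_mul_of_nonneg_left hdist (Real.sqrt_nonneg _))) 2
  calc h ^ d * (polyFun q y - polyFun q z) ^ 2
      ≤ h ^ d * (C * (((h / ρ) ^ d)⁻¹ * D) * h ^ 2) := by gcongr
    _ = C * ρ ^ d * (h ^ 2 * D) := by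
        rw [div_pow, inv_div]
        field_simp

lemma exists_pow_mul_sq_le_facetInt (d m : ℕ) (hd : 1 ≤ d) (hρ : 0 < ρ) : ∃ C : ℝ, 0 < C ∧
    ∀ q : Poly d, q.totalDegree ≤ m → ∀ (s : Finset (Pt d)) (x : Pt d) (h : ℝ), IsSimplex s →
      0 < h → Metric.diam (hull s) ≤ h → Metric.closedBall x (h / ρ) ⊆ hull s →
      ∀ v ∈ s, ∀ y ∈ facet s v, h ^ d * polyFun q y ^ 2
        ≤ C * (cellRatio s * facetInt (facet s v) fun x => polyFun q x ^ 2) := by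
  obtain ⟨C, hC, hinv⟩ := exists_inverse_inequality_facet d m hd ρ
  obtain ⟨c, hc, hratio⟩ := exists_mul_le_cellRatio d hd hρ
  refine ⟨C * ρ ^ (d - 1) / c, by positivity, fun q hq s x h hs hh hdiam hx v hv y hy => ?_⟩
  set B := facetInt (facet s v) fun x => polyFun q x ^ 2
  have hB : 0 ≤ B := facetInt_nonneg fun _ => sq_nonneg _
  calc h ^ d * polyFun q y ^ 2
      ≤ h ^ d * (C * (((h / ρ) ^ (d - 1))⁻¹ * B)) := by
        gcongr
        exact hinv q hq s hs v hv x (h / ρ) (div_pos hh hρ) hx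
          (hdiam.trans_eq (mul_div_cancel₀ h hρ.ne').symm) y hy
    _ = C * ρ ^ (d - 1) / c * (c * h * B) := by
        rw [← mul_pow_sub_one (Nat.one_le_iff_ne_zero.1 hd) h, div_pow, inv_div]
        field_simp
    _ ≤ C * ρ ^ (d - 1) / c * (cellRatio s * B) := by
        gcongr
        exact hratio s x h hs hh hdiam hx

end Scaling

end HDG

/-! ### Conforming approximation of skeletal functions -/

namespace HDG

variable {d k p : ℕ} {Ω : Set (Pt d)} {T : SimplicialMesh Ω}

namespace SimplicialMesh

lemma bdryNorm_sq (f : Finset (Pt d) → Set (Pt d) → Pt d → ℝ) :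
    T.bdryNorm f ^ 2 = ∑ s ∈ T.cells, cellRatio s *
      ∑ v ∈ s, facetInt (facet s v) fun x => f s (facet s v) x ^ 2 :=
  Real.sq_sqrt (Finset.sum_nonneg fun s _ => mul_nonneg (cellRatio_nonneg s)
    (Finset.sum_nonneg fun _ _ => facetInt_nonneg fun _ => sq_nonneg _))

lemma vecNorm0_sq (q : Finset (Pt d) → Fin d → Poly d) :
    T.vecNorm0 q ^ 2 = ∑ s ∈ T.cells, cellInt s fun x => ∑ i, polyFun (q s i) x ^ 2 :=
  Real.sq_sqrt (Finset.sum_nonneg fun _ _ => cellInt_nonneg fun _ =>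
    Finset.sum_nonneg fun _ _ => sq_nonneg _)

lemma vecNorm0_sq_le_add (q r : Finset (Pt d) → Fin d → Poly d) :
    T.vecNorm0 r ^ 2 ≤ 2 * T.vecNorm0 (fun s i => q s i + r s i) ^ 2 + 2 * T.vecNorm0 q ^ 2 := by
  simp only [vecNorm0_sq, Finset.mul_sum, ← Finset.sum_add_distrib]
  refine Finset.sum_le_sum fun s _ => ?_
  calc cellInt s (fun x => ∑ i, polyFun (r s i) x ^ 2)
      ≤ cellInt s fun x => 2 * ∑ i, polyFun (q s i + r s i) x ^ 2 +
          2 * ∑ i, polyFun (q s i) x ^ 2 := by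
        refine cellInt_mono (by fun_prop) (by fun_prop) fun x _ => ?_
        simp only [Finset.mul_sum, ← Finset.sum_add_distrib, polyFun_add]
        exact Finset.sum_le_sum fun i _ => by
          nlinarith [sq_nonneg (2 * polyFun (q s i) x + polyFun (r s i) x)]
    _ = _ := by
        rw [cellInt_eq_mul_add (c := 2) (f := fun x => ∑ i, polyFun (q s i + r s i) x ^ 2)
          (g := fun x => 2 * ∑ i, polyFun (q s i) x ^ 2) (by fun_prop) (by fun_prop)
          fun x _ => rfl]
        exact congrArg _ (integral_const_mul _ _)

namespace HasOscJumpBound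

variable {μ : Set (Pt d) → Pt d → ℝ} {u : Finset (Pt d) → Pt d → ℝ} {E : Finset (Pt d) → ℝ}

lemma exists_isConformingAffine (h : T.HasOscJumpBound μ u E) (hμ : μ ∈ T.skeletal p)
    (hΩ : IsOpen Ω) (hreg : interior (closure Ω) = Ω) : ∃ w, T.IsConformingAffine w ∧
      T.HasOscJumpBound μ (fun _ => w) fun s => 9 * ∑ t ∈ T.neighbours s, E t := by
  obtain ⟨w, hw, huw⟩ := h.exists_quasi_interpolant hμ hΩ hreg
  have hself : ∀ s ∈ T.cells, E s ≤ ∑ t ∈ T.neighbours s, E t := fun s hs =>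
    Finset.single_le_sum (fun t _ => h.nonneg t) (T.self_mem_neighbours hs)
  refine ⟨w, hw, fun s => mul_nonneg (by norm_num) (Finset.sum_nonneg fun t _ => h.nonneg t),
    fun s hs y hy z hz => ?_, fun s hs v hv y hy => ?_⟩
  · have htri := abs_sub_le (w y) (u s y) (w z)
    rw [abs_sub_comm (w y) (u s y)] at htri
    linarith [abs_sub_le (u s y) (u s z) (w z), h.osc s hs y hy z hz, huw s hs y hy,
      huw s hs z hz, hself s hs]
  · have htri := abs_sub_le (w y) (u s y) (μ (facet s v) y)
    rw [abs_sub_comm (w y) (u s y)] at htri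
    linarith [h.jump s hs v hv y hy, huw s hs y (facet_subset_hull hy), hself s hs, h.nonneg s]

end HasOscJumpBound

end SimplicialMesh

open SimplicialMesh

namespace Method

variable {S : Method k T} {μ : Set (Pt d) → Pt d → ℝ} {K : ℝ}

/-- The local error indicator `h² ‖∇ U μ‖² + |T| / |∂T| ‖U μ - μ‖²` of the cell `s`: it controls
both the oscillation of `U μ` on `s` and its distance from `μ` on the facets of `s`. -/
noncomputable def errorIndicator (S : Method k T) (μ : Set (Pt d) → Pt d → ℝ)
    (s : Finset (Pt d)) : ℝ :=
  T.meshSize ^ 2 * cellInt s (fun x => ∑ i, polyFun (MvPolynomial.pderiv i (S.U μ s)) x ^ 2) +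
    cellRatio s * ∑ v ∈ s, facetInt (facet s v) fun x => (polyFun (S.U μ s) x - μ (facet s v) x) ^ 2

lemma errorIndicator_nonneg (S : Method k T) (μ : Set (Pt d) → Pt d → ℝ) (s : Finset (Pt d)) :
    0 ≤ S.errorIndicator μ s :=
  add_nonneg
    (mul_nonneg (sq_nonneg _) (cellInt_nonneg fun _ => Finset.sum_nonneg fun _ _ => sq_nonneg _))
    (mul_nonneg (cellRatio_nonneg s) (Finset.sum_nonneg fun _ _ => facetInt_nonneg fun _ =>
      sq_nonneg _))

lemma mul_cellInt_le_errorIndicator (S : Method k T) (μ : Set (Pt d) → Pt d → ℝ)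
    (s : Finset (Pt d)) :
    T.meshSize ^ 2 * cellInt s (fun x => ∑ i, polyFun (MvPolynomial.pderiv i (S.U μ s)) x ^ 2)
      ≤ S.errorIndicator μ s :=
  le_add_of_nonneg_right (mul_nonneg (cellRatio_nonneg s)
    (Finset.sum_nonneg fun _ _ => facetInt_nonneg fun _ => sq_nonneg _))

lemma mul_facetInt_le_errorIndicator (S : Method k T) (μ : Set (Pt d) → Pt d → ℝ)
    {s : Finset (Pt d)} {v : Pt d} (hv : v ∈ s) :
    cellRatio s * facetInt (facet s v) (fun x => (polyFun (S.U μ s) x - μ (facet s v) x) ^ 2)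
      ≤ S.errorIndicator μ s :=
  (mul_le_mul_of_nonneg_left (Finset.single_le_sum (f := fun v => facetInt (facet s v) fun x =>
      (polyFun (S.U μ s) x - μ (facet s v) x) ^ 2)
    (fun _ _ => facetInt_nonneg fun _ => sq_nonneg _) hv) (cellRatio_nonneg s)).trans
    (le_add_of_nonneg_left (mul_nonneg (sq_nonneg _) (cellInt_nonneg fun _ =>
      Finset.sum_nonneg fun _ _ => sq_nonneg _)))

lemma LS1.traceError_sq_le (h1 : S.LS1 p K) (hμ : μ ∈ T.skeletal p) :
    S.traceError μ ^ 2 ≤ K ^ 2 * (T.meshSize ^ 2 * T.vecNorm0 (S.Q μ) ^ 2) := by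
  rw [← mul_pow, ← mul_pow]
  exact pow_le_pow_left₀ (Real.sqrt_nonneg _) (h1 μ hμ) 2

lemma vecNorm0_pderiv_U_sq_le (hT : 0 < T.meshSize) (h1 : S.LS1 p K) (h3 : S.LS3 p K)
    (hμ : μ ∈ T.skeletal p) :
    T.vecNorm0 (fun s i => MvPolynomial.pderiv i (S.U μ s)) ^ 2
      ≤ (2 * K ^ 4 + 2) * T.vecNorm0 (S.Q μ) ^ 2 := by
  have hsum : T.vecNorm0 (fun s i => S.Q μ s i + MvPolynomial.pderiv i (S.U μ s)) ^ 2
      ≤ K ^ 4 * T.vecNorm0 (S.Q μ) ^ 2 :=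
    calc T.vecNorm0 (fun s i => S.Q μ s i + MvPolynomial.pderiv i (S.U μ s)) ^ 2
        ≤ (K * (T.meshSize⁻¹ * S.traceError μ)) ^ 2 :=
          pow_le_pow_left₀ (Real.sqrt_nonneg _) (h3 μ hμ) 2
      _ = K ^ 2 * T.meshSize⁻¹ ^ 2 * S.traceError μ ^ 2 := by ring
      _ ≤ K ^ 2 * T.meshSize⁻¹ ^ 2 * (K ^ 2 * (T.meshSize ^ 2 * T.vecNorm0 (S.Q μ) ^ 2)) := by
          gcongr
          exact h1.traceError_sq_le hμ
      _ = K ^ 4 * T.vecNorm0 (S.Q μ) ^ 2 := by field_simp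
  linarith [vecNorm0_sq_le_add (T := T) (S.Q μ) fun s i => MvPolynomial.pderiv i (S.U μ s)]

lemma sum_errorIndicator_le (hT : 0 < T.meshSize) (h1 : S.LS1 p K) (h3 : S.LS3 p K)
    (hμ : μ ∈ T.skeletal p) : ∑ s ∈ T.cells, S.errorIndicator μ s
      ≤ (2 * K ^ 4 + 2 + K ^ 2) * (T.meshSize ^ 2 * T.vecNorm0 (S.Q μ) ^ 2) :=
  calc ∑ s ∈ T.cells, S.errorIndicator μ s
      = T.meshSize ^ 2 * T.vecNorm0 (fun s i => MvPolynomial.pderiv i (S.U μ s)) ^ 2 +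
          S.traceError μ ^ 2 := by
        rw [vecNorm0_sq, traceError, bdryNorm_sq, Finset.mul_sum, ← Finset.sum_add_distrib]
        rfl
    _ ≤ T.meshSize ^ 2 * ((2 * K ^ 4 + 2) * T.vecNorm0 (S.Q μ) ^ 2) +
          K ^ 2 * (T.meshSize ^ 2 * T.vecNorm0 (S.Q μ) ^ 2) := by
        gcongr
        · exact vecNorm0_pderiv_U_sq_le hT h1 h3 hμ
        · exact h1.traceError_sq_le hμ
    _ = (2 * K ^ 4 + 2 + K ^ 2) * (T.meshSize ^ 2 * T.vecNorm0 (S.Q μ) ^ 2) := by ring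

end Method

lemma exists_hasOscJumpBound (d p k : ℕ) (hd : 1 ≤ d) {ρ : ℝ} (hρ : 0 < ρ) : ∃ C : ℝ, 0 < C ∧
    ∀ {Ω : Set (Pt d)} {T : SimplicialMesh Ω}, T.IsUniform ρ → ∀ {S : Method k T}, S.WellPosed p →
      ∀ μ ∈ T.skeletal p, T.HasOscJumpBound μ (fun s => polyFun (S.U μ s))
        fun s => √(C * S.errorIndicator μ s / T.meshSize ^ d) := by
  obtain ⟨C₁, hC₁, hosc⟩ := exists_pow_mul_sq_sub_le d k hρ
  obtain ⟨C₂, -, hjump⟩ := exists_pow_mul_sq_le_facetInt d (max k p) hd hρ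
  refine ⟨max C₁ C₂, lt_max_of_lt_left hC₁, fun {Ω T} hT {S} hS μ hμ =>
    ⟨fun _ => Real.sqrt_nonneg _, fun s hs y hy z hz => ?_, fun s hs v hv y hy => ?_⟩⟩
  all_goals
    obtain ⟨x, hx⟩ := hT.exists_closedBall_subset s hs
    refine Real.abs_le_sqrt ((le_div_iff₀' (pow_pos hT.meshSize_pos d)).2 ?_)
  · exact (hosc _ (hS.totalDegree_U_le hμ hs) s x _ hT.meshSize_pos (diam_le_meshSize hs) hx
      y hy z hz).trans (mul_le_mul (le_max_left _ _) (S.mul_cellInt_le_errorIndicator μ s)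
        (mul_nonneg (sq_nonneg _) (cellInt_nonneg fun _ => Finset.sum_nonneg fun _ _ =>
          sq_nonneg _)) (hC₁.le.trans (le_max_left _ _)))
  · obtain ⟨q, hq, hq_eq⟩ := Method.exists_eqOn_polyFun_sub hμ hs hv (hS.totalDegree_U_le hμ hs)
    have hq_facetInt : facetInt (facet s v) (fun x => polyFun q x ^ 2)
        = facetInt (facet s v) fun x => (polyFun (S.U μ s) x - μ (facet s v) x) ^ 2 :=
      facetInt_congr fun x hx => congrArg (· ^ 2) (hq_eq hx).symm
    have hqy := hjump q hq s x _ (T.isSimplex hs) hT.meshSize_pos (diam_le_meshSize hs) hx v hv y hy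
    rw [hq_facetInt, ← hq_eq hy] at hqy
    exact hqy.trans (mul_le_mul (le_max_right _ _) (S.mul_facetInt_le_errorIndicator μ hv)
      (mul_nonneg (cellRatio_nonneg s) (facetInt_nonneg fun _ => sq_nonneg _))
      (hC₁.le.trans (le_max_left _ _)))

lemma exists_conforming_approximation (d p k : ℕ) (hd : 1 ≤ d) {ρ : ℝ} (hρ : 0 < ρ) (K : ℝ) :
    ∃ C : ℝ, 0 < C ∧ ∀ {Ω : Set (Pt d)}, IsOpen Ω → interior (closure Ω) = Ω →
      ∀ {T : SimplicialMesh Ω}, T.IsUniform ρ →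
      ∀ {S : Method k T}, S.WellPosed p → S.LS1 p K → S.LS3 p K → ∀ μ ∈ T.skeletal p,
      ∃ (w : Pt d → ℝ) (G : Finset (Pt d) → ℝ), T.IsConformingAffine w ∧
        T.HasOscJumpBound μ (fun _ => w) G ∧
        T.meshSize ^ d * ∑ s ∈ T.cells, G s ^ 2
          ≤ C * (T.meshSize ^ 2 * T.vecNorm0 (S.Q μ) ^ 2) := by
  obtain ⟨C, hC, hosc⟩ := exists_hasOscJumpBound d p k hd hρ
  refine ⟨81 * ((4 * ρ) ^ d) ^ 2 * (C * (2 * K ^ 4 + 2 + K ^ 2)), by positivity,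
    fun {Ω} hΩ hreg {T} hT {S} hS h1 h3 μ hμ => ?_⟩
  have hh := pow_pos hT.meshSize_pos d
  set E : Finset (Pt d) → ℝ := fun s => √(C * S.errorIndicator μ s / T.meshSize ^ d) with hE
  obtain ⟨w, hw, hwE⟩ := (hosc hT hS μ hμ).exists_isConformingAffine hμ hΩ hreg
  refine ⟨w, _, hw, hwE, ?_⟩
  have hE_sum : T.meshSize ^ d * ∑ s ∈ T.cells, E s ^ 2
      ≤ C * ((2 * K ^ 4 + 2 + K ^ 2) * (T.meshSize ^ 2 * T.vecNorm0 (S.Q μ) ^ 2)) := by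
    refine le_trans (le_of_eq ?_) (mul_le_mul_of_nonneg_left
      (Method.sum_errorIndicator_le hT.meshSize_pos h1 h3 hμ) hC.le)
    rw [Finset.mul_sum, Finset.mul_sum]
    refine Finset.sum_congr rfl fun s _ => ?_
    have hη := S.errorIndicator_nonneg μ s
    rw [hE, Real.sq_sqrt (by positivity), mul_div_cancel₀ _ hh.ne']
  calc T.meshSize ^ d * ∑ s ∈ T.cells, (9 * ∑ t ∈ T.neighbours s, E t) ^ 2
      = 81 * (T.meshSize ^ d * ∑ s ∈ T.cells, (∑ t ∈ T.neighbours s, E t) ^ 2) := by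
        simp only [mul_pow, ← Finset.mul_sum]
        ring
    _ ≤ 81 * (T.meshSize ^ d * (((4 * ρ) ^ d) ^ 2 * ∑ s ∈ T.cells, E s ^ 2)) := by
        gcongr
        exact sum_sq_sum_neighbours_le (fun s hs => hT.card_neighbours_le hρ hs) E
    _ = 81 * ((4 * ρ) ^ d) ^ 2 * (T.meshSize ^ d * ∑ s ∈ T.cells, E s ^ 2) := by ring
    _ ≤ 81 * ((4 * ρ) ^ d) ^ 2 * (C * ((2 * K ^ 4 + 2 + K ^ 2) *
          (T.meshSize ^ 2 * T.vecNorm0 (S.Q μ) ^ 2))) := by gcongr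
    _ = _ := by ring

end HDG

/-! ### Dirichlet energy and the energy of skeletal functions -/

namespace HDG

variable {d k p : ℕ} {Ω : Set (Pt d)}

lemma hull_ae_eq_interior (s : Finset (Pt d)) :
    hull s =ᵐ[(volume : Measure (Pt d))] interior (hull s) :=
  (interior_ae_eq_of_null_frontier (convex_hull.addHaar_frontier volume)).symm

lemma cellInt_eq_setIntegral_interior (s : Finset (Pt d)) (f : Pt d → ℝ) :
    cellInt s f = ∫ x in interior (hull s), f x :=
  setIntegral_congr_set (hull_ae_eq_interior s)

lemma abs_linear_apply_le {f : Pt d →ᵃ[ℝ] ℝ} {c : Pt d} {r M : ℝ} (hr : 0 < r)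
    (hosc : ∀ y ∈ Metric.closedBall c r, |f y - f c| ≤ M) (v : Pt d) :
    |f.linear v| ≤ M / r * ‖v‖ := by
  rcases eq_or_ne v 0 with rfl | hv
  · simp
  have hv_pos : 0 < ‖v‖ := norm_pos_iff.2 hv
  have hmem : (r / ‖v‖) • v + c ∈ Metric.closedBall c r := by
    rw [Metric.mem_closedBall, dist_eq_norm, add_sub_cancel_right, norm_smul, Real.norm_eq_abs,
      abs_of_pos (by positivity), div_mul_cancel₀ _ hv_pos.ne']
  have hdiff : f ((r / ‖v‖) • v + c) - f c = r / ‖v‖ * f.linear v := by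
    rw [← vadd_eq_add, f.map_vadd, vadd_eq_add, add_sub_cancel_right, map_smul, smul_eq_mul]
  have hscaled := hosc _ hmem
  rw [hdiff, abs_mul, abs_of_pos (by positivity), div_mul_eq_mul_div, div_le_iff₀ hv_pos] at hscaled
  rwa [div_mul_eq_mul_div, le_div_iff₀' hr]

lemma mul_norm_gradient_le {f : Pt d →ᵃ[ℝ] ℝ} {c : Pt d} {r M : ℝ} (hr : 0 < r)
    (hosc : ∀ y ∈ Metric.closedBall c r, |f y - f c| ≤ M) (x : Pt d) :
    r * ‖gradient f x‖ ≤ M := by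
  have hM : 0 ≤ M := (abs_nonneg _).trans (hosc c (Metric.mem_closedBall_self hr.le))
  have hlip : LipschitzWith (M / r).toNNReal f := LipschitzWith.of_dist_le_mul fun y z => by
    rw [Real.coe_toNNReal _ (by positivity), Real.dist_eq, dist_eq_norm, ← vsub_eq_sub (f y),
      ← f.linearMap_vsub]
    exact abs_linear_apply_le hr hosc _
  have hgrad := norm_gradient_le_of_lipschitzWith hlip x
  rwa [Real.coe_toNNReal _ (by positivity), le_div_iff₀' hr] at hgrad

namespace SimplicialMesh

variable {T : SimplicialMesh Ω} {w : Pt d → ℝ} {ρ : ℝ} {s : Finset (Pt d)}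

lemma sum_cellInt (T : SimplicialMesh Ω) {f : Pt d → ℝ} (hf : IntegrableOn f (closure Ω)) :
    ∑ s ∈ T.cells, cellInt s f = ∫ x in closure Ω, f x := by
  have hunion : (⋃ s ∈ T.cells, interior (hull s)) =ᵐ[(volume : Measure (Pt d))] closure Ω := by
    rw [← T.cover]
    exact Filter.EventuallyEq.countable_bUnion T.cells.countable_toSet fun s _ =>
      (hull_ae_eq_interior s).symm
  rw [← setIntegral_congr_set hunion, integral_biUnion_finset _
    (fun s _ => isOpen_interior.measurableSet) T.pairwiseDisjoint_interior
    (fun s hs => hf.mono_set (interior_subset.trans (T.hull_subset hs)))]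
  exact Finset.sum_congr rfl fun s _ => cellInt_eq_setIntegral_interior s f

/-- The Dirichlet energy of a function on the domain, computed cell by cell. -/
noncomputable def dirichletEnergy (T : SimplicialMesh Ω) (w : Pt d → ℝ) : ℝ :=
  ∑ s ∈ T.cells, cellInt s fun x => ‖gradient w x‖ ^ 2

lemma dirichletEnergy_eq_integral (T : SimplicialMesh Ω) {K : NNReal} (hw : LipschitzWith K w) :
    T.dirichletEnergy w = ∫ x in closure Ω, ‖gradient w x‖ ^ 2 := by
  refine T.sum_cellInt (Measure.integrableOn_of_bounded (M := (K : ℝ) ^ 2)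
    T.isBounded.closure.measure_lt_top.ne
    ((measurable_gradient w).norm.pow_const 2).aestronglyMeasurable
    (Eventually.of_forall fun x => ?_))
  rw [norm_pow, norm_norm]
  gcongr
  exact norm_gradient_le_of_lipschitzWith hw x

lemma volume_hull_le_meshSize_pow (hs : s ∈ T.cells) :
    volume.real (hull s) ≤ T.meshSize ^ d * ballVol d := by
  obtain ⟨x, hx⟩ := (T.isSimplex hs).nonempty
  exact volume_hull_le T.meshSize_nonneg
    (hull_subset_closedBall (diam_le_meshSize hs) (subset_convexHull ℝ _ hx))

lemma IsUniform.meshSize_mul_norm_gradient_le (hT : T.IsUniform ρ) (hρ : 0 < ρ)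
    (hw : T.IsConformingAffine w) (hs : s ∈ T.cells) {M : ℝ}
    (hosc : ∀ y ∈ hull s, ∀ z ∈ hull s, |w y - w z| ≤ M) {x : Pt d} (hx : x ∈ interior (hull s)) :
    T.meshSize * ‖gradient w x‖ ≤ ρ * M := by
  obtain ⟨f, hf⟩ := hw.affine s hs
  obtain ⟨c, hc⟩ := hT.exists_closedBall_subset s hs
  have hr : 0 < T.meshSize / ρ := div_pos hT.meshSize_pos hρ
  have hgrad : gradient w x = gradient f x := gradient_eq_of_eventually (c := 0) <| by
    filter_upwards [mem_interior_iff_mem_nhds.1 hx] with z hz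
    rw [hf hz, add_zero]
  have hbound := mul_norm_gradient_le (f := f) hr (M := M) (fun y hy => by
    have hcs := hc (Metric.mem_closedBall_self hr.le)
    rw [← hf (hc hy), ← hf hcs]
    exact hosc y (hc hy) c hcs) x
  rwa [hgrad, ← div_le_iff₀' hρ, ← div_mul_eq_mul_div]

lemma IsUniform.sq_mul_dirichletEnergy_le (hT : T.IsUniform ρ) (hρ : 0 < ρ)
    (hw : T.IsConformingAffine w) {G : Finset (Pt d) → ℝ}
    (hosc : ∀ s ∈ T.cells, ∀ y ∈ hull s, ∀ z ∈ hull s, |w y - w z| ≤ G s) :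
    T.meshSize ^ 2 * T.dirichletEnergy w
      ≤ ρ ^ 2 * ballVol d * (T.meshSize ^ d * ∑ s ∈ T.cells, G s ^ 2) := by
  rw [dirichletEnergy, Finset.mul_sum, Finset.mul_sum, Finset.mul_sum]
  refine Finset.sum_le_sum fun s hs => ?_
  have hgrad : ∀ x ∈ interior (hull s), T.meshSize ^ 2 * ‖gradient w x‖ ^ 2 ≤ ρ ^ 2 * G s ^ 2 :=
    fun x hx => by
      rw [← mul_pow, ← mul_pow]
      exact pow_le_pow_left₀ (mul_nonneg T.meshSize_nonneg (norm_nonneg _))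
        (hT.meshSize_mul_norm_gradient_le hρ hw hs (hosc s hs) hx) 2
  have hfin : volume (interior (hull s)) < ⊤ :=
    (measure_mono interior_subset).trans_lt isCompact_hull.measure_lt_top
  calc T.meshSize ^ 2 * cellInt s (fun x => ‖gradient w x‖ ^ 2)
      = ∫ x in interior (hull s), T.meshSize ^ 2 * ‖gradient w x‖ ^ 2 := by
        rw [cellInt_eq_setIntegral_interior, integral_const_mul]
    _ ≤ ∫ _ in interior (hull s), ρ ^ 2 * G s ^ 2 := by
        refine integral_mono_of_nonneg (Eventually.of_forall fun x => by positivity)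
          (integrableOn_const hfin.ne) ?_
        filter_upwards [ae_restrict_mem isOpen_interior.measurableSet] with x hx using hgrad x hx
    _ = volume.real (hull s) * (ρ ^ 2 * G s ^ 2) := by
        rw [setIntegral_const, smul_eq_mul, measureReal_congr (hull_ae_eq_interior s)]
    _ ≤ T.meshSize ^ d * ballVol d * (ρ ^ 2 * G s ^ 2) := by
        gcongr
        exact volume_hull_le_meshSize_pow hs
    _ = _ := by ring

lemma IsUniform.skelNorm_sub_trace_sq_le (hT : T.IsUniform ρ) (hd : 1 ≤ d) (hρ : 0 < ρ)
    {μ : Set (Pt d) → Pt d → ℝ} (hμ : μ ∈ T.skeletal p) (hw : T.trace w ∈ T.skeletal p)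
    {G : Finset (Pt d) → ℝ}
    (hjump : ∀ s ∈ T.cells, ∀ v ∈ s, ∀ y ∈ facet s v, |w y - μ (facet s v) y| ≤ G s) :
    T.skelNorm (μ - T.trace w) ^ 2
      ≤ ballVol d * (T.meshSize ^ d * ∑ s ∈ T.cells, G s ^ 2) := by
  rw [skelNorm, bdryNorm_sq, Finset.mul_sum, Finset.mul_sum]
  refine Finset.sum_le_sum fun s hs => ?_
  obtain ⟨c, hc⟩ := hT.exists_closedBall_subset s hs
  have hfacet : ∀ v ∈ s, facetInt (facet s v) (fun x => (μ - T.trace w) (facet s v) x ^ 2)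
      ≤ G s ^ 2 * facetInt (facet s v) fun _ => 1 := fun v hv => by
    rw [facetInt, facetInt, ← integral_const_mul]
    refine (T.isSimplex hs).facetInt_mono hd hv
      ((T.continuousOn_facet (sub_mem hμ hw) hs hv).pow 2) continuousOn_const fun x hx => ?_
    rw [Pi.sub_apply, Pi.sub_apply, trace_apply hs hv hx, mul_one]
    exact sq_le_sq' (by linarith [(abs_le.1 (hjump s hs v hv x hx)).2])
      (by linarith [(abs_le.1 (hjump s hs v hv x hx)).1])
  calc cellRatio s * ∑ v ∈ s, facetInt (facet s v) (fun x => (μ - T.trace w) (facet s v) x ^ 2)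
      ≤ cellRatio s * (G s ^ 2 * ∑ v ∈ s, facetInt (facet s v) fun _ => 1) := by
        rw [Finset.mul_sum (a := G s ^ 2)]
        exact mul_le_mul_of_nonneg_left (Finset.sum_le_sum hfacet) (cellRatio_nonneg s)
    _ = volume.real (hull s) * G s ^ 2 := by
        rw [mul_left_comm, (T.isSimplex hs).cellRatio_mul_sum_facetInt_one hd
          (div_pos hT.meshSize_pos hρ) hc, mul_comm]
    _ ≤ T.meshSize ^ d * ballVol d * G s ^ 2 := by
        gcongr
        exact volume_hull_le_meshSize_pow hs
    _ = _ := by ring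

end SimplicialMesh

open SimplicialMesh

namespace Method

variable {T : SimplicialMesh Ω} {S : Method k T} {μ : Set (Pt d) → Pt d → ℝ} {K : ℝ}

lemma LS4.energyForm_trace (h4 : S.LS4 p) {w : Pt d → ℝ} (hw : w ∈ T.conforming)
    (htrace : T.trace w ∈ T.skeletal p) :
    S.energyForm (T.trace w) (T.trace w) = T.dirichletEnergy w := by
  have hsol := h4 w hw _ htrace rfl
  have hstab : ∑ s ∈ T.cells, ∑ v ∈ s, facetInt (facet s v) (fun x =>
      S.τ * (polyFun (S.U (T.trace w) s) x - T.trace w (facet s v) x) *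
        (polyFun (S.U (T.trace w) s) x - T.trace w (facet s v) x)) = 0 := by
    refine Finset.sum_eq_zero fun s hs => Finset.sum_eq_zero fun v hv => ?_
    rw [facetInt_congr (g := fun _ => 0)]
    · exact integral_zero _ _
    · intro x hx
      simp only [(hsol s hs).2 x (facet_subset_hull hx), trace_apply hs hv hx, sub_self, mul_zero]
  rw [energyForm, hstab, add_zero]
  refine Finset.sum_congr rfl fun s hs => ?_
  rw [cellInt_eq_setIntegral_interior, cellInt_eq_setIntegral_interior]
  refine setIntegral_congr_fun isOpen_interior.measurableSet fun x hx => ?_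
  rw [EuclideanSpace.real_norm_sq_eq]
  simp only [(hsol s hs).1 x hx, neg_mul_neg, sq]

lemma energyForm_self (S : Method k T) (μ : Set (Pt d) → Pt d → ℝ) :
    S.energyForm μ μ = T.vecNorm0 (S.Q μ) ^ 2 + S.τ * ∑ s ∈ T.cells, ∑ v ∈ s,
      facetInt (facet s v) fun x => (polyFun (S.U μ s) x - μ (facet s v) x) ^ 2 := by
  rw [energyForm, vecNorm0_sq]
  simp only [facetInt, Finset.mul_sum, ← integral_const_mul, sq, mul_assoc]

lemma vecNorm0_sq_le_energyForm (S : Method k T) (μ : Set (Pt d) → Pt d → ℝ) :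
    T.vecNorm0 (S.Q μ) ^ 2 ≤ S.energyForm μ μ := by
  rw [energyForm_self]
  exact le_add_of_nonneg_right (mul_nonneg S.τ_nonneg (Finset.sum_nonneg fun s _ =>
    Finset.sum_nonneg fun v _ => facetInt_nonneg fun x => sq_nonneg _))

lemma LS1.energyForm_self_le {c : ℝ} (h1 : S.LS1 p K) (hh : 0 < T.meshSize) (hc : 0 < c)
    (hratio : ∀ s ∈ T.cells, c * T.meshSize ≤ cellRatio s) (hτ : S.τ * T.meshSize ≤ K)
    (hμ : μ ∈ T.skeletal p) : S.energyForm μ μ ≤ (1 + K ^ 3 / c) * T.vecNorm0 (S.Q μ) ^ 2 := by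
  set N := T.vecNorm0 (S.Q μ) ^ 2
  set J := ∑ s ∈ T.cells, ∑ v ∈ s,
    facetInt (facet s v) fun x => (polyFun (S.U μ s) x - μ (facet s v) x) ^ 2
  have hJ : c * T.meshSize * J ≤ K ^ 2 * (T.meshSize ^ 2 * N) := by
    refine le_trans ?_ (h1.traceError_sq_le hμ)
    rw [traceError, bdryNorm_sq, Finset.mul_sum]
    exact Finset.sum_le_sum fun s hs => mul_le_mul_of_nonneg_right (hratio s hs)
      (Finset.sum_nonneg fun _ _ => facetInt_nonneg fun _ => sq_nonneg _)
  have hJ' : J ≤ K ^ 2 * (T.meshSize * N) / c := by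
    rw [le_div_iff₀' hc]
    refine le_of_mul_le_mul_right ?_ hh
    linarith
  calc S.energyForm μ μ = N + S.τ * J := S.energyForm_self μ
    _ ≤ N + S.τ * (K ^ 2 * (T.meshSize * N) / c) := by
        gcongr
        exact S.τ_nonneg
    _ = N + S.τ * T.meshSize * (K ^ 2 * N / c) := by ring
    _ ≤ N + K * (K ^ 2 * N / c) := by gcongr
    _ = (1 + K ^ 3 / c) * N := by ring

end Method

end HDG

/-! ### Definiteness and stability of the injection -/

namespace HDG

open SimplicialMesh

variable {d k p : ℕ} {Ω : Set (Pt d)} {K ρ : ℝ}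

section OneMesh

variable {T : SimplicialMesh Ω} {S : Method k T} {μ : Set (Pt d) → Pt d → ℝ}

lemma SimplicialMesh.HasOscJumpBound.eq_zero {w : Pt d → ℝ} {G : Finset (Pt d) → ℝ}
    (h : T.HasOscJumpBound μ (fun _ => w) G) (hG : ∀ s ∈ T.cells, G s = 0) (hd : 1 ≤ d)
    (hΩ : IsOpen Ω) (hw : T.IsConformingAffine w) (hμ : μ ∈ T.skeletal p) : μ = 0 := by
  have hw_zero : w = 0 := eq_zero_of_const_on_cells (T := T) hd hΩ hw.eq_zero
    fun s hs x hx y hy => sub_eq_zero.1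
      (abs_nonpos_iff.1 ((h.osc s hs x hx y hy).trans_eq (hG s hs)))
  funext F
  by_cases hF : F ∈ T.faces
  · obtain ⟨q, -, hq⟩ := hμ.1 F hF
    obtain ⟨s, hs, v, hv, rfl⟩ := hF
    funext x
    by_cases hx : x ∈ facet s v
    · simpa [hw_zero, hG s hs] using h.jump s hs v hv x hx
    · rw [hq, indicator_of_notMem hx]
      rfl
  · exact hμ.2.2 F hF

lemma Method.eq_zero_of_energyForm_self_eq_zero (hd : 1 ≤ d) (hρ : 0 < ρ) (hΩ : IsOpen Ω)
    (hreg : interior (closure Ω) = Ω) (hT : T.IsUniform ρ) (hS : S.WellPosed p) (h1 : S.LS1 p K)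
    (h3 : S.LS3 p K) (hμ : μ ∈ T.skeletal p) (h0 : S.energyForm μ μ = 0) : μ = 0 := by
  obtain ⟨C, -, happrox⟩ := exists_conforming_approximation d p k hd hρ K
  obtain ⟨w, G, hw, hwG, hG⟩ := happrox hΩ hreg hT hS h1 h3 μ hμ
  have hQ : T.vecNorm0 (S.Q μ) ^ 2 = 0 :=
    le_antisymm ((S.vecNorm0_sq_le_energyForm μ).trans_eq h0) (sq_nonneg _)
  rw [hQ, mul_zero, mul_zero] at hG
  have hsum : ∑ s ∈ T.cells, G s ^ 2 = 0 :=
    le_antisymm (nonpos_of_mul_nonpos_right hG (pow_pos hT.meshSize_pos d))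
      (Finset.sum_nonneg fun _ _ => sq_nonneg _)
  exact hwG.eq_zero (fun s hs => pow_eq_zero_iff two_ne_zero |>.1
    ((Finset.sum_eq_zero_iff_of_nonneg fun _ _ => sq_nonneg _).1 hsum s hs)) hd hΩ hw hμ

lemma Method.WellPosed.energyForm_add_le (hS : S.WellPosed p) (hd : 1 ≤ d) (x y : T.skeletal p) :
    S.energyForm (x + y).1 (x + y).1 ≤ 2 * S.energyForm x.1 x.1 + 2 * S.energyForm y.1 y.1 := by
  have hsub : 0 ≤ hS.form hd (x - y) (x - y) := S.energyForm_self_nonneg _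
  simp only [← hS.form_apply hd, map_sub, map_add, LinearMap.sub_apply, LinearMap.add_apply]
    at hsub ⊢
  linarith

lemma exists_trace_approximation (d p k : ℕ) (hd : 1 ≤ d) (hp : 1 ≤ p) (hρ : 0 < ρ) (K : ℝ) :
    ∃ C : ℝ, 0 < C ∧ ∀ {Ω : Set (Pt d)}, IsOpen Ω → interior (closure Ω) = Ω →
      ∀ {T : SimplicialMesh Ω}, T.IsUniform ρ →
      ∀ {S : Method k T}, S.WellPosed p → S.LS1 p K → S.LS3 p K → ∀ μ ∈ T.skeletal p,
      ∃ w, T.IsConformingAffine w ∧ T.dirichletEnergy w ≤ C * T.vecNorm0 (S.Q μ) ^ 2 ∧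
        T.skelNorm (μ - T.trace w) ^ 2 ≤ C * (T.meshSize ^ 2 * T.vecNorm0 (S.Q μ) ^ 2) := by
  obtain ⟨C, hC, happrox⟩ := exists_conforming_approximation d p k hd hρ K
  have hb := ballVol_pos d
  refine ⟨(ρ ^ 2 + 1) * ballVol d * C, by positivity,
    fun {Ω} hΩ hreg {T} hT {S} hS h1 h3 μ hμ => ?_⟩
  obtain ⟨w, G, hw, hwG, hG⟩ := happrox hΩ hreg hT hS h1 h3 μ hμ
  have hh := hT.meshSize_pos
  refine ⟨w, hw, le_of_mul_le_mul_left ?_ (pow_pos hh 2), ?_⟩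
  · calc T.meshSize ^ 2 * T.dirichletEnergy w
        ≤ ρ ^ 2 * ballVol d * (T.meshSize ^ d * ∑ s ∈ T.cells, G s ^ 2) :=
          hT.sq_mul_dirichletEnergy_le hρ hw hwG.osc
      _ ≤ (ρ ^ 2 + 1) * ballVol d * (C * (T.meshSize ^ 2 * T.vecNorm0 (S.Q μ) ^ 2)) := by
          gcongr
          exact le_add_of_nonneg_right zero_le_one
      _ = _ := by ring
  · calc T.skelNorm (μ - T.trace w) ^ 2
        ≤ ballVol d * (T.meshSize ^ d * ∑ s ∈ T.cells, G s ^ 2) :=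
          hT.skelNorm_sub_trace_sq_le hd hρ hμ (hw.trace_mem_skeletal hΩ hp) hwG.jump
      _ ≤ (ρ ^ 2 + 1) * ballVol d * (C * (T.meshSize ^ 2 * T.vecNorm0 (S.Q μ) ^ 2)) := by
          gcongr
          exact le_mul_of_one_le_left hb.le (le_add_of_nonneg_left (sq_nonneg ρ))
      _ = _ := by ring

end OneMesh

section TwoMeshes

variable {Tc Tf : SimplicialMesh Ω} {Sf : Method k Tf} {I : Tc.skeletal p →ₗ[ℝ] Tf.skeletal p}

lemma IA2.energyForm_trace (hI : IA2 I) (h4 : Sf.LS4 p) (href : Tf.Refines Tc) (hΩ : IsOpen Ω)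
    {w : Pt d → ℝ} (hw : Tc.IsConformingAffine w) (hμ : Tc.trace w ∈ Tc.skeletal p) :
    Sf.energyForm (I ⟨Tc.trace w, hμ⟩).1 (I ⟨Tc.trace w, hμ⟩).1 = Tc.dirichletEnergy w := by
  have hIw : (I ⟨Tc.trace w, hμ⟩).1 = Tf.trace w := hI w (hw.mem_conforming hΩ) _ rfl
  obtain ⟨L, hL⟩ := hw.exists_lipschitzWith hΩ
  rw [hIw, h4.energyForm_trace ((hw.of_refines href).mem_conforming hΩ) (hIw ▸ (I _).2),
    Tf.dirichletEnergy_eq_integral hL, Tc.dirichletEnergy_eq_integral hL]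

lemma IA1.sq_mul_vecNorm0_Q_sq_le (hI : IA1 I K) {cref : ℝ} (hcref : 0 < cref)
    (hmesh : cref * Tc.meshSize ≤ Tf.meshSize) (hTf : 0 < Tf.meshSize)
    (hQ : ∀ μ ∈ Tf.skeletal p, Tf.vecNorm0 (Sf.Q μ) ≤ K * (Tf.meshSize⁻¹ * Tf.skelNorm μ))
    (ν : Tc.skeletal p) :
    Tc.meshSize ^ 2 * Tf.vecNorm0 (Sf.Q (I ν).1) ^ 2
      ≤ (K ^ 2 / cref) ^ 2 * Tc.skelNorm ν.1 ^ 2 := by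
  have hQ_sq : Tf.vecNorm0 (Sf.Q (I ν).1) ^ 2
      ≤ (K * (Tf.meshSize⁻¹ * Tf.skelNorm (I ν).1)) ^ 2 :=
    pow_le_pow_left₀ (Real.sqrt_nonneg _) (hQ _ (I ν).2) 2
  have hI_sq : Tf.skelNorm (I ν).1 ^ 2 ≤ (K * Tc.skelNorm ν.1) ^ 2 :=
    pow_le_pow_left₀ (Real.sqrt_nonneg _) (hI ν) 2
  have hratio : Tc.meshSize / Tf.meshSize ≤ 1 / cref := by
    rw [div_le_div_iff₀ hTf hcref]
    linarith
  have hTc := Tc.meshSize_nonneg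
  calc Tc.meshSize ^ 2 * Tf.vecNorm0 (Sf.Q (I ν).1) ^ 2
      ≤ Tc.meshSize ^ 2 * (K * (Tf.meshSize⁻¹ * Tf.skelNorm (I ν).1)) ^ 2 :=
        mul_le_mul_of_nonneg_left hQ_sq (sq_nonneg _)
    _ = K ^ 2 * (Tc.meshSize / Tf.meshSize) ^ 2 * Tf.skelNorm (I ν).1 ^ 2 := by ring
    _ ≤ K ^ 2 * (1 / cref) ^ 2 * (K * Tc.skelNorm ν.1) ^ 2 := by
        refine mul_le_mul ?_ hI_sq (sq_nonneg _) (by positivity)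
        gcongr
    _ = (K ^ 2 / cref) ^ 2 * Tc.skelNorm ν.1 ^ 2 := by ring

lemma IA1.sq_mul_energyForm_le (hI : IA1 I K) {c cref : ℝ} (hcref : 0 < cref)
    (hmesh : cref * Tc.meshSize ≤ Tf.meshSize) (hTf : 0 < Tf.meshSize) (hc : 0 < c)
    (hratio : ∀ s ∈ Tf.cells, c * Tf.meshSize ≤ cellRatio s) (h1 : Sf.LS1 p K)
    (hQ : ∀ μ ∈ Tf.skeletal p, Tf.vecNorm0 (Sf.Q μ) ≤ K * (Tf.meshSize⁻¹ * Tf.skelNorm μ))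
    (hK : 0 ≤ K) (hτ : Sf.τ * Tf.meshSize ≤ K) (ν : Tc.skeletal p) :
    Tc.meshSize ^ 2 * Sf.energyForm (I ν).1 (I ν).1
      ≤ (1 + K ^ 3 / c) * ((K ^ 2 / cref) ^ 2 * Tc.skelNorm ν.1 ^ 2) :=
  calc Tc.meshSize ^ 2 * Sf.energyForm (I ν).1 (I ν).1
      ≤ Tc.meshSize ^ 2 * ((1 + K ^ 3 / c) * Tf.vecNorm0 (Sf.Q (I ν).1) ^ 2) := by
        gcongr
        exact h1.energyForm_self_le hTf hc hratio hτ (I ν).2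
    _ = (1 + K ^ 3 / c) * (Tc.meshSize ^ 2 * Tf.vecNorm0 (Sf.Q (I ν).1) ^ 2) := by ring
    _ ≤ (1 + K ^ 3 / c) * ((K ^ 2 / cref) ^ 2 * Tc.skelNorm ν.1 ^ 2) :=
        mul_le_mul_of_nonneg_left (hI.sq_mul_vecNorm0_Q_sq_le hcref hmesh hTf hQ ν) (by positivity)

end TwoMeshes

lemma exists_energyForm_injection_le (d p k : ℕ) (hd : 1 ≤ d) (hp : 1 ≤ p) (hρ : 0 < ρ) {cref : ℝ}
    (hcref : 0 < cref) (K : ℝ) : ∃ C : ℝ, ∀ {Ω : Set (Pt d)}, IsOpen Ω → interior (closure Ω) = Ω →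
      ∀ {Tc Tf : SimplicialMesh Ω}, Tc.IsUniform ρ → Tf.IsUniform ρ → Tf.Refines Tc →
      cref * Tc.meshSize ≤ Tf.meshSize →
      ∀ {Sc : Method k Tc} {Sf : Method k Tf}, Sc.WellPosed p → Sf.WellPosed p →
      Sc.LS1 p K → Sf.LS1 p K →
      (∀ μ ∈ Tf.skeletal p, Tf.vecNorm0 (Sf.Q μ) ≤ K * (Tf.meshSize⁻¹ * Tf.skelNorm μ)) →
      Sc.LS3 p K → Sf.LS4 p → Sf.τ * Tf.meshSize ≤ K →
      ∀ {I : Tc.skeletal p →ₗ[ℝ] Tf.skeletal p}, IA1 I K → IA2 I →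
      ∀ μ, Sf.energyForm (I μ).1 (I μ).1 ≤ C * Sc.energyForm μ.1 μ.1 := by
  obtain ⟨c, hc, hratio⟩ := exists_mul_le_cellRatio d hd hρ
  obtain ⟨C, hC, happrox⟩ := exists_trace_approximation d p k hd hp hρ K
  refine ⟨2 * ((1 + K ^ 3 / c) * ((K ^ 2 / cref) ^ 2 * C)) + 2 * C, ?_⟩
  intro Ω hΩ hreg Tc Tf hTc hTf href hmesh Sc Sf hSc hSf h1c h1f hQ h3 h4 hτ I hI1 hI2 μ
  obtain ⟨w, hw, hdir, hskel⟩ := happrox hΩ hreg hTc hSc h1c h3 μ.1 μ.2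
  have hK : 0 ≤ K := (mul_nonneg Sf.τ_nonneg hTf.meshSize_pos.le).trans hτ
  set γ : Tc.skeletal p := ⟨Tc.trace w, hw.trace_mem_skeletal hΩ hp⟩
  set N := Tc.vecNorm0 (Sc.Q μ.1) ^ 2
  have hremainder : Sf.energyForm (I (μ - γ)).1 (I (μ - γ)).1
      ≤ (1 + K ^ 3 / c) * ((K ^ 2 / cref) ^ 2 * C) * N := by
    have hratio_f : ∀ s ∈ Tf.cells, c * Tf.meshSize ≤ cellRatio s := fun s hs => by
      obtain ⟨x, hx⟩ := hTf.exists_closedBall_subset s hs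
      exact hratio s x _ (Tf.isSimplex hs) hTf.meshSize_pos (diam_le_meshSize hs) hx
    refine le_of_mul_le_mul_left ?_ (pow_pos hTc.meshSize_pos 2)
    calc Tc.meshSize ^ 2 * Sf.energyForm (I (μ - γ)).1 (I (μ - γ)).1
        ≤ (1 + K ^ 3 / c) * ((K ^ 2 / cref) ^ 2 * Tc.skelNorm (μ - γ).1 ^ 2) :=
          hI1.sq_mul_energyForm_le hcref hmesh hTf.meshSize_pos hc hratio_f h1f hQ hK hτ _
      _ ≤ (1 + K ^ 3 / c) * ((K ^ 2 / cref) ^ 2 * (C * (Tc.meshSize ^ 2 * N))) := by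
          gcongr
          exact hskel
      _ = _ := by ring
  calc Sf.energyForm (I μ).1 (I μ).1
      = Sf.energyForm (I (μ - γ) + I γ).1 (I (μ - γ) + I γ).1 := by
        rw [← map_add, sub_add_cancel]
    _ ≤ 2 * Sf.energyForm (I (μ - γ)).1 (I (μ - γ)).1 + 2 * Sf.energyForm (I γ).1 (I γ).1 :=
        hSf.energyForm_add_le hd _ _
    _ ≤ 2 * ((1 + K ^ 3 / c) * ((K ^ 2 / cref) ^ 2 * C) * N) + 2 * (C * N) := by
        rw [hI2.energyForm_trace h4 href hΩ hw]
        gcongr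
    _ = (2 * ((1 + K ^ 3 / c) * ((K ^ 2 / cref) ^ 2 * C)) + 2 * C) * N := by ring
    _ ≤ _ := by
        gcongr
        exact Sc.vecNorm0_sq_le_energyForm μ.1

end HDG

theorem mainTheorem3_general (d : ℕ) (hd : 1 ≤ d) (p : ℕ) (hp : 1 ≤ p) (k : ℕ)
    (σ κ cref K : ℝ) (hcref : 0 < cref) :
    ∃ C : ℝ, 0 < C ∧
      ∀ (Ω : Set (HDG.Pt d)), IsOpen Ω → Ω.Nonempty → interior (closure Ω) = Ω →
      ∀ (Tc Tf : HDG.SimplicialMesh Ω),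
        Tc.ShapeRegular σ → Tf.ShapeRegular σ → Tc.QuasiUniform κ → Tf.QuasiUniform κ →
        Tf.Refines Tc → cref * Tc.meshSize ≤ Tf.meshSize →
      ∀ (Sc : HDG.Method k Tc) (Sf : HDG.Method k Tf),
        Sc.WellPosed p → Sf.WellPosed p → Sc.LS1 p K → Sf.LS1 p K →
        (∀ μ ∈ Tf.skeletal p, Tf.vecNorm0 (Sf.Q μ) ≤ K * (Tf.meshSize⁻¹ * Tf.skelNorm μ)) →
        Sc.LS3 p K → Sf.LS4 p → Sf.τ * Tf.meshSize ≤ K →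
      ∀ (I : Tc.skeletal p →ₗ[ℝ] Tf.skeletal p), HDG.IA1 I K → HDG.IA2 I →
      ∀ μ : Tf.skeletal p,
        (∃! ν, HDG.IsRitz Sc Sf I μ ν) ∧
        Sf.energyNorm (μ - I (HDG.ritz Sc Sf I μ) : Tf.skeletal p).1 ≤ C * Sf.energyNorm μ.1 := by
  have hρ : 0 < max (κ * σ) 1 := lt_max_of_lt_right one_pos
  obtain ⟨C, hC⟩ := HDG.exists_energyForm_injection_le d p k hd hp hρ hcref K
  refine ⟨1 + √C ^ 2, by positivity, ?_⟩
  intro Ω hΩ hne hreg Tc Tf hσc hσf hκc hκf href hmesh Sc Sf hSc hSf h1c h1f hQ h3 h4 hτ I hI1 hI2 μ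
  have hTc := hσc.isUniform hκc hd hne hρ (le_max_left _ _)
  have hTf := hσf.isUniform hκf hd hne hρ (le_max_left _ _)
  have hstable : ∀ ν, √(hSf.form hd (I ν) (I ν)) ≤ √C * √(hSc.form hd ν ν) := fun ν => by
    have hnonneg : 0 ≤ hSc.form hd ν ν := Sc.energyForm_self_nonneg ν.1
    rw [← Real.sqrt_mul' C hnonneg]
    exact Real.sqrt_le_sqrt
      (hC hΩ hreg hTc hTf href hmesh hSc hSf h1c h1f hQ h3 h4 hτ hI1 hI2 ν)
  have hunique : ∃! ν, HDG.IsRitz Sc Sf I μ ν :=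
    HDG.existsUnique_forall_apply_eq (a := hSc.form hd) (fun ν hν => Subtype.ext
      (HDG.Method.eq_zero_of_energyForm_self_eq_zero hd hρ hΩ hreg hTc hSc h1c h3 ν.2 hν))
      (hSf.form hd μ ∘ₗ I)
  exact ⟨hunique, HDG.sqrt_apply_sub_ritz_le (a := hSc.form hd) (b := hSf.form hd)
    (fun ν => Sc.energyForm_self_nonneg ν.1) (fun ν => Sf.energyForm_self_nonneg ν.1)
    ⟨fun μ ν => Sf.energyForm_comm μ.1 ν.1⟩ (Real.sqrt_nonneg C) hstable
    (Classical.epsilon_spec hunique.exists)⟩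

theorem mainTheorem3 (d : ℕ) (hd : 1 ≤ d) (p : ℕ) (hp : 1 ≤ p) (k : ℕ)
    (σ κ cref K : ℝ) (hcref : 0 < cref) :
    ∃ C : ℝ, 0 < C ∧
      ∀ (Ω : Set (HDG.Pt d)), HDG.IsLipschitzDomain Ω →
      ∀ (L : ℕ) (T : Fin (L + 1) → HDG.SimplicialMesh Ω),
        (∀ l, (T l).ShapeRegular σ) →
        (∀ l, (T l).QuasiUniform κ) →
        (∀ l : Fin L, (T l.succ).Refines (T l.castSucc)) →
        (∀ l : Fin L, cref * (T l.castSucc).meshSize ≤ (T l.succ).meshSize) →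
      ∀ (S : ∀ l, HDG.Method k (T l)),
        (∀ l, (S l).WellPosed p) →
        (∀ l, (S l).LS1 p K) →
        (∀ l, (S l).LS2 p K) →
        (∀ l, (S l).LS3 p K) →
        (∀ l, (S l).LS4 p) →
        (∀ l, (S l).τ * (T l).meshSize ≤ K) →
      ∀ (I : ∀ l : Fin L, (T l.castSucc).skeletal p →ₗ[ℝ] (T l.succ).skeletal p),
        (∀ l, HDG.IA1 (I l) K) →
        (∀ l, HDG.IA2 (I l)) →
      ∀ (l : Fin L) (μ : (T l.succ).skeletal p),
        (∃! ν, HDG.IsRitz (S l.castSucc) (S l.succ) (I l) μ ν) ∧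
        (S l.succ).energyNorm
            (μ - I l (HDG.ritz (S l.castSucc) (S l.succ) (I l) μ) : (T l.succ).skeletal p).1
          ≤ C * (S l.succ).energyNorm μ.1 := by
  obtain ⟨C, hC, h⟩ := mainTheorem3_general d hd p hp k σ κ cref K hcref
  exact ⟨C, hC, fun Ω hΩ L T hσ hκ href hmesh S hS h1 h2 h3 h4 hτ I hI1 hI2 l =>
    h Ω hΩ.1 hΩ.2.1.nonempty hΩ.interior_closure _ _ (hσ _) (hσ _) (hκ _) (hκ _) (href l) (hmesh l)
      _ _ (hS _) (hS _) (h1 _) (h1 _) (fun μ hμ => (h2 _ μ hμ).1) (h3 _) (h4 _) (hτ _) _ (hI1 l)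
      (hI2 l)⟩
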